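/- Let $M$ be a smooth manifold and $\pi:E\to M$ a smooth real vector bundle of finite rank. Let $\mathcal M=(M,\mathcal O)$ be the supermanifold with $\mathcal O=\Gamma_{\Lambda E^*}$, and let $\mathcal T=\mathrm{Der}_{\mathbb R}(\mathcal O)$ be its sheaf of superderivations. Let $g$ be an odd Riemannian metric on $\mathcal M$: an odd supersymmetric $\mathcal O$-linear morphism of sheaves $\mathcal T\otimes_{\mathcal O}\mathcal T\to\mathcal O$ such that $X\mapsto g(X,\cdot)$ is an isomorphism from $\mathcal T$ to the parity reversal of $\mathrm{Hom}_{\mathcal O}(\mathcal T,\mathcal O)$; as $g$ is odd, linearity means $g(fX,Y)=(-1)^{|f|}f\,g(X,Y)$. Let $\nabla$ be a Levi-Civita connection of $g$: an even morphism of sheaves $\mathcal T\otimes_{\mathbb R}\mathcal T\to\mathcal T$, $X\otimes Y\mapsto\nabla_XY$, that is $\mathcal O$-linear in $X$ and satisfies, for all homogeneous $f,X,Y,Z$ over any open set, $$\nabla_X(fY)=X(f)Y+(-1)^{|X||f|}f\nabla_XY,\qquad \nabla_XY-(-1)^{|X||Y|}\nabla_YX=[X,Y],$$ $$(-1)^{|X|}X(g(Y,Z))=g(\nabla_XY,Z)+(-1)^{|X||Y|}g(Y,\nabla_XZ).$$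 For $f\in\mathcal O(U)$ with components $f_0,f_1$ of degree $0,1$ let $\psi(f)$ be the function $e\mapsto f_0(\pi(e))+f_1(\pi(e))(e)$ on $\pi^{-1}(U)$. Let $\mathcal F=\Gamma_{\mathbb R\oplus E^*}\subset\mathcal O$. For an even $Z\in\mathcal T(U)$ let $\Psi(Z)$ be the vector field on $\pi^{-1}(U)$ with $\Psi(Z)(\psi(s))=\psi(Z(s))$ for all local sections $s$ of $\mathcal F$ over open subsets of $U$. Let $\mathcal L_{\bar 0}$ be the sheaf of even superderivations that map $\mathcal F$ to $\mathcal F$. Then there are a unique smooth field $g^{TE}$ of symmetric bilinear forms on the tangent spaces of the manifold $E$ and a unique smooth connection $\nabla^{TE}$ on the tangent bundle of $E$ such that, for all open $U\subset M$ and all $X,Y\in\mathcal L_{\bar 0}(U)$, $$g^{TE}(\Psi(X),\Psi(Y))=\psi(g(X,Y)),\qquad \nabla^{TE}_{\Psi(X)}\Psi(Y)=\Psi(\nabla_XY)\qquad\text{on }\pi^{-1}(U).$$ Moreover $g^{TE}$ is non-degenerate, i.e. a pseudo-Riemannian metric on $E$, and $\nabla^{TE}$ is the Levi-Civita connection of $g^{TE}$: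 it is torsion-free and compatible with $g^{TE}$. -/

import Mathlib

open Bundle TopologicalSpace
open scoped Manifold ContDiff

namespace Batchelor

noncomputable section

/-- The sign `(-1)^p` of a parity `p`. -/
def sgn (p : ZMod 2) : ℝ := (-1) ^ p.val

theorem sgn_sq (p : ZMod 2) : sgn p * sgn p = 1 := by
  rw [sgn, ← mul_pow]; norm_num

theorem sgn_add (p q : ZMod 2) : sgn (p + q) = sgn p * sgn q := by
  have h : ∀ n : ℕ, (-1 : ℝ) ^ n = (-1) ^ (n % 2) := fun n => neg_one_pow_eq_pow_mod_two n
  rw [sgn, sgn, sgn, ← pow_add, h (p.val + q.val), ZMod.val_add]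

theorem graded_leibniz_aux {A : Type*} [Ring A] [Algebra ℝ A] {f x y g k : A} {s t : ℝ}
    (hs : s * s = 1) (hc : g * f = s • (f * g)) :
    f * (x * k + t • (g * y)) = f * x * k + (t * s) • (g * (f * y)) := by
  rw [← mul_assoc g, hc, smul_mul_assoc, smul_smul, mul_assoc t, hs, mul_one, mul_add,
    mul_smul_comm, mul_assoc, mul_assoc]

theorem graded_comm {N : Type*} [AddCommGroup N] [Module ℝ N] {p q : ZMod 2}
    {a b : ExteriorAlgebra ℝ N}
    (ha : a ∈ CliffordAlgebra.evenOdd (0 : QuadraticForm ℝ N) p)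
    (hb : b ∈ CliffordAlgebra.evenOdd (0 : QuadraticForm ℝ N) q) :
    a * b = sgn (p * q) • (b * a) := by
  let i : (0 : QuadraticForm ℝ N) →qᵢ (0 : QuadraticForm ℝ N) := QuadraticMap.Isometry.id 0
  have ho : ∀ m₁ m₂ : N, QuadraticMap.IsOrtho (0 : QuadraticForm ℝ N) (i m₁) (i m₂) :=
    fun _ _ => .all _ _
  have hid : ∀ c, CliffordAlgebra.map i c = c := fun c => by
    simp only [i, CliffordAlgebra.map_id]; rfl
  have h2 : ∀ r : ZMod 2, r = 0 ∨ r = 1 := by decide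
  rcases h2 p with rfl | rfl
  · have h := CliffordAlgebra.commute_map_mul_map_of_isOrtho_of_mem_evenOdd_zero_left
      i i ho a b ha hb
    rw [hid, hid] at h
    rw [h]
    simp [sgn]
  · rcases h2 q with rfl | rfl
    · have h := CliffordAlgebra.commute_map_mul_map_of_isOrtho_of_mem_evenOdd_zero_right
        i i ho a b ha hb
      rw [hid, hid] at h
      rw [h]
      simp [sgn]
    · have h := CliffordAlgebra.map_mul_map_eq_neg_of_isOrtho_of_mem_evenOdd_one
        i i ho a b ha hb
      rw [hid, hid] at h
      rw [h]
      simp [sgn, ZMod.val_one]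

section Superfunctions

variable (B : Type*) [NormedAddCommGroup B] [NormedSpace ℝ B]
  (F : Type*) [NormedAddCommGroup F] [NormedSpace ℝ F] [FiniteDimensional ℝ F]
  {M : Type*} [TopologicalSpace M] [ChartedSpace B M]
  (V : M → Type*) [TopologicalSpace (TotalSpace F V)]
  [∀ x, AddCommGroup (V x)] [∀ x, Module ℝ (V x)] [∀ x, TopologicalSpace (V x)]
  [FiberBundle F V] [VectorBundle ℝ F V]

/-- The map `Λ(V_x^*) → Λ(F^*)` induced by the local trivialization of `V` chosen at `x₀`;
it is an isomorphism for `x` in the base set of that trivialization. -/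
def toModel (x₀ x : M) :
    ExteriorAlgebra ℝ (Module.Dual ℝ (V x)) →ₐ[ℝ] ExteriorAlgebra ℝ (Module.Dual ℝ F) :=
  ExteriorAlgebra.map ((trivializationAt F V x₀).symmₗ ℝ x).dualMap

/-- A section of `Λ V^*` over the open set `U` is smooth if its components in local
trivializations, as functions with values in the finite-dimensional space `Λ F^*`, are. -/
def IsSmoothSection (U : Opens M)
    (s : ∀ x : U, ExteriorAlgebra ℝ (Module.Dual ℝ (V x))) : Prop :=
  ∀ (x₀ : U) (l : Module.Dual ℝ (ExteriorAlgebra ℝ (Module.Dual ℝ F))),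
    ContMDiffAt 𝓘(ℝ, B) 𝓘(ℝ, ℝ) ∞ (fun x : U => l (toModel F V x₀ x (s x))) x₀

/-- The smooth sections of `Λ V^*` over `U`, as a subalgebra of all sections. -/
def superFunSubalgebra (U : Opens M) :
    Subalgebra ℝ (∀ x : U, ExteriorAlgebra ℝ (Module.Dual ℝ (V x))) where
  carrier := {s | IsSmoothSection B F V U s}
  algebraMap_mem' r x₀ l := by
    simpa using contMDiffAt_const
  add_mem' {a b} ha hb x₀ l := by
    have h := (ha x₀ l).add (hb x₀ l)
    refine h.congr_of_eventuallyEq (Filter.Eventually.of_forall fun x => ?_)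
    simp
  mul_mem' {a b} ha hb x₀ l := by
    let β := (Module.finBasis ℝ (Module.Dual ℝ F)).ExteriorAlgebra
    have key : (fun x : U => l (toModel F V x₀ x ((a * b) x))) = fun x : U =>
        ∑ i, ∑ j, β.coord i (toModel F V x₀ x (a x)) * β.coord j (toModel F V x₀ x (b x))
          * l (β i * β j) := by
      funext x
      rw [Pi.mul_apply, map_mul]
      conv_lhs => rw [← β.sum_repr (toModel F V x₀ x (a x)), ← β.sum_repr (toModel F V x₀ x (b x))]
      rw [Finset.sum_mul_sum, map_sum]
      refine Finset.sum_congr rfl fun i _ => ?_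
      rw [map_sum]
      refine Finset.sum_congr rfl fun j _ => ?_
      rw [smul_mul_smul_comm, map_smul, smul_eq_mul, Module.Basis.coord_apply,
        Module.Basis.coord_apply]
    rw [key]
    refine ContMDiffAt.sum fun i _ => ContMDiffAt.sum fun j _ => ?_
    exact ((ha x₀ (β.coord i)).mul (hb x₀ (β.coord j))).mul contMDiffAt_const

/-- The algebra `O(U)` of superfunctions over `U`: smooth sections of `Λ V^*`. -/
def superFun (U : Opens M) : Type _ := superFunSubalgebra B F V U

instance superFunRing (U : Opens M) : Ring (superFun B F V U) :=
  inferInstanceAs (Ring (superFunSubalgebra B F V U))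

instance superFunAlgebra (U : Opens M) : Algebra ℝ (superFun B F V U) :=
  inferInstanceAs (Algebra ℝ (superFunSubalgebra B F V U))

variable {B F V}

/-- A superfunction is homogeneous of parity `p` if all its values are. -/
def HasParity {U : Opens M} (p : ZMod 2) (f : superFun B F V U) : Prop :=
  ∀ x : U, f.1 x ∈ CliffordAlgebra.evenOdd (0 : QuadraticForm ℝ (Module.Dual ℝ (V x))) p

/-- The superfunctions in the subsheaf of sections of `ℝ ⊕ V^*` (degrees `0` and `1`). -/
def IsAffine {U : Opens M} (f : superFun B F V U) : Prop :=
  ∀ x : U, f.1 x ∈ (⋀[ℝ]^0 (Module.Dual ℝ (V x)) ⊔ ⋀[ℝ]^1 (Module.Dual ℝ (V x)) :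
    Submodule ℝ (ExteriorAlgebra ℝ (Module.Dual ℝ (V x))))

/-- Restriction of superfunctions to a smaller open set. -/
def res {U W : Opens M} (h : W ≤ U) : superFun B F V U →ₐ[ℝ] superFun B F V W where
  toFun f := ⟨fun x => f.1 ⟨x, h x.2⟩, fun x₀ l => by
    have h1 : ContMDiffAt 𝓘(ℝ, B) 𝓘(ℝ, ℝ) ∞
        (fun x : U => l (toModel F V x₀ x (f.1 x))) (Opens.inclusion h x₀) :=
      f.2 ⟨x₀, h x₀.2⟩ l
    exact h1.comp x₀ (contMDiff_inclusion h x₀)⟩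
  map_one' := rfl
  map_mul' _ _ := rfl
  map_zero' := rfl
  map_add' _ _ := rfl
  commutes' _ := rfl


set_option linter.unusedSectionVars false in
theorem toModel_involute (x₀ x : M) (a : ExteriorAlgebra ℝ (Module.Dual ℝ (V x))) :
    toModel F V x₀ x (CliffordAlgebra.involute a) =
      CliffordAlgebra.involute (toModel F V x₀ x a) := by
  have h : (toModel F V x₀ x).comp CliffordAlgebra.involute =
      (CliffordAlgebra.involute).comp (toModel F V x₀ x) := by
    apply ExteriorAlgebra.hom_ext
    ext m
    simp [toModel]
  exact DFunLike.congr_fun h a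

/-- The superfunction `x ↦ (f(x) + c * (-1)^{|f(x)|} f(x)) / 2`. -/
def parityPart {U : Opens M} (c : ℝ) (f : superFun B F V U) : superFun B F V U :=
  ⟨fun x => (2⁻¹ : ℝ) • (f.1 x + c • CliffordAlgebra.involute (f.1 x)), fun x₀ l => by
    have h1 := f.2 x₀ l
    have h2 := f.2 x₀ (l ∘ₗ (CliffordAlgebra.involute).toLinearMap)
    have h3 := (contMDiffAt_const (c := (2⁻¹ : ℝ)) (I' := 𝓘(ℝ, ℝ)) (I := 𝓘(ℝ, B)) (n := ∞)
      (x := x₀)).mul (h1.add ((contMDiffAt_const (c := c) (I' := 𝓘(ℝ, ℝ))).mul h2))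
    refine h3.congr_of_eventuallyEq (Filter.Eventually.of_forall fun x => ?_)
    simp [toModel_involute, mul_add]⟩

theorem exists_parity_decomposition {U : Opens M} (f : superFun B F V U) :
    ∃ f₀ f₁ : superFun B F V U, HasParity 0 f₀ ∧ HasParity 1 f₁ ∧ f = f₀ + f₁ := by
  have key : ∀ x : U, ∃ a ∈ CliffordAlgebra.evenOdd (0 : QuadraticForm ℝ (Module.Dual ℝ (V x))) 0,
      ∃ b ∈ CliffordAlgebra.evenOdd (0 : QuadraticForm ℝ (Module.Dual ℝ (V x))) 1,
        a + b = f.1 x := fun x => by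
    have h := (CliffordAlgebra.evenOdd_isCompl
      (0 : QuadraticForm ℝ (Module.Dual ℝ (V x)))).sup_eq_top
    exact Submodule.mem_sup.1 (h ▸ Submodule.mem_top)
  refine ⟨parityPart 1 f, parityPart (-1) f, fun x => ?_, fun x => ?_, ?_⟩
  · obtain ⟨a, ha, b, hb, hab⟩ := key x
    have : (parityPart 1 f).1 x = a := by
      simp only [parityPart, ← hab, map_add, CliffordAlgebra.involute_eq_of_mem_even ha,
        CliffordAlgebra.involute_eq_of_mem_odd hb]
      module
    rw [this]; exact ha
  · obtain ⟨a, ha, b, hb, hab⟩ := key x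
    have : (parityPart (-1) f).1 x = b := by
      simp only [parityPart, ← hab, map_add, CliffordAlgebra.involute_eq_of_mem_even ha,
        CliffordAlgebra.involute_eq_of_mem_odd hb]
      module
    rw [this]; exact hb
  · apply Subtype.ext
    funext x
    change f.1 x = (parityPart 1 f).1 x + (parityPart (-1) f).1 x
    simp only [parityPart]
    module

theorem HasParity.mul {U : Opens M} {p q : ZMod 2} {f g : superFun B F V U}
    (hf : HasParity p f) (hg : HasParity q g) : HasParity (p + q) (f * g) := fun x =>
  SetLike.mul_mem_graded (hf x) (hg x)

theorem HasParity.res {U W : Opens M} (h : W ≤ U) {p : ZMod 2} {f : superFun B F V U}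
    (hf : HasParity p f) : HasParity p (res h f) := fun x => hf ⟨x, h x.2⟩

theorem mul_comm_of_hasParity {U : Opens M} {p q : ZMod 2} {f g : superFun B F V U}
    (hf : HasParity p f) (hg : HasParity q g) : f * g = sgn (p * q) • (g * f) := by
  apply Subtype.ext
  funext x
  change f.1 x * g.1 x = sgn (p * q) • (g.1 x * f.1 x)
  exact graded_comm (hf x) (hg x)

end Superfunctions

section Derivations

variable (B : Type*) [NormedAddCommGroup B] [NormedSpace ℝ B]
  (F : Type*) [NormedAddCommGroup F] [NormedSpace ℝ F] [FiniteDimensional ℝ F]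
  {M : Type*} [TopologicalSpace M] [ChartedSpace B M]
  (V : M → Type*) [TopologicalSpace (TotalSpace F V)]
  [∀ x, AddCommGroup (V x)] [∀ x, Module ℝ (V x)] [∀ x, TopologicalSpace (V x)]
  [FiberBundle F V] [VectorBundle ℝ F V]

/-- Families of `ℝ`-linear operators on `O(W)`, for all open `W ⊆ U`. -/
abbrev LocalOps (U : Opens M) : Type _ :=
  ∀ W : {W : Opens M // W ≤ U}, superFun B F V W.1 →ₗ[ℝ] superFun B F V W.1

/-- Superderivations of the sheaf `O|_U` which are homogeneous of parity `p`: endomorphisms of the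
sheaf of vector spaces which shift the parity by `p` and satisfy
`X(f g) = X(f) g + (-1)^{p|f|} f X(g)`. -/
def derOfParity (U : Opens M) (p : ZMod 2) : Submodule ℝ (LocalOps B F V U) where
  carrier := {X |
    (∀ (W W' : Opens M) (h : W ≤ U) (h' : W' ≤ W) (f : superFun B F V W),
      res h' (X ⟨W, h⟩ f) = X ⟨W', h'.trans h⟩ (res h' f)) ∧
    (∀ (W : Opens M) (h : W ≤ U) (q : ZMod 2) (f : superFun B F V W), HasParity q f →
      HasParity (p + q) (X ⟨W, h⟩ f)) ∧
    (∀ (W : Opens M) (h : W ≤ U) (q : ZMod 2) (f g : superFun B F V W), HasParity q f →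
      X ⟨W, h⟩ (f * g) = X ⟨W, h⟩ f * g + sgn (p * q) • (f * X ⟨W, h⟩ g))}
  zero_mem' := by
    refine ⟨?_, ?_, ?_⟩
    · intros; simp
    · intro W h q f hf x
      exact Submodule.zero_mem _
    · intros; simp
  add_mem' := by
    rintro X Y ⟨h1, h2, h3⟩ ⟨k1, k2, k3⟩
    refine ⟨?_, ?_, ?_⟩
    · intro W W' h h' f
      simp [h1, k1]
    · intro W h q f hf x
      exact Submodule.add_mem _ (h2 W h q f hf x) (k2 W h q f hf x)
    · intro W h q f g hf
      simp only [Pi.add_apply, LinearMap.add_apply, h3 W h q f g hf, k3 W h q f g hf, add_mul,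
        mul_add, smul_add]
      abel
  smul_mem' := by
    rintro c X ⟨h1, h2, h3⟩
    refine ⟨?_, ?_, ?_⟩
    · intro W W' h h' f
      simp [h1]
    · intro W h q f hf x
      exact Submodule.smul_mem _ c (h2 W h q f hf x)
    · intro W h q f g hf
      simp only [Pi.smul_apply, LinearMap.smul_apply, h3 W h q f g hf, smul_mul_assoc,
        mul_smul_comm, smul_add, smul_comm c]

/-- The sections over `U` of the sheaf `T = Der(O)` of superderivations; a superderivation is a
sum of an even and an odd one. -/
def superDerSubmodule (U : Opens M) : Submodule ℝ (LocalOps B F V U) :=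
  derOfParity B F V U 0 ⊔ derOfParity B F V U 1

/-- The type of superderivations over `U`. -/
def superDer (U : Opens M) : Type _ := superDerSubmodule B F V U

instance superDerAddCommGroup (U : Opens M) : AddCommGroup (superDer B F V U) :=
  inferInstanceAs (AddCommGroup (superDerSubmodule B F V U))

instance superDerRealModule (U : Opens M) : Module ℝ (superDer B F V U) :=
  inferInstanceAs (Module ℝ (superDerSubmodule B F V U))

variable {B F V}

/-- A superderivation is homogeneous of parity `p`. -/
def DerHasParity {U : Opens M} (p : ZMod 2) (X : superDer B F V U) : Prop :=
  X.1 ∈ derOfParity B F V U p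

/-- Multiplication of an operator from the left by a superfunction. -/
def mulOp {U : Opens M} (f : superFun B F V U) :
    LocalOps B F V U →ₗ[ℝ] LocalOps B F V U where
  toFun X := fun W => LinearMap.mulLeft ℝ (res W.2 f) ∘ₗ X W
  map_add' X Y := by
    funext W
    simp [LinearMap.comp_add]
  map_smul' c X := by
    funext W
    simp [LinearMap.comp_smul]

theorem mulOp_mem_derOfParity {U : Opens M} {p q : ZMod 2} {f : superFun B F V U}
    (hf : HasParity q f) {X : LocalOps B F V U} (hX : X ∈ derOfParity B F V U p) :
    mulOp f X ∈ derOfParity B F V U (q + p) := by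
  obtain ⟨h1, h2, h3⟩ := hX
  refine ⟨?_, ?_, ?_⟩
  · intro W W' h h' g
    change res h' (res h f * X ⟨W, h⟩ g) = res (h'.trans h) f * X ⟨W', h'.trans h⟩ (res h' g)
    rw [map_mul, h1]
    rfl
  · intro W h r g hg
    rw [add_assoc]
    exact (hf.res h).mul (h2 W h r g hg)
  · intro W h r g k hg
    change res h f * X ⟨W, h⟩ (g * k) = res h f * X ⟨W, h⟩ g * k + sgn ((q + p) * r) •
      (g * (res h f * X ⟨W, h⟩ k))
    rw [h3 W h r g k hg, add_mul, sgn_add, mul_comm (sgn (q * r)), mul_comm q r]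
    exact graded_leibniz_aux (sgn_sq _) (mul_comm_of_hasParity hg (hf.res h))

theorem mulOp_mem_superDer {U : Opens M} (f : superFun B F V U) {X : LocalOps B F V U}
    (hX : X ∈ superDerSubmodule B F V U) : mulOp f X ∈ superDerSubmodule B F V U := by
  have hle : ∀ p : ZMod 2, derOfParity B F V U p ≤ superDerSubmodule B F V U := by
    intro p
    fin_cases p
    · exact le_sup_left
    · exact le_sup_right
  obtain ⟨f₀, f₁, h₀, h₁, rfl⟩ := exists_parity_decomposition f
  obtain ⟨X₀, hX₀, X₁, hX₁, rfl⟩ := Submodule.mem_sup.1 hX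
  have hadd : ∀ Y : LocalOps B F V U, mulOp (f₀ + f₁) Y = mulOp f₀ Y + mulOp f₁ Y := by
    intro Y
    funext ⟨W, h⟩
    ext g : 1
    change res h (f₀ + f₁) * _ = res h f₀ * _ + res h f₁ * _
    rw [map_add, add_mul]
  rw [LinearMap.map_add, hadd, hadd]
  exact add_mem
    (add_mem (hle _ (mulOp_mem_derOfParity h₀ hX₀)) (hle _ (mulOp_mem_derOfParity h₁ hX₀)))
    (add_mem (hle _ (mulOp_mem_derOfParity h₀ hX₁)) (hle _ (mulOp_mem_derOfParity h₁ hX₁)))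

/-- The left `O(U)`-module structure on `T(U)`: `(f X)(g) = f X(g)`. -/
instance superDerModule (U : Opens M) : Module (superFun B F V U) (superDer B F V U) where
  smul f X := ⟨mulOp f X.1, mulOp_mem_superDer f X.2⟩
  one_smul X := by
    apply Subtype.ext; funext ⟨W, h⟩; ext g : 1
    change res h 1 * X.1 ⟨W, h⟩ g = X.1 ⟨W, h⟩ g
    rw [map_one, one_mul]
  mul_smul a b X := by
    apply Subtype.ext; funext ⟨W, h⟩; ext g : 1
    change res h (a * b) * X.1 ⟨W, h⟩ g = res h a * (res h b * X.1 ⟨W, h⟩ g)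
    rw [map_mul, mul_assoc]
  smul_zero a := Subtype.ext (LinearMap.map_zero (mulOp a))
  smul_add a X Y := Subtype.ext (LinearMap.map_add (mulOp a) X.1 Y.1)
  add_smul a b X := by
    apply Subtype.ext; funext ⟨W, h⟩; ext g : 1
    change res h (a + b) * X.1 ⟨W, h⟩ g = res h a * X.1 ⟨W, h⟩ g + res h b * X.1 ⟨W, h⟩ g
    rw [map_add, add_mul]
  zero_smul X := by
    apply Subtype.ext; funext ⟨W, h⟩; ext g : 1
    change res h 0 * X.1 ⟨W, h⟩ g = 0
    rw [map_zero, zero_mul]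

theorem restrict_mem {U W : Opens M} (h : W ≤ U) {p : ZMod 2} {X : LocalOps B F V U}
    (hX : X ∈ derOfParity B F V U p) :
    (fun W' => X ⟨W'.1, W'.2.trans h⟩ : LocalOps B F V W) ∈ derOfParity B F V W p :=
  ⟨fun W' W'' k k' f => hX.1 W' W'' (k.trans h) k' f,
    fun W' k q f hf => hX.2.1 W' (k.trans h) q f hf,
    fun W' k q f g hf => hX.2.2 W' (k.trans h) q f g hf⟩

/-- Restriction of superderivations to a smaller open set. -/
def resDer {U W : Opens M} (h : W ≤ U) : superDer B F V U →ₗ[ℝ] superDer B F V W where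
  toFun X := ⟨fun W' => X.1 ⟨W'.1, W'.2.trans h⟩, by
    obtain ⟨X₀, hX₀, X₁, hX₁, hX⟩ := Submodule.mem_sup.1 X.2
    rw [← hX]
    exact add_mem (Submodule.mem_sup_left (restrict_mem h hX₀))
      (Submodule.mem_sup_right (restrict_mem h hX₁))⟩
  map_add' _ _ := rfl
  map_smul' _ _ := rfl

/-- The value `X(f)` of a superderivation over `U` on a superfunction over `U`. -/
def superDer.app {U : Opens M} (X : superDer B F V U) (f : superFun B F V U) :
    superFun B F V U := X.1 ⟨U, le_rfl⟩ f

/-- The subsheaf `L₀`: even superderivations which preserve the subsheaf of sections of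
`ℝ ⊕ V^*`. -/
def IsEvenAffineDer {U : Opens M} (X : superDer B F V U) : Prop :=
  DerHasParity 0 X ∧ ∀ (W : Opens M) (h : W ≤ U) (f : superFun B F V W),
    IsAffine f → IsAffine (X.1 ⟨W, h⟩ f)

end Derivations

section SuperGeometry

variable (B : Type*) [NormedAddCommGroup B] [NormedSpace ℝ B]
  (F : Type*) [NormedAddCommGroup F] [NormedSpace ℝ F] [FiniteDimensional ℝ F]
  {M : Type*} [TopologicalSpace M] [ChartedSpace B M]
  (V : M → Type*) [TopologicalSpace (TotalSpace F V)]
  [∀ x, AddCommGroup (V x)] [∀ x, Module ℝ (V x)] [∀ x, TopologicalSpace (V x)]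
  [FiberBundle F V] [VectorBundle ℝ F V]

/-- A connection on the supermanifold `(M, Γ(Λ V^*))`: an even morphism of sheaves
`∇ : T ⊗_ℝ T → T`, `(X, Y) ↦ ∇_X Y`, which is `O`-linear in `X` and satisfies the graded Leibniz
rule `∇_X (f Y) = X(f) Y + (-1)^{|X||f|} f ∇_X Y`. -/
structure SuperConnection where
  toFun (U : Opens M) : superDer B F V U →ₗ[ℝ] superDer B F V U →ₗ[ℝ] superDer B F V U
  res_apply (U W : Opens M) (h : W ≤ U) (X Y : superDer B F V U) :
    resDer h (toFun U X Y) = toFun W (resDer h X) (resDer h Y)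
  even (U : Opens M) (p q : ZMod 2) (X Y : superDer B F V U) :
    DerHasParity p X → DerHasParity q Y → DerHasParity (p + q) (toFun U X Y)
  smul_left (U : Opens M) (f : superFun B F V U) (X Y : superDer B F V U) :
    toFun U (f • X) Y = f • toFun U X Y
  leibniz (U : Opens M) (p q : ZMod 2) (f : superFun B F V U) (X Y : superDer B F V U) :
    DerHasParity p X → HasParity q f →
      toFun U X (f • Y) = X.app f • Y + sgn (p * q) • (f • toFun U X Y)

/-- Homogeneous sections of parity `p` of the sheaf `Hom_O(T, O)` of one-forms over `U`, with the
sign convention `φ(f X) = (-1)^{p|f|} f φ(X)`. -/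
structure SuperOneForm (U : Opens M) (p : ZMod 2) where
  toFun (W : {W : Opens M // W ≤ U}) : superDer B F V W.1 →ₗ[ℝ] superFun B F V W.1
  res_apply (W W' : {W : Opens M // W ≤ U}) (h : W'.1 ≤ W.1) (X : superDer B F V W.1) :
    res h (toFun W X) = toFun W' (resDer h X)
  parity (W : {W : Opens M // W ≤ U}) (q : ZMod 2) (X : superDer B F V W.1) :
    DerHasParity q X → HasParity (p + q) (toFun W X)
  smul (W : {W : Opens M // W ≤ U}) (q : ZMod 2) (f : superFun B F V W.1)
    (X : superDer B F V W.1) : HasParity q f →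
      toFun W (f • X) = sgn (p * q) • (f * toFun W X)

/-- An odd Riemannian metric on the supermanifold `(M, Γ(Λ V^*))`: an odd supersymmetric
`O`-linear morphism of sheaves `g : T ⊗_O T → O` for which `X ↦ g(X, ·)` is an isomorphism from
`T` to the parity reversal of the sheaf of one-forms. As `g` is odd, linearity in the first
argument reads `g(f X, Y) = (-1)^{|f|} f g(X, Y)`; linearity in the second one,
`g(X, f Y) = (-1)^{|f|(1 + |X|)} f g(X, Y)`, follows by supersymmetry. -/
structure OddRiemannianMetric where
  toFun (U : Opens M) : superDer B F V U →ₗ[ℝ] superDer B F V U →ₗ[ℝ] superFun B F V U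
  res_apply (U W : Opens M) (h : W ≤ U) (X Y : superDer B F V U) :
    res h (toFun U X Y) = toFun W (resDer h X) (resDer h Y)
  odd (U : Opens M) (p q : ZMod 2) (X Y : superDer B F V U) :
    DerHasParity p X → DerHasParity q Y → HasParity (p + q + 1) (toFun U X Y)
  smul_left (U : Opens M) (q : ZMod 2) (f : superFun B F V U) (X Y : superDer B F V U) :
    HasParity q f → toFun U (f • X) Y = sgn q • (f * toFun U X Y)
  supersymm (U : Opens M) (p q : ZMod 2) (X Y : superDer B F V U) :
    DerHasParity p X → DerHasParity q Y → toFun U X Y = sgn (p * q) • toFun U Y X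
  nondegenerate (U : Opens M) (p : ZMod 2) (φ : SuperOneForm B F V U (p + 1)) :
    ∃! X : superDer B F V U, DerHasParity p X ∧
      ∀ (W : {W : Opens M // W ≤ U}) (Y : superDer B F V W.1),
        toFun W.1 (resDer W.2 X) Y = φ.toFun W Y

variable {B F V}

/-- The bracket `[X, Y] = XY - (-1)^{pq} YX` for `X`, `Y` of parity `p`, `q`. -/
def superBracket {U : Opens M} (p q : ZMod 2) (X Y : superDer B F V U) : LocalOps B F V U :=
  fun W => X.1 W ∘ₗ Y.1 W - sgn (p * q) • (Y.1 W ∘ₗ X.1 W)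

/-- The torsion `∇_X Y - (-1)^{|X||Y|} ∇_Y X - [X, Y]` vanishes. -/
def SuperConnection.IsTorsionFree (D : SuperConnection B F V) : Prop :=
  ∀ (U : Opens M) (p q : ZMod 2) (X Y : superDer B F V U),
    DerHasParity p X → DerHasParity q Y →
      (D.toFun U X Y).1 - sgn (p * q) • (D.toFun U Y X).1 = superBracket p q X Y

/-- Compatibility with an odd metric:
`(-1)^{|X|} X(g(Y, Z)) = g(∇_X Y, Z) + (-1)^{|X||Y|} g(Y, ∇_X Z)`. -/
def SuperConnection.IsCompatible (D : SuperConnection B F V) (g : OddRiemannianMetric B F V) :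
    Prop :=
  ∀ (U : Opens M) (p q r : ZMod 2) (X Y Z : superDer B F V U),
    DerHasParity p X → DerHasParity q Y → DerHasParity r Z →
      sgn p • X.app (g.toFun U Y Z) =
        g.toFun U (D.toFun U X Y) Z + sgn (p * q) • g.toFun U Y (D.toFun U X Z)

/-- Levi-Civita connections of odd Riemannian metrics. -/
def SuperConnection.IsLeviCivita (D : SuperConnection B F V) (g : OddRiemannianMetric B F V) :
    Prop :=
  D.IsTorsionFree ∧ D.IsCompatible g

end SuperGeometry

section TotalSpaceGeometry

variable (B : Type*) [NormedAddCommGroup B] [NormedSpace ℝ B]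
  (F : Type*) [NormedAddCommGroup F] [NormedSpace ℝ F] [FiniteDimensional ℝ F]
  {M : Type*} [TopologicalSpace M] [ChartedSpace B M]
  (V : M → Type*) [TopologicalSpace (TotalSpace F V)]
  [∀ x, AddCommGroup (V x)] [∀ x, Module ℝ (V x)] [∀ x, TopologicalSpace (V x)]
  [FiberBundle F V] [VectorBundle ℝ F V]
  [IsManifold 𝓘(ℝ, B) ∞ M] [ContMDiffVectorBundle ∞ F V 𝓘(ℝ, B)]

/-- The tangent space at `e` of the total space of `V`, as a smooth manifold. -/
abbrev TotalTangent (e : TotalSpace F V) : Type _ :=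
  TangentSpace (𝓘(ℝ, B).prod 𝓘(ℝ, F)) e

/-- Connections on the tangent bundle of the total space of `V`. -/
abbrev TotalConnection : Type _ :=
  CovariantDerivative (𝓘(ℝ, B).prod 𝓘(ℝ, F)) (B × F) (TotalTangent B F V)

/-- Differentiability at `e` of a vector field on the total space of `V`. -/
def IsDiffFieldAt (X : ∀ e : TotalSpace F V, TotalTangent B F V e) (e : TotalSpace F V) : Prop :=
  MDifferentiableAt (𝓘(ℝ, B).prod 𝓘(ℝ, F))
    ((𝓘(ℝ, B).prod 𝓘(ℝ, F)).prod 𝓘(ℝ, B × F))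
    (fun e => (⟨e, X e⟩ : TotalSpace (B × F) (TotalTangent B F V))) e

/-- A smooth field of symmetric bilinear forms on the tangent spaces of the total space. -/
structure SmoothSymmetricForm where
  toFun (e : TotalSpace F V) : TotalTangent B F V e →L[ℝ] TotalTangent B F V e →L[ℝ] ℝ
  symm (e : TotalSpace F V) (v w : TotalTangent B F V e) : toFun e v w = toFun e w v
  contMDiff : ContMDiff (𝓘(ℝ, B).prod 𝓘(ℝ, F))
    ((𝓘(ℝ, B).prod 𝓘(ℝ, F)).prod 𝓘(ℝ, (B × F) →L[ℝ] (B × F) →L[ℝ] ℝ)) ∞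
    (fun e => TotalSpace.mk' ((B × F) →L[ℝ] (B × F) →L[ℝ] ℝ)
      (E := fun e => TotalTangent B F V e →L[ℝ] TotalTangent B F V e →L[ℝ] ℝ) e (toFun e))

variable {B F V}

/-- A smooth symmetric form is a pseudo-Riemannian metric if it is nondegenerate everywhere. -/
def SmoothSymmetricForm.IsPseudoRiemannian (g : SmoothSymmetricForm B F V) : Prop :=
  ∀ (e : TotalSpace F V) (v : TotalTangent B F V e), (∀ w, g.toFun e v w = 0) → v = 0

/-- `∇_X Y - ∇_Y X = [X, Y]`; recall that `D Y e (X e)` is the value of `∇_X Y` at `e`. -/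
def TotalTorsionFree (D : TotalConnection B F V) : Prop :=
  ∀ (X Y : ∀ e : TotalSpace F V, TotalTangent B F V e) (e : TotalSpace F V),
    IsDiffFieldAt B F V X e → IsDiffFieldAt B F V Y e →
      D Y e (X e) - D X e (Y e) = VectorField.mlieBracket (𝓘(ℝ, B).prod 𝓘(ℝ, F)) X Y e

/-- `X(g(Y, Z)) = g(∇_X Y, Z) + g(Y, ∇_X Z)`. -/
def TotalCompatible (D : TotalConnection B F V) (g : SmoothSymmetricForm B F V) : Prop :=
  ∀ (X Y Z : ∀ e : TotalSpace F V, TotalTangent B F V e) (e : TotalSpace F V),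
    IsDiffFieldAt B F V X e → IsDiffFieldAt B F V Y e → IsDiffFieldAt B F V Z e →
      mvfderiv (𝓘(ℝ, B).prod 𝓘(ℝ, F)) (fun e => g.toFun e (Y e) (Z e)) e (X e) =
        g.toFun e (D Y e (X e)) (Z e) + g.toFun e (Y e) (D Z e (X e))

/-- `D` is smooth, torsion-free and metric with respect to `g`. -/
def IsTotalLeviCivita (D : TotalConnection B F V) (g : SmoothSymmetricForm B F V) : Prop :=
  D.ContMDiffCovariantDerivative ∞ ∧ TotalTorsionFree D ∧ TotalCompatible D g

end TotalSpaceGeometry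

section Reduction

variable {B : Type*} [NormedAddCommGroup B] [NormedSpace ℝ B]
  {F : Type*} [NormedAddCommGroup F] [NormedSpace ℝ F] [FiniteDimensional ℝ F]
  {M : Type*} [TopologicalSpace M] [ChartedSpace B M]
  {V : M → Type*} [TopologicalSpace (TotalSpace F V)]
  [∀ x, AddCommGroup (V x)] [∀ x, Module ℝ (V x)] [∀ x, TopologicalSpace (V x)]
  [FiberBundle F V] [VectorBundle ℝ F V]
  [IsManifold 𝓘(ℝ, B) ∞ M] [ContMDiffVectorBundle ∞ F V 𝓘(ℝ, B)]

open Classical in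
/-- The function `e ↦ f₀(π(e)) + f₁(π(e))(e)` on `π⁻¹(U)` defined by the components of degree `0`
and `1` of a superfunction `f` over `U`; it is extended by `0`. -/
def fiberAffine {U : Opens M} (f : superFun B F V U) : TotalSpace F V → ℝ := fun e =>
  if h : e.proj ∈ U then
    ExteriorAlgebra.algebraMapInv (f.1 ⟨e.proj, h⟩) +
      ExteriorAlgebra.ιInv (R := ℝ) (f.1 ⟨e.proj, h⟩) e.snd
  else 0

/-- The tangent vector `v` at `e` is the value at `e` of the vector field on `π⁻¹(U)` that
corresponds to the superderivation `Z`: on functions which are affine along the fibers, i.e. on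
superfunctions of degree at most one, it acts as `Z` followed by the projection to the
components of degree at most one. -/
def IsTransportAt {U : Opens M} (Z : superDer B F V U) (e : TotalSpace F V)
    (v : TotalTangent B F V e) : Prop :=
  ∀ (W : {W : Opens M // W ≤ U}) (f : superFun B F V W.1), e.proj ∈ W.1 → IsAffine f →
    mvfderiv (𝓘(ℝ, B).prod 𝓘(ℝ, F)) (fiberAffine f) e v = fiberAffine (Z.1 W f) e

open Classical in
/-- The vector field on `π⁻¹(U)` which corresponds to an even superderivation over `U`. -/
def transport {U : Opens M} (Z : superDer B F V U) (e : TotalSpace F V) : TotalTangent B F V e :=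
  if h : e.proj ∈ U ∧ ∃ v, IsTransportAt Z e v then h.2.choose else 0

/-- The connection `D'` on the total space is induced by the connection `D` on the supermanifold:
on vector fields corresponding to elements `X`, `Y` of `L₀` it is given by the vector field
corresponding to `D_X Y`. Outside of the zero section (everywhere, if `V` has rank zero) these
vector fields span all tangent spaces, so at most one smooth connection is induced by `D`. -/
def Induces (D : SuperConnection B F V) (D' : TotalConnection B F V) : Prop :=
  ∀ (U : Opens M) (X Y : superDer B F V U), IsEvenAffineDer X → IsEvenAffineDer Y →
    ∀ e : TotalSpace F V, e.proj ∈ U →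
      D' (transport Y) e (transport X e) = transport (D.toFun U X Y) e

/-- The symmetric bilinear form `g'` on the total space is induced by the metric `g` on the
supermanifold: on vector fields corresponding to elements of `L₀` it is given by the components
of degree at most one of `g(X, Y)`. At most one smooth form is induced by `g`. -/
def InducesForm (g : OddRiemannianMetric B F V) (g' : SmoothSymmetricForm B F V) : Prop :=
  ∀ (U : Opens M) (X Y : superDer B F V U), IsEvenAffineDer X → IsEvenAffineDer Y →
    ∀ e : TotalSpace F V, e.proj ∈ U →
      g'.toFun e (transport X e) (transport Y e) = fiberAffine (g.toFun U X Y) e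

end Reduction

end

end Batchelor

/-! Take coordinates of M together with a linear frame of E^* over a small open set. A
superderivation is then Σ X^k ∂_k, where X^k is its value on the k-th coordinate (`superDer_eq_sum`,
which rests on Hadamard's lemma). Write ψ for the part of degree at most one, evaluated at a fibre
vector ξ (`aff`). If X is even, its coefficients have the parity of their index: an even one has no
linear part, an odd one has no body. Hence ψ(X f) is the derivative of ψ(f) along the vector field
with components ψ(X^k) (`aff_rep_der`), and this field is Ψ(X) in coordinates (`dchart_transport`).

The same parity count shows that ψ(X^k Y^l a) depends on X and Y only through Ψ(X) and Ψ(Y), and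
bilinearly so: terms with two linear factors have degree two and drop out
(`aff_mul_mul_eq_triForm`). Applied to the expansions of g(X, Y) and ∇_X Y, it produces a bilinear
form G and a Christoffel tensor Γ on the coordinate domain with ψ(g(X, Y)) = G(Ψ(X), Ψ(Y)) and Ψ(∇_X
Y) = dΨ(Y)(Ψ(X)) + Γ(Ψ(X), Ψ(Y)) (`aff_rep_metric`, `hat_connection`).

The sheaf L_0 contains the fields (z, ξ) ↦ (w, Aξ) with w constant and A linear. They span the
tangent space wherever ξ ≠ 0, and everywhere in rank zero, hence on a dense set
(`mem_closure_spanningPoints`). There the two defining identities determine the form and the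
connection, and continuity carries this to the zero section. This single argument gives uniqueness
and also the agreement of the local constructions in different charts, so no transformation law is
ever computed.

Γ is symmetric because coordinate derivations supercommute and the sign of supersymmetry affects
only the odd-odd terms, which ψ does not see. Compatibility comes from differentiating ψ(g(Y, Z))
along Ψ(X), again extended by density. For non-degeneracy, the body of the matrix of the odd metric
g has only mixed even-odd blocks, and it has trivial kernel because the differentials of the
coordinates have duals under g. Since G vanishes on pairs of vertical vectors and has these bodies,
up to sign, as its mixed blocks, it is non-degenerate at every point, including the zero section
(`localForm_nondegenerate`). -/

namespace Batchelor

noncomputable section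

set_option linter.unusedSectionVars false

/-! ### Exterior algebras: components of degree zero and one, parity, contraction -/

section Exterior

variable {N : Type*} [AddCommGroup N] [Module ℝ N]

/-- The component of degree `0` of an element of an exterior algebra. -/
abbrev body : ExteriorAlgebra ℝ N →ₐ[ℝ] ℝ := ExteriorAlgebra.algebraMapInv

/-- The component of degree `1` of an element of an exterior algebra. -/
abbrev lin : ExteriorAlgebra ℝ N →ₗ[ℝ] N := ExteriorAlgebra.ιInv

theorem body_ι (n : N) : body (ExteriorAlgebra.ι ℝ n) = 0 := by
  simp [body, ExteriorAlgebra.algebraMapInv]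

theorem lin_ι (n : N) : lin (ExteriorAlgebra.ι ℝ n) = n :=
  ExteriorAlgebra.ι_leftInverse n

theorem lin_algebraMap (r : ℝ) : lin (algebraMap ℝ (ExteriorAlgebra ℝ N) r) = 0 := by
  simp [lin, ExteriorAlgebra.ιInv, TrivSqZeroExt.algebraMap_eq_inl]

/-- Body and linear part together form the algebra map to the square-zero extension ℝ ⊕ N, whose
product is exactly this Leibniz formula. -/
theorem lin_mul (a b : ExteriorAlgebra ℝ N) :
    lin (a * b) = body a • lin b + body b • lin a := by
  let _ : Module ℝᵐᵒᵖ N := Module.compHom _ ((RingHom.id ℝ).fromOpposite mul_comm)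
  have _ : IsCentralScalar ℝ N := ⟨fun r m => rfl⟩
  have h : ∀ c : ExteriorAlgebra ℝ N,
      (ExteriorAlgebra.toTrivSqZeroExt c).fst = body c := fun c => by
    have : (TrivSqZeroExt.fstHom ℝ ℝ N).comp ExteriorAlgebra.toTrivSqZeroExt =
        (body : ExteriorAlgebra ℝ N →ₐ[ℝ] ℝ) := by
      apply ExteriorAlgebra.hom_ext
      ext m
      simp [ExteriorAlgebra.algebraMapInv]
    exact DFunLike.congr_fun this c
  have h2 : ∀ c : ExteriorAlgebra ℝ N,
      (ExteriorAlgebra.toTrivSqZeroExt c).snd = lin c := fun c => rfl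
  rw [← h2, map_mul, TrivSqZeroExt.snd_mul, h, h, h2, h2]
  rfl

theorem body_involute (a : ExteriorAlgebra ℝ N) :
    body (CliffordAlgebra.involute a) = body a := by
  have : (body (N := N)).comp CliffordAlgebra.involute = body := by
    apply ExteriorAlgebra.hom_ext
    ext m
    simp [body, ExteriorAlgebra.algebraMapInv]
  exact DFunLike.congr_fun this a

theorem lin_involute (a : ExteriorAlgebra ℝ N) :
    lin (CliffordAlgebra.involute a) = -lin a := by
  refine CliffordAlgebra.left_induction (Q := (0 : QuadraticForm ℝ N)) 
    (P := fun a => lin (CliffordAlgebra.involute a) = -lin a) ?_ ?_ ?_ a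
  · intro r
    have := lin_algebraMap (N := N) r
    simp only [AlgHom.commutes]
    rw [this, neg_zero]
  · intro x y hx hy
    rw [map_add, map_add, hx, hy, map_add, neg_add]
  · intro x m hx
    have h1 : body (CliffordAlgebra.ι (0 : QuadraticForm ℝ N) m) = 0 := body_ι m
    rw [map_mul, lin_mul, lin_mul, hx, body_involute, body_involute, h1,
      CliffordAlgebra.involute_ι]
    simp

/-- The grading is the eigenspace decomposition of the involution. Parity thus becomes a linear
equation, which induced maps, contractions and derivatives visibly preserve. -/
theorem mem_evenOdd_iff {p : ZMod 2} {a : ExteriorAlgebra ℝ N} :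
    a ∈ CliffordAlgebra.evenOdd (0 : QuadraticForm ℝ N) p ↔
      CliffordAlgebra.involute a = sgn p • a := by
  have h2 : ∀ r : ZMod 2, r = 0 ∨ r = 1 := by decide
  have hs1 : sgn 1 = -1 := by simp [sgn, ZMod.val_one]
  have hs0 : sgn 0 = 1 := by simp [sgn]
  have hdec : ∃ b ∈ CliffordAlgebra.evenOdd (0 : QuadraticForm ℝ N) 0,
      ∃ c ∈ CliffordAlgebra.evenOdd (0 : QuadraticForm ℝ N) 1, b + c = a := by
    have h := (CliffordAlgebra.evenOdd_isCompl (0 : QuadraticForm ℝ N)).sup_eq_top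
    exact Submodule.mem_sup.1 (h ▸ Submodule.mem_top)
  obtain ⟨b, hb, c, hc, rfl⟩ := hdec
  have ib := CliffordAlgebra.involute_eq_of_mem_even hb
  have ic := CliffordAlgebra.involute_eq_of_mem_odd hc
  rcases h2 p with rfl | rfl
  · refine ⟨fun h => by rw [CliffordAlgebra.involute_eq_of_mem_even h, hs0, one_smul], fun h => ?_⟩
    rw [hs0, one_smul, map_add, ib, ic] at h
    have : c = 0 := by
      have h' := add_left_cancel h
      have : (2 : ℝ) • c = 0 := by rw [two_smul]; nth_rw 1 [← h']; simp
      simpa using this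
    rw [this, add_zero]; exact hb
  · refine ⟨fun h => by rw [CliffordAlgebra.involute_eq_of_mem_odd h, hs1, neg_one_smul],
      fun h => ?_⟩
    rw [hs1, neg_one_smul, map_add, ib, ic, neg_add] at h
    have : b = 0 := by
      have h' := add_right_cancel h
      have : (2 : ℝ) • b = 0 := by rw [two_smul]; nth_rw 1 [h']; simp
      simpa using this
    rw [this, zero_add]; exact hc

theorem sgn_zero : sgn 0 = 1 := by simp [sgn]

theorem sgn_one : sgn 1 = -1 := by simp [sgn, ZMod.val_one]

theorem body_eq_zero_of_odd {a : ExteriorAlgebra ℝ N}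
    (ha : a ∈ CliffordAlgebra.evenOdd (0 : QuadraticForm ℝ N) 1) : body a = 0 := by
  have h := body_involute a
  rw [mem_evenOdd_iff.1 ha, sgn_one, map_smul, smul_eq_mul] at h
  linarith

theorem lin_eq_zero_of_even {a : ExteriorAlgebra ℝ N}
    (ha : a ∈ CliffordAlgebra.evenOdd (0 : QuadraticForm ℝ N) 0) : lin a = 0 := by
  have h := lin_involute a
  rw [mem_evenOdd_iff.1 ha, sgn_zero, one_smul] at h
  have : (2 : ℝ) • lin a = 0 := by rw [two_smul]; nth_rw 1 [h]; simp
  simpa using this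

/-- Contraction of an element of an exterior algebra with a linear form. -/
abbrev contract (d : Module.Dual ℝ N) : ExteriorAlgebra ℝ N →ₗ[ℝ] ExteriorAlgebra ℝ N :=
  CliffordAlgebra.contractLeft (Q := (0 : QuadraticForm ℝ N)) d

theorem contract_ι (d : Module.Dual ℝ N) (n : N) :
    contract d (ExteriorAlgebra.ι ℝ n) = algebraMap ℝ _ (d n) :=
  CliffordAlgebra.contractLeft_ι _ _ _

theorem contract_algebraMap (d : Module.Dual ℝ N) (r : ℝ) :
    contract d (algebraMap ℝ _ r) = 0 :=
  CliffordAlgebra.contractLeft_algebraMap _ _ _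

/-- Contraction is an odd derivation, the algebraic model of ∂/∂θ. The rule for a single vector on
the left propagates to all left factors by induction. -/
theorem contract_mul (d : Module.Dual ℝ N) (a b : ExteriorAlgebra ℝ N) :
    contract d (a * b) = contract d a * b + CliffordAlgebra.involute a * contract d b := by
  refine CliffordAlgebra.left_induction (Q := (0 : QuadraticForm ℝ N)) 
    (P := fun a => contract d (a * b) = contract d a * b +
      CliffordAlgebra.involute a * contract d b) ?_ ?_ ?_ a
  · intro r
    rw [AlgHom.commutes]
    simp only [contract]
    rw [CliffordAlgebra.contractLeft_algebraMap_mul, CliffordAlgebra.contractLeft_algebraMap,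
      zero_mul, zero_add]
  · intro x y hx hy
    rw [add_mul, map_add, hx, hy, map_add, map_add]
    noncomm_ring
  · intro x m hx
    rw [mul_assoc, map_mul CliffordAlgebra.involute, CliffordAlgebra.involute_ι]
    simp only [contract] at hx ⊢
    rw [CliffordAlgebra.contractLeft_ι_mul, CliffordAlgebra.contractLeft_ι_mul, hx]
    simp only [sub_mul, mul_add, smul_mul_assoc, neg_mul, mul_assoc]
    abel

theorem involute_contract (d : Module.Dual ℝ N) (a : ExteriorAlgebra ℝ N) :
    CliffordAlgebra.involute (contract d a) = -contract d (CliffordAlgebra.involute a) := by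
  refine CliffordAlgebra.left_induction (Q := (0 : QuadraticForm ℝ N)) 
    (P := fun a => CliffordAlgebra.involute (contract d a) =
      -contract d (CliffordAlgebra.involute a)) ?_ ?_ ?_ a
  · intro r
    simp [contract]
  · intro x y hx hy
    rw [map_add, map_add, hx, hy, map_add, map_add, neg_add]
  · intro x m hx
    simp only [contract] at hx ⊢
    simp only [CliffordAlgebra.contractLeft_ι_mul, map_sub, map_smul, map_mul, hx,
      CliffordAlgebra.involute_ι, neg_mul, map_neg, mul_neg]
    abel

/-- This identifies the body of ∂f/∂θ with the slope of the affine function of f along the fibre. -/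
theorem body_contract (d : Module.Dual ℝ N) (a : ExteriorAlgebra ℝ N) :
    body (contract d a) = d (lin a) := by
  refine CliffordAlgebra.left_induction (Q := (0 : QuadraticForm ℝ N)) 
    (P := fun a => body (contract d a) = d (lin a)) ?_ ?_ ?_ a
  · intro r
    have := lin_algebraMap (N := N) r
    rw [this, contract, CliffordAlgebra.contractLeft_algebraMap, map_zero, map_zero]
  · intro x y hx hy
    rw [map_add, map_add, hx, hy, map_add, map_add]
  · intro x m hx
    have h1 : body (CliffordAlgebra.ι (0 : QuadraticForm ℝ N) m) = 0 := body_ι m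
    have h2 : lin (CliffordAlgebra.ι (0 : QuadraticForm ℝ N) m) = m := lin_ι m
    rw [lin_mul, h1, h2, contract, CliffordAlgebra.contractLeft_ι_mul, map_sub, map_mul, h1]
    simp [mul_comm]

theorem contract_mem_evenOdd (d : Module.Dual ℝ N) {p : ZMod 2} {a : ExteriorAlgebra ℝ N}
    (ha : a ∈ CliffordAlgebra.evenOdd (0 : QuadraticForm ℝ N) p) :
    contract d a ∈ CliffordAlgebra.evenOdd (0 : QuadraticForm ℝ N) (1 + p) := by
  rw [mem_evenOdd_iff] at ha ⊢
  rw [involute_contract, ha, sgn_add, sgn_one, map_smul]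
  simp

/-- Degree at most one means being fixed by a linear projection, a form of the condition that
survives differentiation. -/
theorem mem_affine_iff {a : ExteriorAlgebra ℝ N} :
    a ∈ (⋀[ℝ]^0 N ⊔ ⋀[ℝ]^1 N : Submodule ℝ (ExteriorAlgebra ℝ N)) ↔
      algebraMap ℝ _ (body a) + ExteriorAlgebra.ι ℝ (lin a) = a := by
  constructor
  · intro h
    obtain ⟨b, hb, c, hc, rfl⟩ := Submodule.mem_sup.1 h
    rw [ExteriorAlgebra.exteriorPower, pow_zero, Submodule.mem_one] at hb
    rw [ExteriorAlgebra.exteriorPower, pow_one] at hc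
    obtain ⟨r, rfl⟩ := hb
    obtain ⟨n, rfl⟩ := hc
    have := body_ι n
    have h2 := lin_ι n
    rw [map_add body, map_add lin, this, h2, lin_algebraMap, AlgHom.commutes]
    simp
  · intro h
    rw [← h]
    refine Submodule.add_mem_sup ?_ ?_
    · rw [ExteriorAlgebra.exteriorPower, pow_zero, Submodule.mem_one]
      exact ⟨_, rfl⟩
    · rw [ExteriorAlgebra.exteriorPower, pow_one]
      exact ⟨_, rfl⟩

variable {N' : Type*} [AddCommGroup N'] [Module ℝ N'] (L : N →ₗ[ℝ] N')

theorem body_map (a : ExteriorAlgebra ℝ N) : body (ExteriorAlgebra.map L a) = body a := by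
  have : (body (N := N')).comp (ExteriorAlgebra.map L) = body := by
    apply ExteriorAlgebra.hom_ext
    ext m
    simp [body_ι]
  exact DFunLike.congr_fun this a

theorem lin_map (a : ExteriorAlgebra ℝ N) : lin (ExteriorAlgebra.map L a) = L (lin a) :=
  DFunLike.congr_fun (ExteriorAlgebra.ιInv_comp_map L) a

theorem involute_map (a : ExteriorAlgebra ℝ N) :
    ExteriorAlgebra.map L (CliffordAlgebra.involute a) =
      CliffordAlgebra.involute (ExteriorAlgebra.map L a) := by
  have h : (ExteriorAlgebra.map L).comp CliffordAlgebra.involute =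
      (CliffordAlgebra.involute).comp (ExteriorAlgebra.map L) := by
    apply ExteriorAlgebra.hom_ext
    ext m
    simp
  exact DFunLike.congr_fun h a

theorem map_mem_evenOdd {p : ZMod 2} {a : ExteriorAlgebra ℝ N}
    (ha : a ∈ CliffordAlgebra.evenOdd (0 : QuadraticForm ℝ N) p) :
    ExteriorAlgebra.map L a ∈ CliffordAlgebra.evenOdd (0 : QuadraticForm ℝ N') p := by
  rw [mem_evenOdd_iff] at ha ⊢
  rw [← involute_map, ha, map_smul]

theorem map_mem_affine {a : ExteriorAlgebra ℝ N}
    (ha : a ∈ (⋀[ℝ]^0 N ⊔ ⋀[ℝ]^1 N : Submodule ℝ (ExteriorAlgebra ℝ N))) :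
    ExteriorAlgebra.map L a ∈
      (⋀[ℝ]^0 N' ⊔ ⋀[ℝ]^1 N' : Submodule ℝ (ExteriorAlgebra ℝ N')) := by
  rw [mem_affine_iff] at ha ⊢
  rw [body_map, lin_map]
  conv_rhs => rw [← ha]
  simp

end Exterior

/-! ### The model algebra Λ F^* as a normed space -/

section ModelAlgebra

variable (F : Type*) [NormedAddCommGroup F] [NormedSpace ℝ F] [FiniteDimensional ℝ F]

/-- The exterior algebra `Λ F^*`. -/
abbrev ModelAlg : Type _ := ExteriorAlgebra ℝ (Module.Dual ℝ F)

instance modelAlgFinite : Module.Finite ℝ (ModelAlg F) :=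
  Module.Finite.of_basis (Module.finBasis ℝ (Module.Dual ℝ F)).ExteriorAlgebra

/-- The choice of norm is irrelevant in finite dimension; some norm is needed to differentiate
functions with values in Λ F^*. -/
instance modelAlgNormed : NormedAddCommGroup (ModelAlg F) :=
  NormedAddCommGroup.induced _ _
    (Module.finBasis ℝ (ModelAlg F)).equivFun.toLinearMap.toAddMonoidHom
    (Module.finBasis ℝ (ModelAlg F)).equivFun.injective

instance modelAlgNormedSpace : NormedSpace ℝ (ModelAlg F) :=
  NormedSpace.induced ℝ _ _ (Module.finBasis ℝ (ModelAlg F)).equivFun.toLinearMap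

/-- Linear maps on `Λ F^*` are continuous. -/
abbrev modelCLM {F} [NormedAddCommGroup F] [NormedSpace ℝ F] [FiniteDimensional ℝ F]
    {G : Type*} [NormedAddCommGroup G] [NormedSpace ℝ G]
    (l : ModelAlg F →ₗ[ℝ] G) : ModelAlg F →L[ℝ] G := LinearMap.toContinuousLinearMap l

/-- The multiplication of `Λ F^*`, as a continuous bilinear map. -/
def modelMul : ModelAlg F →L[ℝ] ModelAlg F →L[ℝ] ModelAlg F :=
  modelCLM ((LinearMap.toContinuousLinearMap : _ ≃ₗ[ℝ] (ModelAlg F →L[ℝ] ModelAlg F)).toLinearMap ∘ₗ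
    LinearMap.mul ℝ (ModelAlg F))

variable {F}
variable {B : Type*} [NormedAddCommGroup B] [NormedSpace ℝ B]

end ModelAlgebra

/-! ### Hadamard's lemma -/

section Hadamard

variable {B : Type*} [NormedAddCommGroup B] [NormedSpace ℝ B] 
  {G : Type*} [NormedAddCommGroup G] [NormedSpace ℝ G]

open MeasureTheory in
/-- The integral of a smooth function over `[0, 1]` depends smoothly on parameters. -/
theorem contDiff_intervalIntegral_param {g : B × ℝ → G} (hg : ContDiff ℝ ∞ g) :
    ContDiff ℝ ∞ fun p => ∫ u in (0 : ℝ)..1, g (p, u) := by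
  -- The bump equals 1 on [0, 1] and cuts the integrand off outside the ball of radius 2, so that
  -- the integral becomes a convolution with a compactly supported smooth function.
  let b : ContDiffBump (0 : ℝ) := ⟨1, 2, one_pos, one_lt_two⟩
  let g' : B → ℝ → G := fun p u => b u • g (p, u)
  have hg' : ContDiff ℝ ∞ (↿g') := by
    have h2 : ContDiff ℝ ∞ (fun q : B × ℝ => b q.2) := b.contDiff.comp contDiff_snd
    exact h2.smul hg
  -- Convolution at the point 0 evaluates the integrand at -t, hence the indicator of the reflected
  -- interval.
  let ind : ℝ → ℝ := (Set.Ioc (-1 : ℝ) 0).indicator 1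
  have hind : LocallyIntegrable ind := by
    apply Integrable.locallyIntegrable
    rw [integrable_indicator_iff measurableSet_Ioc]
    exact integrableOn_const (by simp)
  have key := contDiffOn_convolution_right_with_param_comp (𝕜 := ℝ) (μ := volume) (n := ⊤)
    (ContinuousLinearMap.lsmul ℝ ℝ : ℝ →L[ℝ] G →L[ℝ] G)
    (s := (Set.univ : Set B)) (v := fun _ => (0 : ℝ)) contDiffOn_const (f := ind) (g := g')
    (k := Metric.closedBall 0 2) isOpen_univ (isCompact_closedBall _ _) ?_ hind
    (by simpa using hg'.contDiffOn)
  · rw [contDiffOn_univ] at key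
    convert! key using 2 with z
    rw [convolution_def]
    have : (fun t => (ContinuousLinearMap.lsmul ℝ ℝ (ind t)) (g' z (0 - t))) =
        (Set.Ioc (-1 : ℝ) 0).indicator (fun t => g' z (-t)) := by
      funext t
      by_cases ht : t ∈ Set.Ioc (-1 : ℝ) 0 <;> simp [ind, ht]
    rw [this, integral_indicator measurableSet_Ioc,
      ← intervalIntegral.integral_of_le (by norm_num), intervalIntegral.integral_comp_neg]
    simp only [neg_zero, neg_neg]
    refine intervalIntegral.integral_congr fun u hu => ?_
    rw [Set.uIcc_of_le zero_le_one] at hu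
    have : b u = 1 := b.one_of_mem_closedBall (by
      simp only [b, Metric.mem_closedBall, dist_zero_right, Real.norm_eq_abs]
      rw [abs_of_nonneg hu.1]; exact hu.2)
    simp [g', this]
  · intro p x _ hx
    have : b x = 0 := b.zero_of_le_dist (by
      simp only [Metric.mem_closedBall, not_le] at hx
      exact hx.le)
    simp [g', this]

/-- Hadamard's lemma for functions which are smooth on the whole space. -/
theorem exists_hadamard_global [CompleteSpace G] {f : B → G} (hf : ContDiff ℝ ∞ f) (y : B) :
    ∃ h : B → (B →L[ℝ] G), ContDiff ℝ ∞ h ∧ ∀ z, f z = f y + h z (z - y) := by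
  have hG : ContDiff ℝ ∞ fun q : B × ℝ => fderiv ℝ f (y + q.2 • (q.1 - y)) := by
    have h1 : ContDiff ℝ ∞ (fderiv ℝ f) := hf.fderiv_right (by simp)
    have h3 : ContDiff ℝ ∞ (fun q : B × ℝ => y + q.2 • (q.1 - y)) := by fun_prop
    exact h1.comp h3
  -- The witness is h(z) = ∫₀¹ f'(y + u(z - y)) du; the identity is the fundamental theorem of
  -- calculus on the segment from y to z.
  refine ⟨_, contDiff_intervalIntegral_param hG, fun z => ?_⟩
  have hc : Continuous (fun u : ℝ => fderiv ℝ f (y + u • (z - y))) :=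
    (hf.continuous_fderiv (by simp)).comp (by fun_prop)
  rw [ContinuousLinearMap.intervalIntegral_apply (hc.intervalIntegrable _ _)]
  have hd : ∀ u ∈ Set.uIcc (0 : ℝ) 1, HasDerivAt (fun u : ℝ => f (y + u • (z - y)))
      (fderiv ℝ f (y + u • (z - y)) (z - y)) u := fun u _ => by
    have h4 : HasDerivAt (fun u : ℝ => y + u • (z - y)) (z - y) u := by
      simpa using ((hasDerivAt_id u).smul_const (z - y)).const_add y
    exact ((hf.differentiable (by simp)) _).hasFDerivAt.comp_hasDerivAt u h4
  rw [intervalIntegral.integral_eq_sub_of_hasDerivAt hd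
    ((hc.clm_apply continuous_const).intervalIntegrable _ _)]
  simp

/-- Hadamard's lemma. -/
theorem exists_hadamard [CompleteSpace G] [FiniteDimensional ℝ B] {f : B → G} {s : Set B} (hs : IsOpen s)
    (hf : ContDiffOn ℝ ∞ f s) {y : B} (hy : y ∈ s) :
    ∃ t ⊆ s, IsOpen t ∧ y ∈ t ∧ ∃ h : B → (B →L[ℝ] G), ContDiff ℝ ∞ h ∧
      ∀ z ∈ t, f z = f y + h z (z - y) := by
  obtain ⟨r, hr, hrs⟩ := Metric.isOpen_iff.1 hs y hy
  -- The outer radius stays below r, so that b • f extends smoothly by zero. On the inner ball b is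
  -- 1 and the global factorization is one for f.
  let b : ContDiffBump y := ⟨r / 3, r / 2, by positivity, by linarith⟩
  have hsm : ContDiff ℝ ∞ (fun z => b z • f z) := by
    rw [contDiff_iff_contDiffAt]
    intro z
    by_cases hz : z ∈ Metric.ball y r
    · exact b.contDiffAt.smul (hf.contDiffAt (hs.mem_nhds (hrs hz)))
    · have : (fun z => b z • f z) =ᶠ[nhds z] fun _ => 0 := by
        have hz' : z ∈ (Metric.closedBall y (r / 2))ᶜ := by
          simp only [Metric.mem_ball, not_lt] at hz
          simp only [Set.mem_compl_iff, Metric.mem_closedBall, not_le]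
          linarith
        filter_upwards [Metric.isClosed_closedBall.isOpen_compl.mem_nhds hz'] with w hw
        have : b w = 0 := b.zero_of_le_dist (by
          simp only [Set.mem_compl_iff, Metric.mem_closedBall, not_le] at hw
          exact hw.le)
        rw [this, zero_smul]
      exact contDiffAt_const.congr_of_eventuallyEq this
  obtain ⟨h, hh, hh'⟩ := exists_hadamard_global hsm y
  have h1 : ∀ z ∈ Metric.ball y (r / 3), b z = 1 := fun z hz =>
    b.one_of_mem_closedBall (Metric.ball_subset_closedBall hz)
  refine ⟨Metric.ball y (r / 3), (Metric.ball_subset_ball (by linarith)).trans hrs,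
    Metric.isOpen_ball, Metric.mem_ball_self (by positivity), h, hh, fun z hz => ?_⟩
  have := hh' z
  rwa [h1 z hz, h1 y (Metric.mem_ball_self (by positivity)), one_smul, one_smul] at this

end Hadamard

/-! ### Superfunctions as functions with values in Λ F^* -/

section LocalRepresentation

variable {B : Type*} [NormedAddCommGroup B] [NormedSpace ℝ B]
  {F : Type*} [NormedAddCommGroup F] [NormedSpace ℝ F] [FiniteDimensional ℝ F]

section MapSmooth

variable {M : Type*} [TopologicalSpace M] [ChartedSpace B M]

/-- This connects the functional-by-functional condition in `IsSmoothSection` with smoothness of one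
vector-valued map; the coordinates of a finite basis suffice. -/
theorem contMDiffAt_model_iff {s : M → ModelAlg F} {x : M} {n : ℕ∞ω} :
    ContMDiffAt 𝓘(ℝ, B) 𝓘(ℝ, ModelAlg F) n s x ↔
      ∀ l : Module.Dual ℝ (ModelAlg F), ContMDiffAt 𝓘(ℝ, B) 𝓘(ℝ, ℝ) n (fun y => l (s y)) x := by
  refine ⟨fun h l => (modelCLM l).contDiff.contMDiff.contMDiffAt.comp x h, fun h => ?_⟩
  let e := (Module.finBasis ℝ (ModelAlg F)).equivFun.toContinuousLinearEquiv
  have h1 : ContMDiffAt 𝓘(ℝ, B) 𝓘(ℝ, Fin (Module.finrank ℝ (ModelAlg F)) → ℝ) n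
      (fun y => e (s y)) x := by
    rw [contMDiffAt_pi_space]
    exact fun i => h ((Module.finBasis ℝ (ModelAlg F)).coord i)
  have h2 := e.symm.contDiff.contMDiff.contMDiffAt.comp (n := n) x h1
  refine h2.congr_of_eventuallyEq (Filter.Eventually.of_forall fun y => ?_)
  simp

theorem contMDiffAt_model_mul {s t : M → ModelAlg F} {x : M} {n : ℕ∞ω}
    (hs : ContMDiffAt 𝓘(ℝ, B) 𝓘(ℝ, ModelAlg F) n s x)
    (ht : ContMDiffAt 𝓘(ℝ, B) 𝓘(ℝ, ModelAlg F) n t x) :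
    ContMDiffAt 𝓘(ℝ, B) 𝓘(ℝ, ModelAlg F) n (fun y => s y * t y) x := by
  have h1 := ((modelMul F).contDiff.contMDiff.contMDiffAt.comp (n := n) x hs).clm_apply ht
  exact h1

/-- The algebra map `Λ F^* → Λ F^*` induced by a linear endomorphism of `F`. -/
abbrev pullAlg (C : F →L[ℝ] F) : ModelAlg F →ₐ[ℝ] ModelAlg F :=
  ExteriorAlgebra.map (C : F →ₗ[ℝ] F).dualMap

/-- The induced map is linear in C on generators and multiplicative, so its value on a fixed element
is polynomial in C. -/
theorem contMDiffAt_pullAlg_const {C : M → F →L[ℝ] F} {x : M} {n : ℕ∞ω}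
    (hC : ContMDiffAt 𝓘(ℝ, B) 𝓘(ℝ, F →L[ℝ] F) n C x) (a : ModelAlg F) :
    ContMDiffAt 𝓘(ℝ, B) 𝓘(ℝ, ModelAlg F) n (fun y => pullAlg (C y) a) x := by
  refine CliffordAlgebra.left_induction (Q := (0 : QuadraticForm ℝ (Module.Dual ℝ F)))
    (P := fun a => ContMDiffAt 𝓘(ℝ, B) 𝓘(ℝ, ModelAlg F) n (fun y => pullAlg (C y) a) x)
    ?_ ?_ ?_ a
  · intro r
    refine (contMDiffAt_const (c := algebraMap ℝ (ModelAlg F) r)).congr_of_eventuallyEq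
      (Filter.Eventually.of_forall fun y => ?_)
    exact AlgHom.commutes _ _
  · intro a b ha hb
    refine (ha.add hb).congr_of_eventuallyEq (Filter.Eventually.of_forall fun y => ?_)
    exact map_add _ _ _
  · intro a m ha
    let k : (F →L[ℝ] F) →L[ℝ] ModelAlg F := LinearMap.toContinuousLinearMap
      { toFun := fun D => ExteriorAlgebra.ι ℝ ((D : F →ₗ[ℝ] F).dualMap m)
        map_add' := fun D D' => by
          rw [← map_add]; congr 1; ext v; simp
        map_smul' := fun c D => by
          rw [RingHom.id_apply, ← map_smul]; congr 1; ext v; simp }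
    have hk : ContMDiffAt 𝓘(ℝ, B) 𝓘(ℝ, ModelAlg F) n (fun y => k (C y)) x :=
      k.contDiff.contMDiff.contMDiffAt.comp x hC
    refine (contMDiffAt_model_mul hk ha).congr_of_eventuallyEq (Filter.Eventually.of_forall fun y => ?_)
    change pullAlg (C y) (ExteriorAlgebra.ι ℝ m * a) = _
    rw [map_mul, ExteriorAlgebra.map_apply_ι]
    rfl

theorem contMDiffAt_pullAlg {C : M → F →L[ℝ] F} {s : M → ModelAlg F} {x : M} {n : ℕ∞ω}
    (hC : ContMDiffAt 𝓘(ℝ, B) 𝓘(ℝ, F →L[ℝ] F) n C x)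
    (hs : ContMDiffAt 𝓘(ℝ, B) 𝓘(ℝ, ModelAlg F) n s x) :
    ContMDiffAt 𝓘(ℝ, B) 𝓘(ℝ, ModelAlg F) n (fun y => pullAlg (C y) (s y)) x := by
  let β := Module.finBasis ℝ (ModelAlg F)
  have h : ContMDiffAt 𝓘(ℝ, B) 𝓘(ℝ, ModelAlg F) n
      (fun y => ∑ i, β.coord i (s y) • pullAlg (C y) (β i)) x :=
    ContMDiffAt.sum fun i _ => (contMDiffAt_model_iff.1 hs (β.coord i)).smul
      (contMDiffAt_pullAlg_const hC (β i))
  refine h.congr_of_eventuallyEq (Filter.Eventually.of_forall fun y => ?_)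
  change pullAlg (C y) (s y) = _
  conv_lhs => rw [← β.sum_repr (s y)]
  simp only [map_sum, map_smul, Module.Basis.coord_apply]

end MapSmooth

variable {M : Type*} [TopologicalSpace M] [ChartedSpace B M]
  {V : M → Type*} [TopologicalSpace (TotalSpace F V)]
  [∀ x, AddCommGroup (V x)] [∀ x, Module ℝ (V x)] [∀ x, TopologicalSpace (V x)]
  [FiberBundle F V] [VectorBundle ℝ F V]

/-- The map `Λ(F^*) → Λ(V_x^*)` induced by the local trivialization chosen at `x₀`. -/
def fromModel (x₀ x : M) : ModelAlg F →ₐ[ℝ] ExteriorAlgebra ℝ (Module.Dual ℝ (V x)) :=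
  ExteriorAlgebra.map ((trivializationAt F V x₀).linearMapAt ℝ x).dualMap

theorem toModel_fromModel {x₀ x : M} (hx : x ∈ (trivializationAt F V x₀).baseSet)
    (a : ModelAlg F) : toModel F V x₀ x (fromModel (V := V) x₀ x a) = a := by
  rw [toModel, fromModel, ← AlgHom.comp_apply, ExteriorAlgebra.map_comp_map]
  have : ((trivializationAt F V x₀).symmₗ ℝ x).dualMap ∘ₗ
      ((trivializationAt F V x₀).linearMapAt ℝ x).dualMap = LinearMap.id := by
    ext l v
    simp only [LinearMap.comp_apply, LinearMap.dualMap_apply, LinearMap.id_apply]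
    rw [Trivialization.linearMapAt_symmₗ _ hx]
  rw [this, ExteriorAlgebra.map_id, AlgHom.id_apply]

theorem fromModel_toModel {x₀ x : M} (hx : x ∈ (trivializationAt F V x₀).baseSet)
    (a : ExteriorAlgebra ℝ (Module.Dual ℝ (V x))) :
    fromModel x₀ x (toModel F V x₀ x a) = a := by
  rw [toModel, fromModel, ← AlgHom.comp_apply, ExteriorAlgebra.map_comp_map]
  have : ((trivializationAt F V x₀).linearMapAt ℝ x).dualMap ∘ₗ
      ((trivializationAt F V x₀).symmₗ ℝ x).dualMap = LinearMap.id := by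
    ext l v
    simp only [LinearMap.comp_apply, LinearMap.dualMap_apply, LinearMap.id_apply]
    rw [Trivialization.symmₗ_linearMapAt _ hx]
  rw [this, ExteriorAlgebra.map_id, AlgHom.id_apply]

/-- Pulling back forms is contravariant: the passage from the trivialization at y to the one at x₀
uses the coordinate change from x₀ to y. -/
theorem toModel_change {x₀ y x : M} (hx : x ∈ (trivializationAt F V x₀).baseSet)
    (hy : x ∈ (trivializationAt F V y).baseSet) (a : ExteriorAlgebra ℝ (Module.Dual ℝ (V x))) :
    toModel F V x₀ x a = pullAlg
      ((trivializationAt F V x₀).coordChangeL ℝ (trivializationAt F V y) x : F →L[ℝ] F)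
      (toModel F V y x a) := by
  rw [toModel, toModel, pullAlg, ← AlgHom.comp_apply, ExteriorAlgebra.map_comp_map]
  congr 2
  ext l v
  simp only [LinearMap.comp_apply, LinearMap.dualMap_apply]
  congr 1
  simp only [ContinuousLinearMap.coe_coe, ContinuousLinearEquiv.coe_coe]
  rw [Trivialization.coe_coordChangeL _ _ ⟨hx, hy⟩]
  rw [Trivialization.symmₗ_apply _ hx, Trivialization.symmₗ_apply _ hy]
  simp [Trivialization.symm_apply_apply_mk, hy]

variable (B F V) in
/-- The intersection of the domains of the chart and of the local trivialization at `x₀`. -/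
def coordDomain (x₀ : M) : Opens M :=
  ⟨(chartAt B x₀).source ∩ (trivializationAt F V x₀).baseSet,
    (chartAt B x₀).open_source.inter (trivializationAt F V x₀).open_baseSet⟩

theorem mem_coordDomain (x₀ : M) : x₀ ∈ coordDomain B F V x₀ :=
  ⟨mem_chart_source B x₀, FiberBundle.mem_baseSet_trivializationAt' x₀⟩

/-- The image of an open set under the chart at `x₀`. -/
def chartImage (x₀ : M) (W : Opens M) : Set B :=
  (chartAt B x₀).target ∩ (chartAt B x₀).symm ⁻¹' W

theorem isOpen_chartImage (x₀ : M) (W : Opens M) : IsOpen (chartImage (B := B) x₀ W) :=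
  (chartAt B x₀).isOpen_inter_preimage_symm W.2

theorem chartImage_mono {x₀ : M} {W W' : Opens M} (h : W ≤ W') :
    chartImage (B := B) x₀ W ⊆ chartImage x₀ W' := fun _ hz => ⟨hz.1, h hz.2⟩

theorem chart_mem_chartImage {x₀ : M} {W : Opens M} (hW : W ≤ coordDomain B F V x₀) {x : M}
    (hx : x ∈ W) : chartAt B x₀ x ∈ chartImage x₀ W :=
  ⟨(chartAt B x₀).map_source (hW hx).1, by
    rw [Set.mem_preimage, (chartAt B x₀).left_inv (hW hx).1]; exact hx⟩

open Classical in
/-- The local representation `B → Λ F^*` of a superfunction in the coordinates at `x₀`. -/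
def rep (x₀ : M) {W : Opens M} (f : superFun B F V W) : B → ModelAlg F := fun z =>
  if h : (chartAt B x₀).symm z ∈ W then toModel F V x₀ _ (f.1 ⟨_, h⟩) else 0

theorem rep_apply {x₀ : M} {W : Opens M} (f : superFun B F V W) {z : B}
    (hz : z ∈ chartImage x₀ W) :
    rep x₀ f z = toModel F V x₀ _ (f.1 ⟨(chartAt B x₀).symm z, hz.2⟩) := dif_pos hz.2

theorem rep_chart {x₀ : M} {W : Opens M} (hW : W ≤ coordDomain B F V x₀) (f : superFun B F V W)
    {x : M} (hx : x ∈ W) : rep x₀ f (chartAt B x₀ x) = toModel F V x₀ x (f.1 ⟨x, hx⟩) := by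
  have key : ∀ y : M, y = x → ∀ hy : y ∈ W,
      toModel F V x₀ y (f.1 ⟨y, hy⟩) = toModel F V x₀ x (f.1 ⟨x, hx⟩) := by
    rintro y rfl hy; rfl
  rw [rep_apply f (chart_mem_chartImage hW hx)]
  exact key _ ((chartAt B x₀).left_inv (hW hx).1) _

theorem rep_add {x₀ : M} {W : Opens M} (f g : superFun B F V W) {z : B} :
    rep x₀ (f + g) z = rep x₀ f z + rep x₀ g z := by
  unfold rep
  split_ifs with h
  · exact map_add _ _ _
  · simp

theorem rep_smul {x₀ : M} {W : Opens M} (c : ℝ) (f : superFun B F V W) {z : B} :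
    rep x₀ (c • f) z = c • rep x₀ f z := by
  unfold rep
  split_ifs with h
  · exact map_smul (toModel F V x₀ _) _ _
  · simp

theorem rep_mul {x₀ : M} {W : Opens M} (f g : superFun B F V W) {z : B} :
    rep x₀ (f * g) z = rep x₀ f z * rep x₀ g z := by
  unfold rep
  split_ifs with h
  · exact map_mul _ _ _
  · simp

/-- Local representation as a linear map. -/
def repLin (x₀ : M) (W : Opens M) (z : B) : superFun B F V W →ₗ[ℝ] ModelAlg F where
  toFun f := rep x₀ f z
  map_add' f g := rep_add f g
  map_smul' c f := rep_smul c f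

theorem rep_sum {x₀ : M} {W : Opens M} {ι : Type*} (s : Finset ι) (f : ι → superFun B F V W)
    {z : B} : rep x₀ (∑ i ∈ s, f i) z = ∑ i ∈ s, rep x₀ (f i) z :=
  map_sum (repLin x₀ W z) f s

theorem rep_algebraMap {x₀ : M} {W : Opens M} (r : ℝ) {z : B} (hz : z ∈ chartImage x₀ W) :
    rep x₀ (algebraMap ℝ (superFun B F V W) r) z = algebraMap ℝ _ r := by
  rw [rep_apply _ hz]
  exact AlgHom.commutes _ _

theorem rep_one {x₀ : M} {W : Opens M} {z : B} (hz : z ∈ chartImage x₀ W) :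
    rep x₀ (1 : superFun B F V W) z = 1 := by
  simpa using rep_algebraMap (F := F) (V := V) 1 hz

theorem rep_res {x₀ : M} {W W' : Opens M} (h : W' ≤ W) (f : superFun B F V W) {z : B}
    (hz : z ∈ chartImage x₀ W') : rep x₀ (res h f) z = rep x₀ f z := by
  rw [rep_apply _ hz, rep_apply _ (chartImage_mono h hz)]
  rfl

theorem rep_ext {x₀ : M} {W : Opens M} (hW : W ≤ coordDomain B F V x₀) {f g : superFun B F V W}
    (h : ∀ z ∈ chartImage x₀ W, rep x₀ f z = rep x₀ g z) : f = g := by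
  apply Subtype.ext
  funext ⟨x, hx⟩
  have := h _ (chart_mem_chartImage hW hx)
  rw [rep_chart hW f hx, rep_chart hW g hx] at this
  rw [← fromModel_toModel (hW hx).2 (f.1 ⟨x, hx⟩), this, fromModel_toModel (hW hx).2]

theorem hasParity_iff_rep {x₀ : M} {W : Opens M} (hW : W ≤ coordDomain B F V x₀)
    {f : superFun B F V W} {p : ZMod 2} :
    HasParity p f ↔ ∀ z ∈ chartImage x₀ W,
      rep x₀ f z ∈ CliffordAlgebra.evenOdd (0 : QuadraticForm ℝ (Module.Dual ℝ F)) p := by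
  refine ⟨fun h z hz => ?_, fun h ⟨x, hx⟩ => ?_⟩
  · rw [rep_apply _ hz]
    exact map_mem_evenOdd _ (h _)
  · rw [← fromModel_toModel (hW hx).2 (f.1 ⟨x, hx⟩), ← rep_chart hW f hx]
    exact map_mem_evenOdd _ (h _ (chart_mem_chartImage hW hx))

theorem isAffine_iff_rep {x₀ : M} {W : Opens M} (hW : W ≤ coordDomain B F V x₀)
    {f : superFun B F V W} :
    IsAffine f ↔ ∀ z ∈ chartImage x₀ W,
      algebraMap ℝ _ (body (rep x₀ f z)) + ExteriorAlgebra.ι ℝ (lin (rep x₀ f z)) =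
        rep x₀ f z := by
  refine ⟨fun h z hz => mem_affine_iff.1 ?_, fun h ⟨x, hx⟩ => ?_⟩
  · rw [rep_apply _ hz]
    exact map_mem_affine _ (h _)
  · rw [← fromModel_toModel (hW hx).2 (f.1 ⟨x, hx⟩), ← rep_chart hW f hx]
    exact map_mem_affine _ (mem_affine_iff.2 (h _ (chart_mem_chartImage hW hx)))

variable [IsManifold 𝓘(ℝ, B) ∞ M] [ContMDiffVectorBundle ∞ F V 𝓘(ℝ, B)]

/-- `IsSmoothSection` tests smoothness at a point only in the trivialization chosen at that very
point. Composing with the smooth change of trivialization gives smoothness in the single one at x₀.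
-/
theorem contDiffOn_rep {x₀ : M} {W : Opens M} (hW : W ≤ coordDomain B F V x₀)
    (f : superFun B F V W) : ContDiffOn ℝ ∞ (rep x₀ f) (chartImage x₀ W) := by
  classical
  let g : M → M → ModelAlg F := fun y x => if h : x ∈ W then toModel F V y x (f.1 ⟨x, h⟩) else 0
  have h1 : ∀ y : M, y ∈ W → ContMDiffAt 𝓘(ℝ, B) 𝓘(ℝ, ModelAlg F) ∞ (g y) y := fun y hy => by
    have h2 : ContMDiffAt 𝓘(ℝ, B) 𝓘(ℝ, ModelAlg F) ∞ (fun x : W => g y x) ⟨y, hy⟩ := by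
      rw [contMDiffAt_model_iff]
      intro l
      refine (f.2 ⟨y, hy⟩ l).congr_of_eventuallyEq (Filter.Eventually.of_forall fun x => ?_)
      simp [g, x.2]
    exact contMDiffAt_subtype_iff.1 h2
  have h3 : ∀ y : M, y ∈ W → ContMDiffAt 𝓘(ℝ, B) 𝓘(ℝ, ModelAlg F) ∞ (g x₀) y := fun y hy => by
    have hC := (contMDiffOn_coordChangeL (n := ∞) (IB := 𝓘(ℝ, B)) (trivializationAt F V x₀)
      (trivializationAt F V y)).contMDiffAt (x := y) (((trivializationAt F V x₀).open_baseSet.inter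
        (trivializationAt F V y).open_baseSet).mem_nhds
          ⟨(hW hy).2, FiberBundle.mem_baseSet_trivializationAt' y⟩)
    refine (contMDiffAt_pullAlg hC (h1 y hy)).congr_of_eventuallyEq ?_
    filter_upwards [(((trivializationAt F V x₀).open_baseSet.inter
        (trivializationAt F V y).open_baseSet).mem_nhds
          ⟨(hW hy).2, FiberBundle.mem_baseSet_trivializationAt' y⟩)] with x hx
    simp only [g]
    split_ifs with h
    · exact toModel_change hx.1 hx.2 _
    · simp
  intro z hz
  have h4 : ContMDiffAt 𝓘(ℝ, B) 𝓘(ℝ, B) ∞ (chartAt B x₀).symm z :=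
    (contMDiffOn_chart_symm (I := 𝓘(ℝ, B)) (n := ∞)).contMDiffAt
      ((chartAt B x₀).open_target.mem_nhds hz.1)
  have h5 := (h3 _ hz.2).comp z h4
  exact (contMDiffAt_iff_contDiffAt.1 h5).contDiffWithinAt

/-- The superfunction with a given local representation. -/
def ofRep (x₀ : M) {W : Opens M} (hW : W ≤ coordDomain B F V x₀) (s : B → ModelAlg F)
    (hs : ContDiffOn ℝ ∞ s (chartImage x₀ W)) : superFun B F V W :=
  ⟨fun x => fromModel x₀ x (s (chartAt B x₀ x)), fun y => by
    refine contMDiffAt_model_iff.1 ?_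
    refine contMDiffAt_subtype_iff (f := fun x : M =>
      toModel F V y x (fromModel (V := V) x₀ x (s (chartAt B x₀ x)))) |>.2 ?_
    have hy := hW y.2
    have hn := (((trivializationAt F V y.1).open_baseSet.inter
        (trivializationAt F V x₀).open_baseSet).mem_nhds
          ⟨FiberBundle.mem_baseSet_trivializationAt' y.1, hy.2⟩)
    have hC := (contMDiffOn_coordChangeL (n := ∞) (IB := 𝓘(ℝ, B)) (trivializationAt F V y.1)
      (trivializationAt F V x₀)).contMDiffAt hn
    have h1 : ContMDiffAt 𝓘(ℝ, B) 𝓘(ℝ, B) ∞ (chartAt B x₀) y.1 :=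
      (contMDiffOn_chart (I := 𝓘(ℝ, B)) (n := ∞)).contMDiffAt
        ((chartAt B x₀).open_source.mem_nhds hy.1)
    have h2 : ContMDiffAt 𝓘(ℝ, B) 𝓘(ℝ, ModelAlg F) ∞ s (chartAt B x₀ y.1) :=
      (hs.contDiffAt ((isOpen_chartImage x₀ W).mem_nhds
        (chart_mem_chartImage hW y.2))).contMDiffAt
    refine (contMDiffAt_pullAlg hC (h2.comp y.1 h1)).congr_of_eventuallyEq ?_
    filter_upwards [hn] with x hx
    rw [toModel_change hx.1 hx.2, toModel_fromModel hx.2]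
    rfl⟩

theorem rep_ofRep {x₀ : M} {W : Opens M} (hW : W ≤ coordDomain B F V x₀) (s : B → ModelAlg F)
    (hs : ContDiffOn ℝ ∞ s (chartImage x₀ W)) {z : B} (hz : z ∈ chartImage x₀ W) :
    rep x₀ (ofRep (V := V) x₀ hW s hs) z = s z := by
  rw [rep_apply _ hz]
  change toModel F V x₀ _ (fromModel x₀ _ (s (chartAt B x₀ ((chartAt B x₀).symm z)))) = s z
  rw [(chartAt B x₀).right_inv hz.1, toModel_fromModel (hW hz.2).2]

end LocalRepresentation

/-! ### Coordinate derivations and the expansion of superderivations -/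

section Frames

/-- The index set of a local frame of the tangent sheaf: even and odd coordinates. -/
abbrev FrameIdx (B F : Type*) [NormedAddCommGroup B] [NormedSpace ℝ B]
    [NormedAddCommGroup F] [NormedSpace ℝ F] : Type :=
  Fin (Module.finrank ℝ B) ⊕ Fin (Module.finrank ℝ F)

variable {B : Type*} [NormedAddCommGroup B] [NormedSpace ℝ B] [FiniteDimensional ℝ B]
  {F : Type*} [NormedAddCommGroup F] [NormedSpace ℝ F] [FiniteDimensional ℝ F]
  {M : Type*} [TopologicalSpace M] [ChartedSpace B M]
  {V : M → Type*} [TopologicalSpace (TotalSpace F V)]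
  [∀ x, AddCommGroup (V x)] [∀ x, Module ℝ (V x)] [∀ x, TopologicalSpace (V x)]
  [FiberBundle F V] [VectorBundle ℝ F V]

/-- The parity of a coordinate. -/
def idxParity : FrameIdx B F → ZMod 2 := Sum.elim (fun _ => 0) fun _ => 1

/-- The contraction `∂/∂θ_a` on `Λ F^*`. -/
def contractBasis (a : Fin (Module.finrank ℝ F)) : ModelAlg F →ₗ[ℝ] ModelAlg F :=
  contract (Module.Dual.eval ℝ F (Module.finBasis ℝ F a))

/-- The coordinate derivations on functions with values in `Λ F^*`. -/
def frameDeriv (k : FrameIdx B F) (s : B → ModelAlg F) (z : B) : ModelAlg F :=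
  Sum.elim (fun i => fderiv ℝ s z (Module.finBasis ℝ B i)) (fun a => contractBasis a (s z)) k

/-- The coordinates as functions with values in `Λ F^*`. -/
def coordFun (k : FrameIdx B F) (z : B) : ModelAlg F :=
  Sum.elim (fun i => algebraMap ℝ (ModelAlg F) ((Module.finBasis ℝ B).coord i z))
    (fun a => ExteriorAlgebra.ι ℝ ((Module.finBasis ℝ F).coord a)) k

theorem contDiff_coordFun (k : FrameIdx B F) : ContDiff ℝ ∞ (coordFun k : B → ModelAlg F) := by
  rcases k with i | a
  · exact (LinearMap.toContinuousLinearMap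
      ((Algebra.linearMap ℝ (ModelAlg F)) ∘ₗ (Module.finBasis ℝ B).coord i)).contDiff
  · exact contDiff_const

theorem frameDeriv_congr {k : FrameIdx B F} {s t : B → ModelAlg F} {z : B}
    (h : s =ᶠ[nhds z] t) : frameDeriv k s z = frameDeriv k t z := by
  rcases k with i | a
  · simp only [frameDeriv, Sum.elim_inl, h.fderiv_eq]
  · simp only [frameDeriv, Sum.elim_inr, h.eq_of_nhds]

theorem contDiffOn_frameDeriv (k : FrameIdx B F) {s : B → ModelAlg F} {t : Set B}
    (ht : IsOpen t) (hs : ContDiffOn ℝ ∞ s t) : ContDiffOn ℝ ∞ (frameDeriv k s) t := by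
  rcases k with i | a
  · exact (hs.fderiv_of_isOpen ht (by simp)).clm_apply contDiffOn_const
  · exact (modelCLM (contractBasis a)).contDiff.comp_contDiffOn hs

theorem frameDeriv_add (k : FrameIdx B F) {s t : B → ModelAlg F} {z : B}
    (hs : DifferentiableAt ℝ s z) (ht : DifferentiableAt ℝ t z) :
    frameDeriv k (fun y => s y + t y) z = frameDeriv k s z + frameDeriv k t z := by
  rcases k with i | a
  · simp only [frameDeriv, Sum.elim_inl, fderiv_fun_add hs ht, add_apply]
  · exact map_add _ _ _

theorem frameDeriv_smul (k : FrameIdx B F) (c : ℝ) {s : B → ModelAlg F} {z : B}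
    (hs : DifferentiableAt ℝ s z) :
    frameDeriv k (fun y => c • s y) z = c • frameDeriv k s z := by
  rcases k with i | a
  · simp only [frameDeriv, Sum.elim_inl, fderiv_fun_const_smul hs, smul_apply]
  · exact map_smul _ _ _

theorem frameDeriv_linearMap_inl (i : Fin (Module.finrank ℝ B)) {s : B → ModelAlg F} {z : B}
    (hs : DifferentiableAt ℝ s z) {G : Type*} [NormedAddCommGroup G] [NormedSpace ℝ G]
    (l : ModelAlg F →ₗ[ℝ] G) :
    fderiv ℝ (fun y => l (s y)) z (Module.finBasis ℝ B i) = l (frameDeriv (.inl i) s z) := by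
  have := ((modelCLM l).hasFDerivAt.comp z hs.hasFDerivAt).fderiv
  have h2 : fderiv ℝ (fun y => l (s y)) z = (modelCLM l).comp (fderiv ℝ s z) := this
  rw [h2]
  rfl

theorem frameDeriv_mem_evenOdd (k : FrameIdx B F) {s : B → ModelAlg F} {t : Set B}
    (ht : IsOpen t) (hs : ContDiffOn ℝ ∞ s t) {q : ZMod 2}
    (h : ∀ z ∈ t, s z ∈ CliffordAlgebra.evenOdd (0 : QuadraticForm ℝ (Module.Dual ℝ F)) q)
    {z : B} (hz : z ∈ t) : frameDeriv k s z ∈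
      CliffordAlgebra.evenOdd (0 : QuadraticForm ℝ (Module.Dual ℝ F)) (idxParity k + q) := by
  rcases k with i | a
  · have hd : DifferentiableAt ℝ s z := (hs.contDiffAt (ht.mem_nhds hz)).differentiableAt (by simp)
    -- Parity is the vanishing of the linear map involution minus sign, so it can be differentiated
    -- along the even coordinates.
    have h1 := frameDeriv_linearMap_inl i hd
      (CliffordAlgebra.involute.toLinearMap - sgn q • LinearMap.id : ModelAlg F →ₗ[ℝ] ModelAlg F)
    have h2 : (fun y => (CliffordAlgebra.involute.toLinearMap - sgn q • LinearMap.id :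
        ModelAlg F →ₗ[ℝ] ModelAlg F) (s y)) =ᶠ[nhds z] fun _ => 0 := by
      filter_upwards [ht.mem_nhds hz] with y hy
      have := mem_evenOdd_iff.1 (h y hy)
      simp [this]
    rw [h2.fderiv_eq] at h1
    simp only [idxParity, Sum.elim_inl, zero_add]
    rw [mem_evenOdd_iff, ← sub_eq_zero]
    simpa using h1.symm
  · exact contract_mem_evenOdd _ (h z hz)

theorem frameDeriv_mul (k : FrameIdx B F) {s t : B → ModelAlg F} {z : B}
    (hs : DifferentiableAt ℝ s z) (ht : DifferentiableAt ℝ t z) {q : ZMod 2}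
    (hq : s z ∈ CliffordAlgebra.evenOdd (0 : QuadraticForm ℝ (Module.Dual ℝ F)) q) :
    frameDeriv k (fun y => s y * t y) z =
      frameDeriv k s z * t z + sgn (idxParity k * q) • (s z * frameDeriv k t z) := by
  rcases k with i | a
  · have h := ((modelMul F).hasFDerivAt_of_bilinear hs.hasFDerivAt ht.hasFDerivAt).fderiv
    have h' : fderiv ℝ (fun y => s y * t y) z =
      (modelMul F).precompR B (s z) (fderiv ℝ t z) +
        (modelMul F).precompL B (fderiv ℝ s z) (t z) := h
    simp only [frameDeriv, Sum.elim_inl, h', idxParity, zero_mul, sgn_zero, one_smul]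
    rw [add_comm]
    rfl
  · simp only [frameDeriv, Sum.elim_inr, idxParity, one_mul, contractBasis]
    rw [contract_mul, mem_evenOdd_iff.1 hq, smul_mul_assoc]

theorem frameDeriv_coordFun (k l : FrameIdx B F) (z : B) :
    frameDeriv k (coordFun l) z = if k = l then 1 else 0 := by
  rcases k with i | a <;> rcases l with j | c
  · let L : B →L[ℝ] ModelAlg F := LinearMap.toContinuousLinearMap
      ((Algebra.linearMap ℝ (ModelAlg F)) ∘ₗ (Module.finBasis ℝ B).coord j)
    have h1 : HasFDerivAt (coordFun (.inl j) : B → ModelAlg F) L z := L.hasFDerivAt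
    simp only [frameDeriv, Sum.elim_inl, h1.fderiv]
    by_cases h : i = j
    · subst h; simp [L]
    · simp [L, h, Finsupp.single_apply]
  · have : (coordFun (.inr c) : B → ModelAlg F) =
      fun _ => ExteriorAlgebra.ι ℝ ((Module.finBasis ℝ F).coord c) := rfl
    simp [frameDeriv, this]
  · simp only [frameDeriv, Sum.elim_inr, coordFun, Sum.elim_inl, contractBasis]
    rw [contract_algebraMap]; simp
  · simp only [frameDeriv, Sum.elim_inr, coordFun, contractBasis]
    rw [contract_ι]
    by_cases h : a = c
    · subst h; simp
    · simp [h, Finsupp.single_apply]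

theorem coordFun_mem_evenOdd (k : FrameIdx B F) (z : B) :
    (coordFun k z : ModelAlg F) ∈
      CliffordAlgebra.evenOdd (0 : QuadraticForm ℝ (Module.Dual ℝ F)) (idxParity k) := by
  rcases k with i | a
  · rw [mem_evenOdd_iff]
    simp [coordFun, idxParity, sgn_zero]
  · exact CliffordAlgebra.ι_mem_evenOdd_one _ _

variable [IsManifold 𝓘(ℝ, B) ∞ M] [ContMDiffVectorBundle ∞ F V 𝓘(ℝ, B)]

theorem differentiableAt_rep {x₀ : M} {W : Opens M} (hW : W ≤ coordDomain B F V x₀)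
    (f : superFun B F V W) {z : B} (hz : z ∈ chartImage x₀ W) :
    DifferentiableAt ℝ (rep x₀ f) z :=
  ((contDiffOn_rep hW f).contDiffAt ((isOpen_chartImage x₀ W).mem_nhds hz)).differentiableAt
    (by simp)

theorem rep_res_eventuallyEq {x₀ : M} {W W' : Opens M} (h : W' ≤ W) (f : superFun B F V W) {z : B}
    (hz : z ∈ chartImage x₀ W') : rep x₀ (res h f) =ᶠ[nhds z] rep x₀ f := by
  filter_upwards [(isOpen_chartImage x₀ W').mem_nhds hz] with y hy
  exact rep_res h f hy

theorem rep_ofRep_eventuallyEq {x₀ : M} {W : Opens M} (hW : W ≤ coordDomain B F V x₀)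
    (s : B → ModelAlg F) (hs : ContDiffOn ℝ ∞ s (chartImage x₀ W)) {z : B}
    (hz : z ∈ chartImage x₀ W) : rep x₀ (ofRep (V := V) x₀ hW s hs) =ᶠ[nhds z] s := by
  filter_upwards [(isOpen_chartImage x₀ W).mem_nhds hz] with y hy
  exact rep_ofRep hW s hs hy

/-- The coordinate derivations as operators on superfunctions. -/
def frameOp (x₀ : M) (k : FrameIdx B F) : LocalOps B F V (coordDomain B F V x₀) := fun W =>
  { toFun := fun f => ofRep x₀ W.2 (frameDeriv k (rep x₀ f))
      (contDiffOn_frameDeriv k (isOpen_chartImage x₀ W.1) (contDiffOn_rep W.2 f))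
    map_add' := fun f g => rep_ext W.2 fun z hz => by
      rw [rep_add, rep_ofRep _ _ _ hz, rep_ofRep _ _ _ hz, rep_ofRep _ _ _ hz,
        ← frameDeriv_add k (differentiableAt_rep W.2 f hz) (differentiableAt_rep W.2 g hz)]
      simp only [← rep_add]
    map_smul' := fun c f => rep_ext W.2 fun z hz => by
      rw [RingHom.id_apply, rep_smul, rep_ofRep _ _ _ hz, rep_ofRep _ _ _ hz,
        ← frameDeriv_smul k c (differentiableAt_rep W.2 f hz)]
      simp only [← rep_smul] }

theorem rep_frameOp {x₀ : M} (k : FrameIdx B F) {W : Opens M} (hW : W ≤ coordDomain B F V x₀)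
    (f : superFun B F V W) {z : B} (hz : z ∈ chartImage x₀ W) :
    rep x₀ (frameOp x₀ k ⟨W, hW⟩ f) z = frameDeriv k (rep x₀ f) z :=
  rep_ofRep hW _ (contDiffOn_frameDeriv k (isOpen_chartImage x₀ W) (contDiffOn_rep hW f)) hz

theorem frameOp_mem (x₀ : M) (k : FrameIdx B F) :
    frameOp x₀ k ∈ derOfParity B F V (coordDomain B F V x₀) (idxParity k) := by
  refine ⟨fun W W' h h' f => ?_, fun W h q f hf => ?_, fun W h q f g hf => ?_⟩
  · refine rep_ext (h'.trans h) fun z hz => ?_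
    rw [rep_res _ _ hz, rep_frameOp k h _ (chartImage_mono h' hz), rep_frameOp k _ _ hz]
    exact (frameDeriv_congr (rep_res_eventuallyEq h' f hz)).symm
  · refine (hasParity_iff_rep h).2 fun z hz => ?_
    rw [rep_frameOp k h _ hz]
    exact frameDeriv_mem_evenOdd k (isOpen_chartImage x₀ W) (contDiffOn_rep h f)
      ((hasParity_iff_rep h).1 hf) hz
  · refine rep_ext h fun z hz => ?_
    rw [rep_frameOp k h _ hz, rep_add, rep_mul, rep_smul, rep_mul, rep_frameOp k h _ hz,
      rep_frameOp k h _ hz, ← frameDeriv_mul k (differentiableAt_rep h f hz)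
        (differentiableAt_rep h g hz) ((hasParity_iff_rep h).1 hf z hz)]
    simp only [← rep_mul]

theorem derOfParity_le (U : Opens M) (p : ZMod 2) :
    derOfParity B F V U p ≤ superDerSubmodule B F V U := by
  have h2 : ∀ r : ZMod 2, r = 0 ∨ r = 1 := by decide
  rcases h2 p with rfl | rfl
  · exact le_sup_left
  · exact le_sup_right

/-- The coordinate superderivations over `U`. -/
def frame (x₀ : M) {U : Opens M} (hU : U ≤ coordDomain B F V x₀) (k : FrameIdx B F) :
    superDer B F V U :=
  resDer hU ⟨frameOp x₀ k, derOfParity_le _ _ (frameOp_mem x₀ k)⟩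

theorem frame_parity {x₀ : M} {U : Opens M} (hU : U ≤ coordDomain B F V x₀) (k : FrameIdx B F) :
    DerHasParity (idxParity k) (frame (V := V) x₀ hU k) :=
  restrict_mem hU (frameOp_mem x₀ k)

theorem rep_frame {x₀ : M} {U : Opens M} (hU : U ≤ coordDomain B F V x₀) (k : FrameIdx B F)
    {W : Opens M} (hW : W ≤ U) (f : superFun B F V W) {z : B} (hz : z ∈ chartImage x₀ W) :
    rep x₀ ((frame x₀ hU k).1 ⟨W, hW⟩ f) z = frameDeriv k (rep x₀ f) z :=
  rep_frameOp k (hW.trans hU) f hz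

theorem resDer_frame {x₀ : M} {U W : Opens M} (hU : U ≤ coordDomain B F V x₀) (h : W ≤ U)
    (k : FrameIdx B F) : resDer h (frame (V := V) x₀ hU k) = frame x₀ (h.trans hU) k := rfl

/-- The coordinates as superfunctions. -/
def coordSF (x₀ : M) {U : Opens M} (hU : U ≤ coordDomain B F V x₀) (k : FrameIdx B F) :
    superFun B F V U :=
  ofRep x₀ hU (coordFun k) (contDiff_coordFun k).contDiffOn

theorem res_coordSF {x₀ : M} {U W : Opens M} (hU : U ≤ coordDomain B F V x₀) (h : W ≤ U)
    (k : FrameIdx B F) : res h (coordSF (V := V) x₀ hU k) = coordSF x₀ (h.trans hU) k := rfl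

theorem rep_coordSF {x₀ : M} {U : Opens M} (hU : U ≤ coordDomain B F V x₀) (k : FrameIdx B F)
    {z : B} (hz : z ∈ chartImage x₀ U) : rep x₀ (coordSF (V := V) x₀ hU k) z = coordFun k z :=
  rep_ofRep _ _ _ hz

theorem rep_coordSF_eventuallyEq {x₀ : M} {U : Opens M} (hU : U ≤ coordDomain B F V x₀)
    (k : FrameIdx B F) {z : B} (hz : z ∈ chartImage x₀ U) :
    rep x₀ (coordSF (V := V) x₀ hU k) =ᶠ[nhds z] coordFun k :=
  rep_ofRep_eventuallyEq _ _ _ hz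

theorem coordSF_parity {x₀ : M} {U : Opens M} (hU : U ≤ coordDomain B F V x₀)
    (k : FrameIdx B F) : HasParity (idxParity k) (coordSF (V := V) x₀ hU k) :=
  (hasParity_iff_rep hU).2 fun z hz => by
    rw [rep_coordSF hU k hz]; exact coordFun_mem_evenOdd k z

theorem frame_coordSF {x₀ : M} {U : Opens M} (hU : U ≤ coordDomain B F V x₀)
    (k l : FrameIdx B F) {W : Opens M} (hW : W ≤ U) :
    (frame x₀ hU k).1 ⟨W, hW⟩ (coordSF (V := V) x₀ (hW.trans hU) l) = if k = l then 1 else 0 := by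
  refine rep_ext (hW.trans hU) fun z hz => ?_
  rw [rep_frame hU k hW _ hz, frameDeriv_congr (rep_coordSF_eventuallyEq _ _ hz),
    frameDeriv_coordFun]
  split_ifs
  · exact (rep_one hz).symm
  · exact (map_zero (repLin x₀ W z)).symm

/-- The constant superfunction with value `a ∈ Λ F^*` in the coordinates at `x₀`. -/
def constSF (x₀ : M) {U : Opens M} (hU : U ≤ coordDomain B F V x₀) (a : ModelAlg F) :
    superFun B F V U := ofRep x₀ hU (fun _ => a) contDiffOn_const

theorem rep_constSF {x₀ : M} {U : Opens M} (hU : U ≤ coordDomain B F V x₀) (a : ModelAlg F)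
    {z : B} (hz : z ∈ chartImage x₀ U) : rep x₀ (constSF (V := V) x₀ hU a) z = a :=
  rep_ofRep _ _ _ hz

theorem der_algebraMap {U : Opens M} {p : ZMod 2} {X : LocalOps B F V U}
    (hX : X ∈ derOfParity B F V U p) {W : Opens M} (hW : W ≤ U) (r : ℝ) :
    X ⟨W, hW⟩ (algebraMap ℝ (superFun B F V W) r) = 0 := by
  have h1 : HasParity 0 (1 : superFun B F V W) := fun x => SetLike.one_mem_graded _
  have h := hX.2.2 W hW 0 1 1 h1
  rw [mul_one, mul_one, one_mul, mul_zero, sgn_zero, one_smul] at h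
  have h0 : X ⟨W, hW⟩ 1 = 0 := by simpa using h
  rw [Algebra.algebraMap_eq_smul_one, map_smul, h0, smul_zero]

/-- The constants Λ F^* are generated by the odd coordinates, on which both sides agree, and both
sides obey the same graded Leibniz rule for left multiplication by a generator. -/
theorem rep_der_const {x₀ : M} {U : Opens M} (hU : U ≤ coordDomain B F V x₀) {p : ZMod 2}
    {X : LocalOps B F V U} (hX : X ∈ derOfParity B F V U p) {W : Opens M} (hW : W ≤ U)
    (a : ModelAlg F) {z : B} (hz : z ∈ chartImage x₀ W) :
    rep x₀ (X ⟨W, hW⟩ (constSF x₀ (hW.trans hU) a)) z =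
      ∑ c, rep x₀ (X ⟨W, hW⟩ (coordSF x₀ (hW.trans hU) (.inr c))) z * contractBasis c a := by
  have hWd := hW.trans hU
  -- A linear form is a real combination of the odd coordinates, and X is ℝ-linear.
  have hι : ∀ m : Module.Dual ℝ F,
      X ⟨W, hW⟩ (constSF x₀ hWd (ExteriorAlgebra.ι ℝ m)) =
        ∑ c, m (Module.finBasis ℝ F c) • X ⟨W, hW⟩ (coordSF x₀ hWd (.inr c)) := fun m => by
    simp only [← map_smul, ← map_sum]
    congr 1
    refine rep_ext hWd fun y hy => ?_
    rw [rep_constSF hWd _ hy, rep_sum]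
    have : ∀ c, rep x₀ (m (Module.finBasis ℝ F c) • coordSF (V := V) x₀ hWd (.inr c)) y =
        ExteriorAlgebra.ι ℝ (m (Module.finBasis ℝ F c) • (Module.finBasis ℝ F).coord c) := by
      intro c
      rw [rep_smul, rep_coordSF _ _ hy, map_smul]
      rfl
    simp only [this, ← map_sum]
    congr 1
    ext v
    conv_lhs => rw [← (Module.finBasis ℝ F).sum_repr v]
    simp
  refine CliffordAlgebra.left_induction (Q := (0 : QuadraticForm ℝ (Module.Dual ℝ F)))
    (P := fun a => rep x₀ (X ⟨W, hW⟩ (constSF x₀ hWd a)) z =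
      ∑ c, rep x₀ (X ⟨W, hW⟩ (coordSF x₀ hWd (.inr c))) z * contractBasis c a) ?_ ?_ ?_ a
  · intro r
    have h1 : constSF (V := V) x₀ hWd (algebraMap ℝ _ r) = algebraMap ℝ (superFun B F V W) r :=
      rep_ext hWd fun y hy => by rw [rep_constSF _ _ hy, rep_algebraMap _ hy]
    have h2 : ∀ c : Fin (Module.finrank ℝ F),
        contractBasis c (algebraMap ℝ (ModelAlg F) r) = 0 := fun c => contract_algebraMap _ _
    rw [show algebraMap ℝ (CliffordAlgebra (0 : QuadraticForm ℝ (Module.Dual ℝ F))) r =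
      algebraMap ℝ (ModelAlg F) r from rfl]
    simp only [h2, mul_zero, Finset.sum_const_zero]
    rw [h1, der_algebraMap hX]
    exact map_zero (repLin x₀ W z)
  · intro a b ha hb
    have h1 : constSF (V := V) x₀ hWd (a + b) = constSF x₀ hWd a + constSF x₀ hWd b :=
      rep_ext hWd fun y hy => by
        rw [rep_add, rep_constSF _ _ hy, rep_constSF _ _ hy, rep_constSF _ _ hy]
    rw [h1, map_add, rep_add, ha, hb, ← Finset.sum_add_distrib]
    refine Finset.sum_congr rfl fun c _ => ?_
    rw [map_add, mul_add]
  · intro a m ha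
    have h1 : constSF (V := V) x₀ hWd (ExteriorAlgebra.ι ℝ m * a) =
        constSF x₀ hWd (ExteriorAlgebra.ι ℝ m) * constSF x₀ hWd a :=
      rep_ext hWd fun y hy => by
        rw [rep_mul, rep_constSF _ _ hy, rep_constSF _ _ hy, rep_constSF _ _ hy]
    have hpar : HasParity 1 (constSF (V := V) x₀ hWd (ExteriorAlgebra.ι ℝ m)) :=
      (hasParity_iff_rep hWd).2 fun y hy => by
        rw [rep_constSF _ _ hy]; exact CliffordAlgebra.ι_mem_evenOdd_one _ _
    change rep x₀ (X ⟨W, hW⟩ (constSF x₀ hWd (ExteriorAlgebra.ι ℝ m * a))) z =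
      ∑ c, _ * contractBasis c (ExteriorAlgebra.ι ℝ m * a)
    rw [h1, hX.2.2 W hW 1 _ _ hpar, rep_add, rep_mul, rep_smul, rep_mul, ha, rep_constSF _ _ hz,
      rep_constSF _ _ hz, hι m, rep_sum, Finset.sum_mul, Finset.mul_sum, Finset.smul_sum,
      ← Finset.sum_add_distrib]
    refine Finset.sum_congr rfl fun c _ => ?_
    have h3 := hX.2.1 W hW 1 _ (coordSF_parity (V := V) hWd (.inr c))
    -- Moving X(θ_c), of parity p + 1, past a generator costs the sign -(-1)^p. This matches the
    -- Leibniz sign (-1)^p against the minus sign in the contraction rule `h5`.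
    have h4 := graded_comm ((hasParity_iff_rep hWd).1 h3 z hz)
      (CliffordAlgebra.ι_mem_evenOdd_one (0 : QuadraticForm ℝ (Module.Dual ℝ F)) m)
    have h5 : contractBasis c (ExteriorAlgebra.ι ℝ m * a) =
        m (Module.finBasis ℝ F c) • a - ExteriorAlgebra.ι ℝ m * contractBasis c a :=
      CliffordAlgebra.contractLeft_ι_mul _ _ _
    rw [rep_smul, h5, mul_sub, ← mul_assoc (rep _ _ _)]
    change _ = _ - _ * CliffordAlgebra.ι (0 : QuadraticForm ℝ (Module.Dual ℝ F)) m *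
      contractBasis c a
    rw [h4, mul_one, mul_one, sgn_add, sgn_one, smul_mul_assoc, smul_mul_assoc, mul_smul_comm,
      mul_assoc]
    simp only [mul_neg, mul_one, neg_smul, sub_neg_eq_add]

/-- The open set of points whose coordinates lie in a given open set. -/
def chartPreimage (x₀ : M) (t : Set B) (ht : IsOpen t) : Opens M :=
  ⟨(chartAt B x₀).source ∩ chartAt B x₀ ⁻¹' t, (chartAt B x₀).isOpen_inter_preimage ht⟩

/-- The value of a superderivation in terms of its values on the coordinates. -/
theorem rep_der {x₀ : M} {U : Opens M} (hU : U ≤ coordDomain B F V x₀) {p : ZMod 2}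
    {X : LocalOps B F V U} (hX : X ∈ derOfParity B F V U p) {W : Opens M} (hW : W ≤ U)
    (f : superFun B F V W) {z : B} (hz : z ∈ chartImage x₀ W) :
    rep x₀ (X ⟨W, hW⟩ f) z =
      ∑ k, rep x₀ (X ⟨W, hW⟩ (coordSF x₀ (hW.trans hU) k)) z * frameDeriv k (rep x₀ f) z := by
  have hWd := hW.trans hU
  -- Near z the function is f(z) + Σ (x_i - z_i) h_i. After applying X and evaluating at z, the
  -- factors x_i - z_i vanish and only X(x_i) h_i(z) remains, together with X of the constant
  -- element f(z) of Λ F^*.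
  obtain ⟨t, hts, hto, hzt, h, hh, hfh⟩ := exists_hadamard (isOpen_chartImage x₀ W)
    (contDiffOn_rep hWd f) hz
  -- The factorization is only local. As X commutes with restriction, its value at z can be computed
  -- on this smaller set.
  let W' : Opens M := W ⊓ chartPreimage x₀ t hto
  have hW' : W' ≤ W := inf_le_left
  have hW'd := hW'.trans hWd
  have hzW' : z ∈ chartImage x₀ W' := ⟨hz.1, hz.2, (chartAt B x₀).map_target hz.1, by
    rw [Set.mem_preimage, (chartAt B x₀).right_inv hz.1]; exact hzt⟩
  have ht' : ∀ y ∈ chartImage x₀ W', y ∈ t := fun y hy => by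
    have := hy.2.2.2
    rwa [Set.mem_preimage, (chartAt B x₀).right_inv hy.1] at this
  let β := Module.finBasis ℝ B
  let hc : Fin (Module.finrank ℝ B) → superFun B F V W' := fun i =>
    ofRep x₀ hW'd (fun y => h y (β i)) (hh.clm_apply contDiff_const).contDiffOn
  let xc : Fin (Module.finrank ℝ B) → superFun B F V W' := fun i =>
    coordSF x₀ hW'd (.inl i) - algebraMap ℝ _ (β.coord i z)
  have hxc : ∀ i, ∀ y ∈ chartImage x₀ W',
      rep x₀ (xc i) y = algebraMap ℝ _ (β.coord i (y - z)) := fun i y hy => by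
    have : rep x₀ (xc i) y = rep x₀ (coordSF (V := V) x₀ hW'd (.inl i)) y -
      rep x₀ (algebraMap ℝ (superFun B F V W') (β.coord i z)) y := map_sub (repLin x₀ W' y) _ _
    rw [this, rep_coordSF _ _ hy, rep_algebraMap _ hy, map_sub, map_sub]
    rfl
  have hdec : res hW' f = constSF x₀ hW'd (rep x₀ f z) + ∑ i, xc i * hc i := by
    refine rep_ext hW'd fun y hy => ?_
    rw [rep_add, rep_res _ _ hy, rep_constSF _ _ hy, rep_sum, hfh y (ht' y hy)]
    congr 1
    conv_lhs => rw [← β.sum_repr (y - z), map_sum]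
    refine Finset.sum_congr rfl fun i _ => ?_
    rw [rep_mul, hxc i y hy, rep_ofRep _ _ _ hy, map_smul, Algebra.smul_def]
    rfl
  have hpar : ∀ i, HasParity 0 (xc i) := fun i => (hasParity_iff_rep hW'd).2 fun y hy => by
    rw [hxc i y hy, mem_evenOdd_iff]
    simp [sgn_zero]
  -- The factor y - z vanishes at z, so the derivative of h does not contribute.
  have hfd : fderiv ℝ (rep x₀ f) z = h z := by
    have h1 : HasFDerivAt (fun y => rep x₀ f z + h y (y - z)) (h z) z := by
      have h2 := ((hh.differentiable (by simp)) z).hasFDerivAt.clm_apply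
        ((hasFDerivAt_id z).sub_const z)
      have h3 := h2.const_add (rep x₀ f z)
      convert! h3 using 1
      ext v
      simp
    have h4 : rep x₀ f =ᶠ[nhds z] fun y => rep x₀ f z + h y (y - z) := by
      filter_upwards [hto.mem_nhds hzt] with y hy using hfh y hy
    rw [h4.fderiv_eq, h1.fderiv]
  have hXx : ∀ i, X ⟨W', hW'.trans hW⟩ (xc i) = X ⟨W', hW'.trans hW⟩ (coordSF x₀ hW'd (.inl i)) :=
    fun i => by rw [map_sub, der_algebraMap hX, sub_zero]
  have hloc : ∀ k, rep x₀ (X ⟨W', hW'.trans hW⟩ (coordSF x₀ hW'd k)) z =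
      rep x₀ (X ⟨W, hW⟩ (coordSF x₀ hWd k)) z := fun k => by
    rw [← res_coordSF hWd hW', ← hX.1, rep_res _ _ hzW']
  rw [← rep_res hW' _ hzW', hX.1, hdec, map_add, rep_add, map_sum, rep_sum,
    rep_der_const hU hX _ _ hzW', Fintype.sum_sum_type, add_comm]
  congr 1
  · refine Finset.sum_congr rfl fun i _ => ?_
    rw [hX.2.2 W' _ 0 _ _ (hpar i), rep_add, rep_mul, rep_smul, rep_mul, hxc i z hzW', hXx, hloc,
      rep_ofRep _ _ _ hzW']
    simp [frameDeriv, hfd, β]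
  · refine Finset.sum_congr rfl fun c _ => ?_
    rw [hloc]
    rfl

/-- Evaluation of superderivations. -/
def evalDer {U W : Opens M} (hW : W ≤ U) (f : superFun B F V W) :
    superDer B F V U →ₗ[ℝ] superFun B F V W where
  toFun X := X.1 ⟨W, hW⟩ f
  map_add' _ _ := rfl
  map_smul' _ _ := rfl

theorem rep_superDer {x₀ : M} {U : Opens M} (hU : U ≤ coordDomain B F V x₀)
    (X : superDer B F V U) {W : Opens M} (hW : W ≤ U)
    (f : superFun B F V W) {z : B} (hz : z ∈ chartImage x₀ W) :
    rep x₀ (X.1 ⟨W, hW⟩ f) z =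
      ∑ k, rep x₀ (X.1 ⟨W, hW⟩ (coordSF x₀ (hW.trans hU) k)) z * frameDeriv k (rep x₀ f) z := by
  obtain ⟨X₀, hX₀, X₁, hX₁, hX⟩ := Submodule.mem_sup.1 X.2
  rw [← hX]
  simp only [Pi.add_apply, LinearMap.add_apply, rep_add, add_mul, Finset.sum_add_distrib]
  rw [rep_der hU hX₀ hW f hz, rep_der hU hX₁ hW f hz]

theorem superDer_res {U : Opens M} (X : superDer B F V U) {W W' : Opens M} (hW : W ≤ U)
    (h : W' ≤ W) (f : superFun B F V W) :
    res h (X.1 ⟨W, hW⟩ f) = X.1 ⟨W', h.trans hW⟩ (res h f) := by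
  obtain ⟨X₀, hX₀, X₁, hX₁, hX⟩ := Submodule.mem_sup.1 X.2
  rw [← hX]
  simp only [Pi.add_apply, LinearMap.add_apply, map_add]
  rw [hX₀.1, hX₁.1]

/-- By `rep_superDer` the values on the coordinates are the coefficients of the superderivation,
also after restriction to smaller open sets. -/
theorem superDer_ext {x₀ : M} {U : Opens M} (hU : U ≤ coordDomain B F V x₀)
    {X Y : superDer B F V U}
    (h : ∀ k, X.app (coordSF x₀ hU k) = Y.app (coordSF x₀ hU k)) : X = Y := by
  apply Subtype.ext
  funext ⟨W, hW⟩
  ext f : 1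
  refine rep_ext (hW.trans hU) fun z hz => ?_
  rw [rep_superDer hU X hW f hz, rep_superDer hU Y hW f hz]
  refine Finset.sum_congr rfl fun k _ => ?_
  rw [← res_coordSF hU hW, ← superDer_res X le_rfl hW, ← superDer_res Y le_rfl hW]
  have := h k
  simp only [superDer.app] at this
  rw [this]

/-- The expansion of a superderivation in the coordinate frame. -/
theorem superDer_eq_sum {x₀ : M} {U : Opens M} (hU : U ≤ coordDomain B F V x₀)
    (X : superDer B F V U) : X = ∑ k, X.app (coordSF x₀ hU k) • frame x₀ hU k := by
  refine superDer_ext hU fun l => ?_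
  have h1 : ∀ Y : superDer B F V U, Y.app (coordSF x₀ hU l) =
    evalDer le_rfl (coordSF x₀ hU l) Y := fun _ => rfl
  rw [h1 (∑ k, _), map_sum]
  have h2 : ∀ k, evalDer le_rfl (coordSF x₀ hU l) (X.app (coordSF x₀ hU k) • frame x₀ hU k) =
      X.app (coordSF x₀ hU k) * (if k = l then 1 else 0) := fun k => by
    rw [← frame_coordSF hU k l le_rfl]
    rfl
  simp [h2]

end Frames

/-- Points of one fibre are separated inside a trivialization, points of different fibres over the
base. The Hausdorff property is what allows vector fields on the total space to be extended by bump
functions. -/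
theorem t2Space_totalSpace {X : Type*} [TopologicalSpace X] [T2Space X] (G : Type*)
    [TopologicalSpace G] [T2Space G] (Z : X → Type*) [∀ x, TopologicalSpace (Z x)]
    [TopologicalSpace (TotalSpace G Z)] [FiberBundle G Z] : T2Space (TotalSpace G Z) := by
  refine ⟨fun p q hpq => ?_⟩
  by_cases h : p.proj = q.proj
  · let e := trivializationAt G Z p.proj
    have hp : p ∈ e.source := FiberBundle.mem_trivializationAt_proj_source
    have hq : q ∈ e.source := by
      rw [Trivialization.mem_source, ← h]; exact FiberBundle.mem_baseSet_trivializationAt' _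
    have hne : e p ≠ e q := fun h' => hpq (e.toOpenPartialHomeomorph.injOn hp hq h')
    obtain ⟨u, v, hu, hv, hpu, hqv, huv⟩ := t2_separation hne
    refine ⟨e.source ∩ e ⁻¹' u, e.source ∩ e ⁻¹' v,
      e.toOpenPartialHomeomorph.isOpen_inter_preimage hu,
      e.toOpenPartialHomeomorph.isOpen_inter_preimage hv, ⟨hp, hpu⟩, ⟨hq, hqv⟩, ?_⟩
    exact Set.disjoint_left.2 fun r hr hr' => Set.disjoint_left.1 huv hr.2 hr'.2
  · obtain ⟨u, v, hu, hv, hpu, hqv, huv⟩ := t2_separation h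
    have hc : Continuous (TotalSpace.proj : TotalSpace G Z → X) := FiberBundle.continuous_proj G Z
    exact ⟨_, _, hu.preimage hc, hv.preimage hc, hpu, hqv, huv.preimage _⟩

/-! ### Functions and vector fields in a chart of a manifold -/

section ChartCalculus

variable {N : Type*} [NormedAddCommGroup N] [NormedSpace ℝ N] 
  {H : Type*} [TopologicalSpace H] (I : ModelWithCorners ℝ N H) 
  {E : Type*} [TopologicalSpace E] [ChartedSpace H E] [IsManifold I ∞ E]

/-- The derivative of the chart at `p`. -/
abbrev dchart (p e : E) : TangentSpace I e →L[ℝ] N :=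
  (trivializationAt N (TangentSpace I) p).continuousLinearMapAt ℝ e

/-- The inverse of the derivative of the chart at `p`. -/
abbrev dchartSymm (p e : E) : N →L[ℝ] TangentSpace I e :=
  (trivializationAt N (TangentSpace I) p).symmL ℝ e

variable {I}

theorem dchart_symm {p e : E} (he : e ∈ (extChartAt I p).source) (v : N) :
    dchart I p e (dchartSymm I p e v) = v := by
  refine Trivialization.continuousLinearMapAt_symmL _ ?_ v
  rw [TangentBundle.trivializationAt_baseSet, ← extChartAt_source I]
  exact he

theorem dchartSymm_apply {p e : E} (he : e ∈ (extChartAt I p).source) (v : TangentSpace I e) :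
    dchartSymm I p e (dchart I p e v) = v := by
  refine Trivialization.symmL_continuousLinearMapAt _ ?_ v
  rw [TangentBundle.trivializationAt_baseSet, ← extChartAt_source I]
  exact he

theorem dchart_injective {p e : E} (he : e ∈ (extChartAt I p).source) :
    Function.Injective (dchart I p e) := fun v w h => by
  rw [← dchartSymm_apply he v, h, dchartSymm_apply he]

/-- A function in the chart at `p`. -/
theorem mvfderiv_eq_fderiv [I.Boundaryless]
    {f : E → ℝ} {p e : E} (he : e ∈ (extChartAt I p).source) {fh : N → ℝ}
    (hf : DifferentiableAt ℝ fh (extChartAt I p e))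
    (h : f =ᶠ[nhds e] fun e => fh (extChartAt I p e)) (v : TangentSpace I e) :
    mvfderiv I f e v = fderiv ℝ fh (extChartAt I p e) (dchart I p e v) := by
  have he' : e ∈ (chartAt H p).source := by rwa [← extChartAt_source I]
  have h1 : mfderiv I 𝓘(ℝ, ℝ) f e = mfderiv I 𝓘(ℝ, ℝ) (fh ∘ extChartAt I p) e :=
    h.mfderiv_eq
  have h2 := mvfderiv_comp_apply (I := 𝓘(ℝ, N)) (I' := I) (g := fh) (f := extChartAt I p) e
    hf.mdifferentiableAt (mdifferentiableAt_extChartAt he') v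
  have h3 : mvfderiv I f e v = mvfderiv I (fh ∘ extChartAt I p) e v := by
    simp only [mvfderiv, ContinuousLinearMap.comp_apply, h1]
    rfl
  rw [h3, h2, dchart, TangentBundle.continuousLinearMapAt_trivializationAt he', mvfderiv,
    mfderiv_eq_fderiv]
  rfl

theorem eventually_mem_source {p e : E} (he : e ∈ (extChartAt I p).source) :
    ∀ᶠ e' in nhds e, e' ∈ (extChartAt I p).source := extChartAt_source_mem_nhds' he

theorem differentiableAt_chart_comp [I.Boundaryless] {G : Type*} [NormedAddCommGroup G]
    [NormedSpace ℝ G] {f : E → G} {p e : E} (he : e ∈ (extChartAt I p).source)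
    (hf : MDifferentiableAt I 𝓘(ℝ, G) f e) :
    DifferentiableAt ℝ (fun z => f ((extChartAt I p).symm z)) (extChartAt I p e) := by
  have hz := (extChartAt I p).map_source he
  have h1 := mdifferentiableWithinAt_extChartAt_symm (I := I) hz
  rw [I.range_eq_univ, mdifferentiableWithinAt_univ] at h1
  have h2 := MDifferentiableAt.comp (I := 𝓘(ℝ, N)) (I' := I) (I'' := 𝓘(ℝ, G)) (g := f)
    (extChartAt I p e) (by rwa [(extChartAt I p).left_inv he]) h1
  exact h2.differentiableAt

theorem contDiffAt_chart_comp [I.Boundaryless] {G : Type*} [NormedAddCommGroup G]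
    [NormedSpace ℝ G] {f : E → G} {p e : E} (he : e ∈ (extChartAt I p).source)
    (hf : ContMDiffAt I 𝓘(ℝ, G) ∞ f e) :
    ContDiffAt ℝ ∞ (fun z => f ((extChartAt I p).symm z)) (extChartAt I p e) := by
  have hz := (extChartAt I p).map_source he
  have h1 : ContMDiffAt 𝓘(ℝ, N) I ∞ (extChartAt I p).symm (extChartAt I p e) :=
    (contMDiffOn_extChartAt_symm p).contMDiffAt
      ((isOpen_extChartAt_target p).mem_nhds hz)
  have h2 := ContMDiffAt.comp (I := 𝓘(ℝ, N)) (I' := I) (I'' := 𝓘(ℝ, G)) (g := f)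
    (extChartAt I p e) (by rwa [(extChartAt I p).left_inv he]) h1
  exact contMDiffAt_iff_contDiffAt.1 h2

theorem contMDiffAt_comp_chart {G : Type*} [NormedAddCommGroup G]
    [NormedSpace ℝ G] {fh : N → G} {p e : E} (he : e ∈ (extChartAt I p).source)
    (hf : ContDiffAt ℝ ∞ fh (extChartAt I p e)) :
    ContMDiffAt I 𝓘(ℝ, G) ∞ (fun e => fh (extChartAt I p e)) e := by
  have he' : e ∈ (chartAt H p).source := by rwa [← extChartAt_source I]
  exact hf.contMDiffAt.comp e (contMDiffAt_extChartAt' he')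

/-- The coordinate representation of a vector field in the chart at `p`. -/
def vrep (p : E) (Y : ∀ e : E, TangentSpace I e) (z : N) : N :=
  dchart I p ((extChartAt I p).symm z) (Y ((extChartAt I p).symm z))

theorem vrep_chart {p e : E} (he : e ∈ (extChartAt I p).source) (Y : ∀ e : E, TangentSpace I e) :
    vrep p Y (extChartAt I p e) = dchart I p e (Y e) := by
  have key : ∀ e' : E, e' = e → dchart I p e' (Y e') = dchart I p e (Y e) := by
    rintro e' rfl; rfl
  exact key _ ((extChartAt I p).left_inv he)

/-- Smoothness of a vector field. -/
abbrev SmoothFieldAt (Y : ∀ e : E, TangentSpace I e) (e : E) : Prop :=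
  ContMDiffAt I (I.prod 𝓘(ℝ, N)) ∞ (fun e => (⟨e, Y e⟩ : TotalSpace N (TangentSpace I : E → Type _))) e

/-- Differentiability of a vector field. -/
abbrev DiffFieldAt (Y : ∀ e : E, TangentSpace I e) (e : E) : Prop :=
  MDifferentiableAt I (I.prod 𝓘(ℝ, N))
    (fun e => (⟨e, Y e⟩ : TotalSpace N (TangentSpace I : E → Type _))) e

theorem triv_apply {p e : E} (he : e ∈ (extChartAt I p).source) (v : TangentSpace I e) :
    (trivializationAt N (TangentSpace I) p ⟨e, v⟩).2 = dchart I p e v := by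
  rw [dchart, Trivialization.continuousLinearMapAt_apply,
    Trivialization.coe_linearMapAt_of_mem]
  rw [TangentBundle.trivializationAt_baseSet, ← extChartAt_source I]
  exact he

theorem mem_tangent_baseSet {p e : E} (he : e ∈ (extChartAt I p).source) :
    e ∈ (trivializationAt N (TangentSpace I : E → Type _) p).baseSet := by
  rw [TangentBundle.trivializationAt_baseSet, ← extChartAt_source I]
  exact he

theorem differentiableAt_vrep [I.Boundaryless] {Y : ∀ e : E, TangentSpace I e} {p e : E}
    (he : e ∈ (extChartAt I p).source) (hY : DiffFieldAt Y e) :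
    DifferentiableAt ℝ (vrep p Y) (extChartAt I p e) := by
  have h1 := ((trivializationAt N (TangentSpace I) p).mdifferentiableAt_section_iff I Y
    (mem_tangent_baseSet he)).1 hY
  have h2 : MDifferentiableAt I 𝓘(ℝ, N) (fun e => dchart I p e (Y e)) e := by
    refine h1.congr_of_eventuallyEq ?_
    filter_upwards [eventually_mem_source he] with e' he'
    rw [triv_apply he']
  exact differentiableAt_chart_comp he h2

theorem contDiffAt_vrep [I.Boundaryless] {Y : ∀ e : E, TangentSpace I e} {p e : E}
    (he : e ∈ (extChartAt I p).source) (hY : SmoothFieldAt Y e) :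
    ContDiffAt ℝ ∞ (vrep p Y) (extChartAt I p e) := by
  have h1 := ((trivializationAt N (TangentSpace I) p).contMDiffAt_section_iff (s := Y)
    (mem_tangent_baseSet he)).1 hY
  have h2 : ContMDiffAt I 𝓘(ℝ, N) ∞ (fun e => dchart I p e (Y e)) e := by
    refine h1.congr_of_eventuallyEq ?_
    filter_upwards [eventually_mem_source he] with e' he'
    rw [triv_apply he']
  exact contDiffAt_chart_comp he h2

/-- A vector field is smooth if its coordinate representation is. -/
theorem smoothFieldAt_of_eventuallyEq {Y : ∀ e : E, TangentSpace I e} {p e : E}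
    (he : e ∈ (extChartAt I p).source) {Yh : N → N} (hYh : ContDiffAt ℝ ∞ Yh (extChartAt I p e))
    (h : ∀ᶠ e' in nhds e, dchart I p e' (Y e') = Yh (extChartAt I p e')) : SmoothFieldAt Y e := by
  refine ((trivializationAt N (TangentSpace I) p).contMDiffAt_section_iff (s := Y)
    (mem_tangent_baseSet he)).2 ?_
  refine (contMDiffAt_comp_chart he hYh).congr_of_eventuallyEq ?_
  filter_upwards [eventually_mem_source he, h] with e' he' h'
  rw [triv_apply he', h']

theorem vrep_eventuallyEq {Y : ∀ e : E, TangentSpace I e} {p e : E} [I.Boundaryless]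
    (he : e ∈ (extChartAt I p).source) {Yh : N → N}
    (h : ∀ᶠ e' in nhds e, dchart I p e' (Y e') = Yh (extChartAt I p e')) :
    vrep p Y =ᶠ[nhds (extChartAt I p e)] Yh := by
  have hz := (extChartAt I p).map_source he
  have hc := continuousAt_extChartAt_symm' (I := I) he
  rw [ContinuousAt, (extChartAt I p).left_inv he] at hc
  filter_upwards [hc.eventually h, (isOpen_extChartAt_target p).mem_nhds hz] with z h1 hz'
  rw [(extChartAt I p).right_inv hz'] at h1
  exact h1

/-! ### Connections given by Christoffel tensors -/

section Connections

/-- The connection with Christoffel tensor `Γ` in the chart at `p`. -/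
def chartConn (p : E) (Γ : N → N →L[ℝ] N →L[ℝ] N) (Y : ∀ e : E, TangentSpace I e) (e : E) :
    TangentSpace I e →L[ℝ] TangentSpace I e :=
  dchartSymm I p e ∘L (fderiv ℝ (vrep p Y) (extChartAt I p e) +
    (Γ (extChartAt I p e)).flip (dchart I p e (Y e))) ∘L dchart I p e

theorem dchart_chartConn {p e : E} (he : e ∈ (extChartAt I p).source)
    (Γ : N → N →L[ℝ] N →L[ℝ] N) (Y : ∀ e : E, TangentSpace I e) (v : TangentSpace I e) :
    dchart I p e (chartConn p Γ Y e v) = fderiv ℝ (vrep p Y) (extChartAt I p e) (dchart I p e v) +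
      Γ (extChartAt I p e) (dchart I p e v) (dchart I p e (Y e)) := by
  rw [chartConn, ContinuousLinearMap.comp_apply, dchart_symm he]
  rfl

/-- The Leibniz rule comes from the flat derivative d alone; the term Γ is linear over functions. -/
theorem isCovariantDerivativeOn_chartConn [I.Boundaryless] (p : E) (Γ : N → N →L[ℝ] N →L[ℝ] N) :
    IsCovariantDerivativeOn N (chartConn (I := I) p Γ) (extChartAt I p).source where
  add {X Y e} hX hY he := by
    ext v
    apply dchart_injective he
    rw [add_apply, map_add, dchart_chartConn he, dchart_chartConn he,
      dchart_chartConn he]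
    have h1 : vrep p (X + Y) = fun z => vrep p X z + vrep p Y z := by
      funext z; simp only [vrep, Pi.add_apply, map_add]
    rw [h1, fderiv_fun_add (differentiableAt_vrep he hX) (differentiableAt_vrep he hY)]
    simp only [Pi.add_apply, map_add, add_apply]
    abel
  leibniz {Y f e} hY hf he := by
    ext v
    apply dchart_injective he
    rw [add_apply, map_add, dchart_chartConn he]
    have hfd := differentiableAt_chart_comp he hf
    have h1 : vrep p (f • Y) = fun z => f ((extChartAt I p).symm z) • vrep p Y z := by
      funext z; simp only [vrep, Pi.smul_apply', map_smul]
    have h2 : mvfderiv I f e v = fderiv ℝ (fun z => f ((extChartAt I p).symm z))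
        (extChartAt I p e) (dchart I p e v) := by
      refine mvfderiv_eq_fderiv he hfd ?_ v
      filter_upwards [eventually_mem_source he] with e' he'
      rw [(extChartAt I p).left_inv he']
    rw [h1, fderiv_fun_smul hfd (differentiableAt_vrep he hY), ContinuousLinearMap.smulRight_apply,
      smul_apply, map_smul, map_smul, dchart_chartConn he, h2,
      (extChartAt I p).left_inv he, vrep_chart he]
    simp only [Pi.smul_apply', map_smul, add_apply,
      smul_apply, ContinuousLinearMap.smulRight_apply, smul_add]
    abel

theorem contMDiffAt_chartConn [I.Boundaryless] {p e : E} (he : e ∈ (extChartAt I p).source)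
    {Γ : N → N →L[ℝ] N →L[ℝ] N} (hΓ : ContDiffOn ℝ ∞ Γ (extChartAt I p).target)
    {Y : ∀ e : E, TangentSpace I e} (hY : SmoothFieldAt Y e) :
    ContMDiffAt I (I.prod 𝓘(ℝ, N →L[ℝ] N)) ∞
      (fun e => (⟨e, chartConn p Γ Y e⟩ : TotalSpace (N →L[ℝ] N)
        (fun e : E => TangentSpace I e →L[ℝ] TangentSpace I e))) e := by
  have hz := (extChartAt I p).map_source he
  have hmem : e ∈ (trivializationAt (N →L[ℝ] N)
      (fun e : E => TangentSpace I e →L[ℝ] TangentSpace I e) p).baseSet :=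
    ⟨mem_tangent_baseSet he, mem_tangent_baseSet he⟩
  refine (Trivialization.contMDiffAt_section_iff (IB := I) (n := ∞)
    (trivializationAt (N →L[ℝ] N) (fun e : E => TangentSpace I e →L[ℝ] TangentSpace I e) p)
    hmem).2 ?_
  have hv := contDiffAt_vrep he hY
  have h1 : ContDiffAt ℝ ∞ (fun z => fderiv ℝ (vrep p Y) z + (Γ z).flip (vrep p Y z))
      (extChartAt I p e) := by
    refine (hv.fderiv_right (by simp)).add ?_
    have h2 : ContDiffAt ℝ ∞ (fun z => (Γ z).flip) (extChartAt I p e) :=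
      (ContinuousLinearMap.flipₗᵢ ℝ N N N).contDiff.contDiffAt.comp _
        (hΓ.contDiffAt ((isOpen_extChartAt_target p).mem_nhds hz))
    exact h2.clm_apply hv
  refine (contMDiffAt_comp_chart he h1).congr_of_eventuallyEq ?_
  filter_upwards [eventually_mem_source he] with e' he'
  rw [hom_trivializationAt_apply]
  ext v
  rw [ContinuousLinearMap.inCoordinates]
  simp only [ContinuousLinearMap.comp_apply]
  have := dchart_chartConn he' Γ Y (dchartSymm I p e' v)
  rw [dchart_symm he'] at this
  refine this.trans ?_
  rw [vrep_chart he']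
  rfl

/-- The global connection with Christoffel tensors `Γ p` in the chart at `p`. -/
def gluedConn [I.Boundaryless] (Γ : E → N → N →L[ℝ] N →L[ℝ] N) :
    CovariantDerivative I N (TangentSpace I : E → Type _) where
  toFun Y e := chartConn e (Γ e) Y e
  isCovariantDerivativeOnUniv :=
    { add := fun {_ _ e} hX hY _ => (isCovariantDerivativeOn_chartConn e (Γ e)).add hX hY
        (mem_extChartAt_source e)
      leibniz := fun {_ _ e} hX hf _ => (isCovariantDerivativeOn_chartConn e (Γ e)).leibniz hX hf
        (mem_extChartAt_source e) }

/-- `gluedConn` uses at every point the chart centred there, so the axioms of a covariant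
derivative, being pointwise, need no agreement between charts. Smoothness does: near e the varying
charts are replaced by the fixed chart at e. -/
theorem contMDiff_gluedConn [I.Boundaryless] {Γ : E → N → N →L[ℝ] N →L[ℝ] N}
    (hΓ : ∀ p, ContDiffOn ℝ ∞ (Γ p) (extChartAt I p).target)
    (hcompat : ∀ p, ∀ e ∈ (extChartAt I p).source, ∀ Y : ∀ e : E, TangentSpace I e,
      DiffFieldAt Y e → chartConn p (Γ p) Y e = chartConn e (Γ e) Y e) :
    (gluedConn (I := I) Γ).ContMDiffCovariantDerivative ∞ := by
  refine ⟨⟨fun {Y} hY e _ => ContMDiffAt.contMDiffWithinAt ?_⟩⟩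
  have hY' : ∀ e, SmoothFieldAt Y e := fun e => (hY e (Set.mem_univ _)).contMDiffAt Filter.univ_mem
  refine (contMDiffAt_chartConn (mem_extChartAt_source e) (hΓ e)
    (hY' e)).congr_of_eventuallyEq ?_
  filter_upwards [eventually_mem_source (mem_extChartAt_source (I := I) e)] with e' he'
  rw [hcompat e e' he' Y ((hY' e').mdifferentiableAt (by simp))]
  rfl

/-- The Lie bracket on a manifold is defined by pulling back along the inverse chart; here that
pullback is recognized as `vrep`. -/
theorem inverse_eq_dchart [I.Boundaryless] {p : E} {z : N} (hz : z ∈ (extChartAt I p).target) :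
    (mfderivWithin 𝓘(ℝ, N) I (extChartAt I p).symm (Set.range I) z).inverse =
      dchart I p ((extChartAt I p).symm z) := by
  have he := (extChartAt I p).map_target hz
  have he' : (extChartAt I p).symm z ∈ (chartAt H p).source := by rwa [← extChartAt_source I]
  have h := TangentBundle.symmL_trivializationAt (I := I) he'
  rw [(extChartAt I p).right_inv hz] at h
  rw [← h]
  refine ContinuousLinearMap.inverse_eq ?_ ?_
  · ext v; exact dchartSymm_apply he v
  · ext v; exact dchart_symm he v

theorem dchart_mlieBracket [I.Boundaryless] (X Y : ∀ e : E, TangentSpace I e) (e : E) :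
    dchart I e e (VectorField.mlieBracket I X Y e) =
      fderiv ℝ (vrep e Y) (extChartAt I e e) (dchart I e e (X e)) -
      fderiv ℝ (vrep e X) (extChartAt I e e) (dchart I e e (Y e)) := by
  have he := mem_extChartAt_source (I := I) e
  have hz := (extChartAt I e).map_source he
  have he' : e ∈ (chartAt H e).source := mem_chart_source H e
  have h1 : ∀ Z : ∀ e : E, TangentSpace I e,
      VectorField.mpullbackWithin 𝓘(ℝ, N) I (extChartAt I e).symm Z (Set.range I)
        =ᶠ[nhds (extChartAt I e e)] vrep e Z := fun Z => by
    filter_upwards [(isOpen_extChartAt_target e).mem_nhds hz] with z hz'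
    rw [VectorField.mpullbackWithin_apply, inverse_eq_dchart hz']
    rfl
  have h2 : (mfderiv I 𝓘(ℝ, N) (extChartAt I e) e).inverse = dchartSymm I e e := by
    rw [← TangentBundle.continuousLinearMapAt_trivializationAt he']
    refine ContinuousLinearMap.inverse_eq ?_ ?_
    · ext v; exact dchart_symm he v
    · ext v; exact dchartSymm_apply he v
  rw [VectorField.mlieBracket, VectorField.mlieBracketWithin_apply, h2]
  refine (dchart_symm he _).trans ?_
  rw [Set.preimage_univ, Set.univ_inter]
  have h3 := Filter.EventuallyEq.lieBracket_vectorField_eq (𝕜 := ℝ) (h1 X) (h1 Y)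
  have h5 : ∀ A C : N → N, VectorField.lieBracketWithin ℝ A C (Set.range I) (extChartAt I e e) =
      VectorField.lieBracket ℝ A C (extChartAt I e e) := fun A C => by
    rw [I.range_eq_univ, VectorField.lieBracketWithin_univ]
  refine (h5 _ _).trans (h3.trans ?_)
  rw [VectorField.lieBracket, vrep_chart he, vrep_chart he]

/-- In the chart at e the flat parts give the bracket, and symmetric Christoffel terms cancel. -/
theorem gluedConn_torsionFree [I.Boundaryless] {Γ : E → N → N →L[ℝ] N →L[ℝ] N} {e : E}
    (hsymm : ∀ v w, Γ e (extChartAt I e e) v w = Γ e (extChartAt I e e) w v)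
    (X Y : ∀ e : E, TangentSpace I e) :
    gluedConn Γ Y e (X e) - gluedConn Γ X e (Y e) = VectorField.mlieBracket I X Y e := by
  have he := mem_extChartAt_source (I := I) e
  apply dchart_injective he
  rw [dchart_mlieBracket, map_sub]
  change dchart I e e (chartConn e (Γ e) Y e (X e)) - dchart I e e (chartConn e (Γ e) X e (Y e)) = _
  rw [dchart_chartConn he, dchart_chartConn he, hsymm (dchart I e e (X e))]
  abel

end Connections

end ChartCalculus

/-! ### Bilinear forms in charts; extension of identities from dense sets -/

section ChartForms

variable {N : Type*} [NormedAddCommGroup N] [NormedSpace ℝ N]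
  {H : Type*} [TopologicalSpace H] {I : ModelWithCorners ℝ N H}
  {E : Type*} [TopologicalSpace E] [ChartedSpace H E] [IsManifold I ∞ E]

/-- The bilinear form with components `G` in the chart at `p`. -/
def chartForm (p : E) (G : N → N →L[ℝ] N →L[ℝ] ℝ) (e : E) :
    TangentSpace I e →L[ℝ] TangentSpace I e →L[ℝ] ℝ :=
  (ContinuousLinearMap.precomp ℝ (dchart I p e)) ∘L (G (extChartAt I p e)) ∘L dchart I p e

theorem chartForm_apply (p : E) (G : N → N →L[ℝ] N →L[ℝ] ℝ) (e : E) (v w : TangentSpace I e) :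
    chartForm p G e v w = G (extChartAt I p e) (dchart I p e v) (dchart I p e w) := rfl

theorem contMDiffAt_chartForm {p e : E} (he : e ∈ (extChartAt I p).source)
    {G : N → N →L[ℝ] N →L[ℝ] ℝ} (hG : ContDiffAt ℝ ∞ G (extChartAt I p e)) :
    ContMDiffAt I (I.prod 𝓘(ℝ, N →L[ℝ] N →L[ℝ] ℝ)) ∞
      (fun e => TotalSpace.mk' (N →L[ℝ] N →L[ℝ] ℝ)
        (E := fun e : E => TangentSpace I e →L[ℝ] TangentSpace I e →L[ℝ] ℝ) e (chartForm p G e))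
      e := by
  -- Each tangent space is `N` by definition, and the topological structure of its dual is taken
  -- from there.
  have : ∀ x : E, ContinuousAdd (TangentSpace I x →L[ℝ] ℝ) := fun x =>
    inferInstanceAs (ContinuousAdd (N →L[ℝ] ℝ))
  have : ∀ x : E, ContinuousSMul ℝ (TangentSpace I x →L[ℝ] ℝ) := fun x =>
    inferInstanceAs (ContinuousSMul ℝ (N →L[ℝ] ℝ))
  have hmem : e ∈ (trivializationAt (N →L[ℝ] N →L[ℝ] ℝ)
      (fun e : E => TangentSpace I e →L[ℝ] TangentSpace I e →L[ℝ] ℝ) p).baseSet :=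
    ⟨mem_tangent_baseSet he, mem_tangent_baseSet he, by simp⟩
  refine (Trivialization.contMDiffAt_section_iff (IB := I) (n := ∞)
    (trivializationAt (N →L[ℝ] N →L[ℝ] ℝ)
      (fun e : E => TangentSpace I e →L[ℝ] TangentSpace I e →L[ℝ] ℝ) p) hmem).2 ?_
  refine (contMDiffAt_comp_chart he hG).congr_of_eventuallyEq ?_
  filter_upwards [eventually_mem_source he] with e' he'
  rw [hom_trivializationAt_apply]
  ext v w
  refine (inCoordinates_apply_eq₂ (E₃ := fun _ : E => ℝ) (mem_tangent_baseSet he')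
    (mem_tangent_baseSet he') (by simp)).trans ?_
  have h1 : dchart I p e' ((trivializationAt N (TangentSpace I) p).symm e' v) = v := by
    rw [← Trivialization.symmL_apply (R := ℝ) _ (mem_tangent_baseSet he')]
    exact dchart_symm he' v
  have h2 : dchart I p e' ((trivializationAt N (TangentSpace I) p).symm e' w) = w := by
    rw [← Trivialization.symmL_apply (R := ℝ) _ (mem_tangent_baseSet he')]
    exact dchart_symm he' w
  rw [chartForm_apply, h1, h2]
  simp

/-- The coordinate vector field with components `w` in the chart at `p`. -/
theorem smoothFieldAt_dchartSymm [I.Boundaryless] {p e : E} (he : e ∈ (extChartAt I p).source)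
    (w : N) : SmoothFieldAt (fun e => dchartSymm I p e w) e := by
  refine smoothFieldAt_of_eventuallyEq he (Yh := fun _ => w) contDiffAt_const ?_
  filter_upwards [eventually_mem_source he] with e' he'
  exact dchart_symm he' w

/-- The components of a smooth bilinear form in a chart are smooth. -/
theorem contMDiffAt_form_dchartSymm [I.Boundaryless] {p e : E} (he : e ∈ (extChartAt I p).source)
    {φ : ∀ e : E, TangentSpace I e →L[ℝ] TangentSpace I e →L[ℝ] ℝ}
    (hφ : ContMDiffAt I (I.prod 𝓘(ℝ, N →L[ℝ] N →L[ℝ] ℝ)) ∞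
      (fun e => TotalSpace.mk' (N →L[ℝ] N →L[ℝ] ℝ)
        (E := fun e : E => TangentSpace I e →L[ℝ] TangentSpace I e →L[ℝ] ℝ) e (φ e)) e)
    (v w : N) :
    ContMDiffAt I 𝓘(ℝ, ℝ) ∞ (fun e => φ e (dchartSymm I p e v) (dchartSymm I p e w)) e := by
  have h := ContMDiffAt.clm_bundle_apply₂ (E₃ := Bundle.Trivial E ℝ) (F₃ := ℝ) hφ
    (smoothFieldAt_dchartSymm he v) (smoothFieldAt_dchartSymm he w)
  exact (contMDiffAt_totalSpace.1 h).2

/-- Two smooth bilinear forms which agree on a set agree on its closure. -/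
theorem form_eq_of_mem_closure [I.Boundaryless] {e : E}
    {φ φ' : ∀ e : E, TangentSpace I e →L[ℝ] TangentSpace I e →L[ℝ] ℝ}
    (hφ : ContMDiffAt I (I.prod 𝓘(ℝ, N →L[ℝ] N →L[ℝ] ℝ)) ∞
      (fun e => TotalSpace.mk' (N →L[ℝ] N →L[ℝ] ℝ)
        (E := fun e : E => TangentSpace I e →L[ℝ] TangentSpace I e →L[ℝ] ℝ) e (φ e)) e)
    (hφ' : ContMDiffAt I (I.prod 𝓘(ℝ, N →L[ℝ] N →L[ℝ] ℝ)) ∞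
      (fun e => TotalSpace.mk' (N →L[ℝ] N →L[ℝ] ℝ)
        (E := fun e : E => TangentSpace I e →L[ℝ] TangentSpace I e →L[ℝ] ℝ) e (φ' e)) e)
    {S : Set E} (hS : e ∈ closure S)
    (h : ∀ᶠ e' in nhds e, e' ∈ S → φ e' = φ' e') : φ e = φ' e := by
  have he := mem_extChartAt_source (I := I) e
  ext v w
  have h1 := (contMDiffAt_form_dchartSymm he hφ (dchart I e e v) (dchart I e e w)).continuousAt
  have h2 := (contMDiffAt_form_dchartSymm he hφ' (dchart I e e v) (dchart I e e w)).continuousAt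
  have h3 := mem_closure_iff_nhdsWithin_neBot.1 hS
  -- Both components are continuous at e and agree along S, which accumulates at e, so their limits
  -- there coincide.
  have h4 := tendsto_nhds_unique_of_eventuallyEq (h1.mono_left (nhdsWithin_le_nhds (s := S)))
    (h2.mono_left nhdsWithin_le_nhds) (by
      filter_upwards [self_mem_nhdsWithin, nhdsWithin_le_nhds h] with e' he' h'
      rw [h' he'])
  simpa only [dchartSymm_apply he] using h4

/-- A globally smooth vector field with constant components near `p`. -/
theorem exists_smoothField [I.Boundaryless] [FiniteDimensional ℝ N] [T2Space E] (p : E) (w : N) :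
    ∃ σ : ∀ e : E, TangentSpace I e, (∀ e, SmoothFieldAt σ e) ∧
      ∀ᶠ e in nhds p, σ e = dchartSymm I p e w := by
  obtain ⟨f, -⟩ := (SmoothBumpFunction.nhds_basis_tsupport (I := I) p).ex_mem
  refine ⟨fun e => f e • dchartSymm I p e w, fun e => ?_, ?_⟩
  · by_cases he : e ∈ (extChartAt I p).source
    · refine smoothFieldAt_of_eventuallyEq he (Yh := fun z => f ((extChartAt I p).symm z) • w)
        ?_ ?_
      · exact (contDiffAt_chart_comp he f.contMDiffAt).smul contDiffAt_const
      · filter_upwards [eventually_mem_source he] with e' he'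
        rw [map_smul, dchart_symm he', (extChartAt I p).left_inv he']
    · have h1 : e ∉ tsupport f := fun h => he (f.tsupport_subset_extChartAt_source h)
      refine smoothFieldAt_of_eventuallyEq (mem_extChartAt_source e) (Yh := fun _ => 0)
        contDiffAt_const ?_
      filter_upwards [notMem_tsupport_iff_eventuallyEq.1 h1] with e' he'
      rw [he', Pi.zero_apply, zero_smul, map_zero]
  · filter_upwards [f.eventuallyEq_one] with e he
    rw [he, Pi.one_apply, one_smul]

/-- Smooth covariant derivatives which agree on a set of points agree on its closure. -/
theorem covariantDerivative_eq_of_mem_closure [I.Boundaryless] [FiniteDimensional ℝ N] [T2Space E]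
    {e : E} {c c' : (∀ e : E, TangentSpace I e) → ∀ e : E, TangentSpace I e →L[ℝ] TangentSpace I e}
    (hc : IsCovariantDerivativeOn N c {e}) (hc' : IsCovariantDerivativeOn N c' {e})
    (hs : ∀ σ, (∀ e, SmoothFieldAt σ e) → ContMDiffAt I (I.prod 𝓘(ℝ, N →L[ℝ] N)) ∞
      (fun e => (⟨e, c σ e⟩ : TotalSpace (N →L[ℝ] N)
        (fun e : E => TangentSpace I e →L[ℝ] TangentSpace I e))) e)
    (hs' : ∀ σ, (∀ e, SmoothFieldAt σ e) → ContMDiffAt I (I.prod 𝓘(ℝ, N →L[ℝ] N)) ∞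
      (fun e => (⟨e, c' σ e⟩ : TotalSpace (N →L[ℝ] N)
        (fun e : E => TangentSpace I e →L[ℝ] TangentSpace I e))) e)
    {S : Set E} (hS : e ∈ closure S)
    (h : ∀ᶠ e' in nhds e, e' ∈ S → ∀ σ, DiffFieldAt σ e' → c σ e' = c' σ e')
    (Y : ∀ e : E, TangentSpace I e) (hY : DiffFieldAt Y e) : c Y e = c' Y e := by
  have he := mem_extChartAt_source (I := I) e
  have : IsManifold I 1 E := IsManifold.of_le (n := ∞) (by simp)
  have h3 := mem_closure_iff_nhdsWithin_neBot.1 hS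
  -- The regularity assumptions concern globally smooth fields only, so Y is first replaced by such
  -- a field with the same value at e.
  obtain ⟨σ, hσ, hσe⟩ := exists_smoothField (I := I) e (dchart I e e (Y e))
  have hσY : σ e = Y e := by rw [hσe.self_of_nhds, dchartSymm_apply he]
  have h1 : c σ e = c' σ e := by
    ext v
    have key : ∀ b : (∀ e : E, TangentSpace I e) → ∀ e : E, TangentSpace I e →L[ℝ] TangentSpace I e,
        (∀ σ, (∀ e, SmoothFieldAt σ e) → ContMDiffAt I (I.prod 𝓘(ℝ, N →L[ℝ] N)) ∞
          (fun e => (⟨e, b σ e⟩ : TotalSpace (N →L[ℝ] N)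
          (fun e : E => TangentSpace I e →L[ℝ] TangentSpace I e))) e) →
        ContinuousAt (fun e' => dchart I e e' (b σ e' (dchartSymm I e e' (dchart I e e v)))) e := by
      intro b hb
      have k1 := ContMDiffAt.clm_bundle_apply (hb σ hσ)
        (smoothFieldAt_dchartSymm he (dchart I e e v))
      have k2 := ((trivializationAt N (TangentSpace I) e).contMDiffAt_section_iff
        (mem_tangent_baseSet he)).1 k1
      refine k2.continuousAt.congr ?_
      filter_upwards [eventually_mem_source he] with e' he'
      rw [triv_apply he']
    have h4 := tendsto_nhds_unique_of_eventuallyEq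
      ((key c hs).mono_left (nhdsWithin_le_nhds (s := S)))
      ((key c' hs').mono_left nhdsWithin_le_nhds) (by
        filter_upwards [self_mem_nhdsWithin, nhdsWithin_le_nhds h] with e' he' h'
        rw [h' he' σ ((hσ e').mdifferentiableAt (by simp))])
    simp only [dchartSymm_apply he] at h4
    exact dchart_injective he h4
  -- The difference of two covariant derivatives is tensorial: its vanishing on σ gives its
  -- vanishing on Y, since the two agree at e.
  have hd := fun {τ} (hτ : DiffFieldAt τ e) =>
    IsCovariantDerivativeOn.difference_apply (I := I) hc hc' (Set.mem_singleton e) hτ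
  have h5 := hd ((hσ e).mdifferentiableAt (by simp))
  rw [h1, sub_self, hσY] at h5
  have h6 := hd hY
  rw [h5] at h6
  exact sub_eq_zero.1 h6.symm

/-- Covariant derivatives which agree on fields spanning the tangent space agree. -/
theorem covariantDerivative_eq_of_span [FiniteDimensional ℝ N]
    {e : E} {c c' : (∀ e : E, TangentSpace I e) → ∀ e : E, TangentSpace I e →L[ℝ] TangentSpace I e}
    (hc : IsCovariantDerivativeOn N c {e}) (hc' : IsCovariantDerivativeOn N c' {e})
    (h : ∀ v w : TangentSpace I e, ∃ σ, DiffFieldAt σ e ∧ σ e = v ∧ c σ e w = c' σ e w)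
    (Y : ∀ e : E, TangentSpace I e) (hY : DiffFieldAt Y e) : c Y e = c' Y e := by
  have : IsManifold I 1 E := IsManifold.of_le (n := ∞) (by simp)
  -- By tensoriality of the difference, one test field for each value at e is enough.
  have hd := fun {τ} (hτ : DiffFieldAt τ e) =>
    IsCovariantDerivativeOn.difference_apply (I := I) hc hc' (Set.mem_singleton e) hτ
  ext w
  obtain ⟨σ, hσ, hσe, hw⟩ := h (Y e) w
  have h1 := DFunLike.congr_fun (hd hσ) w
  have h2 := DFunLike.congr_fun (hd hY) w
  rw [hσe, h2] at h1
  rw [sub_apply, sub_apply, hw, sub_self] at h1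
  exact sub_eq_zero.1 h1

end ChartForms

/-! ### Gluing bilinear forms; metric compatibility in charts -/

section ChartForms

variable {N : Type*} [NormedAddCommGroup N] [NormedSpace ℝ N]
  {H : Type*} [TopologicalSpace H] {I : ModelWithCorners ℝ N H}
  {E : Type*} [TopologicalSpace E] [ChartedSpace H E] [IsManifold I ∞ E]

/-- The global bilinear form with components `G p` in the chart at `p`. -/
def gluedForm (G : E → N → N →L[ℝ] N →L[ℝ] ℝ) (e : E) :
    TangentSpace I e →L[ℝ] TangentSpace I e →L[ℝ] ℝ := chartForm e (G e) e

theorem gluedForm_symm {G : E → N → N →L[ℝ] N →L[ℝ] ℝ} (hG : ∀ p y v w, G p y v w = G p y w v)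
    (e : E) (v w : TangentSpace I e) : gluedForm G e v w = gluedForm G e w v := by
  rw [gluedForm, chartForm_apply, chartForm_apply, hG]

theorem contMDiff_gluedForm [I.Boundaryless] {G : E → N → N →L[ℝ] N →L[ℝ] ℝ}
    (hG : ∀ p, ContDiffOn ℝ ∞ (G p) (extChartAt I p).target)
    (hcompat : ∀ p, ∀ e ∈ (extChartAt I p).source,
      chartForm (I := I) p (G p) e = chartForm e (G e) e) :
    ContMDiff I (I.prod 𝓘(ℝ, N →L[ℝ] N →L[ℝ] ℝ)) ∞
      (fun e => TotalSpace.mk' (N →L[ℝ] N →L[ℝ] ℝ)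
        (E := fun e : E => TangentSpace I e →L[ℝ] TangentSpace I e →L[ℝ] ℝ) e
        (gluedForm G e)) := fun p => by
  have hp := mem_extChartAt_source (I := I) p
  refine (contMDiffAt_chartForm hp ((hG p).contDiffAt ((isOpen_extChartAt_target p).mem_nhds
    ((extChartAt I p).map_source hp)))).congr_of_eventuallyEq ?_
  filter_upwards [eventually_mem_source hp] with e he
  rw [hcompat p e he, gluedForm]

/-- The hypothesis `h` says that the covariant derivative of G vanishes at e. The product rule for
G(Y, Z) in the chart at e supplies the terms with derivatives of Y and Z. -/
theorem gluedConn_compatible [I.Boundaryless] {Γ : E → N → N →L[ℝ] N →L[ℝ] N}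
    {G : E → N → N →L[ℝ] N →L[ℝ] ℝ} {e : E}
    (hG : ∀ p, ContDiffOn ℝ ∞ (G p) (extChartAt I p).target)
    (hcompat : ∀ p, ∀ e ∈ (extChartAt I p).source,
      chartForm (I := I) p (G p) e = chartForm e (G e) e)
    (h : ∀ v y z, fderiv ℝ (G e) (extChartAt I e e) v y z =
      G e (extChartAt I e e) (Γ e (extChartAt I e e) v y) z +
      G e (extChartAt I e e) y (Γ e (extChartAt I e e) v z))
    (X Y Z : ∀ e : E, TangentSpace I e) (hY : DiffFieldAt Y e) (hZ : DiffFieldAt Z e) :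
    mvfderiv I (fun e => gluedForm G e (Y e) (Z e)) e (X e) =
      gluedForm G e (gluedConn Γ Y e (X e)) (Z e) + gluedForm G e (Y e) (gluedConn Γ Z e (X e)) := by
  have he := mem_extChartAt_source (I := I) e
  have h1 : ∀ᶠ e' in nhds e, gluedForm G e' (Y e') (Z e') =
      (fun z => G e z (vrep e Y z) (vrep e Z z)) (extChartAt I e e') := by
    filter_upwards [eventually_mem_source he] with e' he'
    rw [gluedForm, ← hcompat e e' he', chartForm_apply, vrep_chart he', vrep_chart he']
  have hGd : DifferentiableAt ℝ (G e) (extChartAt I e e) :=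
    ((hG e).contDiffAt ((isOpen_extChartAt_target e).mem_nhds
      ((extChartAt I e).map_source he))).differentiableAt (by simp)
  have hYd := differentiableAt_vrep he hY
  have hZd := differentiableAt_vrep he hZ
  rw [mvfderiv_eq_fderiv he ((hGd.clm_apply hYd).clm_apply hZd) h1,
    fderiv_clm_apply (hGd.clm_apply hYd) hZd, fderiv_clm_apply hGd hYd]
  simp only [gluedForm, chartForm_apply]
  change _ = G e (extChartAt I e e) (dchart I e e (chartConn e (Γ e) Y e (X e))) _ +
    G e (extChartAt I e e) _ (dchart I e e (chartConn e (Γ e) Z e (X e)))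
  rw [dchart_chartConn he, dchart_chartConn he]
  simp only [add_apply, ContinuousLinearMap.comp_apply, ContinuousLinearMap.flip_apply, map_add,
    vrep_chart he, h]
  abel

end ChartForms

/-! ### The affine part of elements of Λ F^* -/

section AffineModel

variable {B : Type*} [NormedAddCommGroup B] [NormedSpace ℝ B] [FiniteDimensional ℝ B]
  {F : Type*} [NormedAddCommGroup F] [NormedSpace ℝ F] [FiniteDimensional ℝ F]

/-- The degree one component, as a continuous linear map. -/
def linCLM : ModelAlg F →L[ℝ] F →L[ℝ] ℝ :=
  LinearMap.toContinuousLinearMap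
    ((LinearMap.toContinuousLinearMap : (F →ₗ[ℝ] ℝ) ≃ₗ[ℝ] F →L[ℝ] ℝ).toLinearMap ∘ₗ lin)

theorem linCLM_apply (a : ModelAlg F) (ξ : F) : linCLM a ξ = lin a ξ := rfl

/-- The degree zero component, as a continuous linear map. -/
def bodyCLM : ModelAlg F →L[ℝ] ℝ := modelCLM body.toLinearMap

/-- The affine function `ξ ↦ a₀ + a₁(ξ)` on `F` defined by the components of degree at most one
of an element of `Λ F^*`. -/
def aff (ξ : F) (a : ModelAlg F) : ℝ := bodyCLM a + linCLM a ξ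

theorem aff_apply (ξ : F) (a : ModelAlg F) : aff ξ a = body a + lin a ξ := rfl

theorem aff_add (ξ : F) (a b : ModelAlg F) : aff ξ (a + b) = aff ξ a + aff ξ b := by
  simp only [aff, map_add, add_apply]; ring

theorem aff_smul (ξ : F) (c : ℝ) (a : ModelAlg F) : aff ξ (c • a) = c * aff ξ a := by
  simp only [aff, map_smul, smul_apply, smul_eq_mul]; ring

theorem aff_sum (ξ : F) {ι : Type*} (s : Finset ι) (f : ι → ModelAlg F) :
    aff ξ (∑ i ∈ s, f i) = ∑ i ∈ s, aff ξ (f i) := by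
  simp only [aff, map_sum, sum_apply, Finset.sum_add_distrib]

theorem aff_mul (ξ : F) (a b : ModelAlg F) :
    aff ξ (a * b) = body a * aff ξ b + lin a ξ * body b := by
  simp only [aff_apply, map_mul, lin_mul]
  simp only [LinearMap.add_apply, LinearMap.smul_apply, smul_eq_mul]
  ring

variable (B F) in
/-- The basis of `B × F`. -/
def prodBasis : Module.Basis (FrameIdx B F) ℝ (B × F) :=
  (Module.finBasis ℝ B).prod (Module.finBasis ℝ F)

theorem prodBasis_inl (i : Fin (Module.finrank ℝ B)) :
    prodBasis B F (.inl i) = (Module.finBasis ℝ B i, 0) := by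
  simp [prodBasis]

theorem prodBasis_inr (a : Fin (Module.finrank ℝ F)) :
    prodBasis B F (.inr a) = (0, Module.finBasis ℝ F a) := by
  simp [prodBasis]

/-- The coordinates on `B × F`. -/
def prodCoord (k : FrameIdx B F) : B × F →L[ℝ] ℝ :=
  LinearMap.toContinuousLinearMap ((prodBasis B F).coord k)

theorem prodCoord_prodBasis (k l : FrameIdx B F) :
    prodCoord k (prodBasis B F l) = if k = l then 1 else 0 := by
  rw [prodCoord, LinearMap.coe_toContinuousLinearMap', Module.Basis.coord_apply,
    Module.Basis.repr_self, Finsupp.single_apply]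
  simp only [eq_comm]

theorem sum_prodCoord (v : B × F) : ∑ k, prodCoord k v • prodBasis B F k = v :=
  (prodBasis B F).sum_repr v

theorem prodCoord_sum (k : FrameIdx B F) (c : FrameIdx B F → ℝ) :
    prodCoord k (∑ l, c l • prodBasis B F l) = c k := by
  rw [map_sum]
  simp only [map_smul, prodCoord_prodBasis, smul_eq_mul, mul_ite, mul_one, mul_zero,
    Finset.sum_ite_eq, Finset.mem_univ, if_true]

/-- The even coordinates. -/
def evenCoord : FrameIdx B F → (B × F →L[ℝ] ℝ) :=
  Sum.elim (fun i => prodCoord (.inl i)) fun _ => 0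

/-- The odd coordinates. -/
def oddCoord : FrameIdx B F → (B × F →L[ℝ] ℝ) :=
  Sum.elim (fun _ => 0) fun a => prodCoord (.inr a)

/-- The bilinear form on `B × F` which computes the affine part of `X^k Y^l a`. -/
def triForm (k l : FrameIdx B F) (a : ModelAlg F) (ξ : F) : B × F →L[ℝ] B × F →L[ℝ] ℝ :=
  aff ξ a • (evenCoord k).smulRight (evenCoord l) +
    body a • ((evenCoord k).smulRight (oddCoord l) + (oddCoord k).smulRight (evenCoord l))

theorem triForm_apply (k l : FrameIdx B F) (a : ModelAlg F) (ξ : F) (v w : B × F) :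
    triForm k l a ξ v w = aff ξ a * (evenCoord k v * evenCoord l w) +
      body a * (evenCoord k v * oddCoord l w + oddCoord k v * evenCoord l w) := rfl

theorem triForm_swap (k l : FrameIdx B F) (a : ModelAlg F) (ξ : F) (v w : B × F) :
    triForm k l a ξ v w = triForm l k a ξ w v := by
  simp only [triForm_apply]; ring

/-- The parity count on which everything depends. An even coefficient enters through its body alone
and an odd one through its linear part alone; in each case this is its affine value, a component of
v or w. A product of two linear parts has degree two and leaves no trace. -/
theorem aff_mul_mul_eq_triForm {k l : FrameIdx B F} {x y : ModelAlg F}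
    (hx : x ∈ CliffordAlgebra.evenOdd (0 : QuadraticForm ℝ (Module.Dual ℝ F)) (idxParity k))
    (hy : y ∈ CliffordAlgebra.evenOdd (0 : QuadraticForm ℝ (Module.Dual ℝ F)) (idxParity l))
    (a : ModelAlg F) (ξ : F) {v w : B × F} (hv : prodCoord k v = aff ξ x)
    (hw : prodCoord l w = aff ξ y) :
    aff ξ (x * (y * a)) = triForm k l a ξ v w := by
  have key : ∀ {k : FrameIdx B F} {x : ModelAlg F} {v : B × F},
      x ∈ CliffordAlgebra.evenOdd (0 : QuadraticForm ℝ (Module.Dual ℝ F)) (idxParity k) →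
      prodCoord k v = aff ξ x → body x = evenCoord k v ∧ lin x ξ = oddCoord k v := by
    intro k x v hx hv
    rcases k with i | a
    · have h := lin_eq_zero_of_even hx
      refine ⟨?_, by rw [h]; rfl⟩
      change _ = prodCoord (.inl i) v
      rw [hv, aff_apply, h]; simp
    · have h := body_eq_zero_of_odd hx
      refine ⟨h, ?_⟩
      change _ = prodCoord (.inr a) v
      rw [hv, aff_apply, h, zero_add]
  obtain ⟨h1, h2⟩ := key hx hv
  obtain ⟨h3, h4⟩ := key hy hw
  rw [triForm_apply, aff_mul, aff_mul, map_mul, h1, h2, h3, h4]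
  ring

theorem contDiffOn_aff {s : Set B} {f : B → ModelAlg F} (hf : ContDiffOn ℝ ∞ f s) :
    ContDiffOn ℝ ∞ (fun y : B × F => aff y.2 (f y.1)) (s ×ˢ Set.univ) := by
  have h1 : ContDiffOn ℝ ∞ (fun y : B × F => f y.1) (s ×ˢ Set.univ) :=
    hf.comp contDiff_fst.contDiffOn fun y hy => hy.1
  exact (bodyCLM.contDiff.comp_contDiffOn h1).add
    ((linCLM.contDiff.comp_contDiffOn h1).clm_apply contDiff_snd.contDiffOn)

theorem contDiffOn_body {s : Set B} {f : B → ModelAlg F} (hf : ContDiffOn ℝ ∞ f s) :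
    ContDiffOn ℝ ∞ (fun y : B × F => body (f y.1)) (s ×ˢ Set.univ) :=
  bodyCLM.contDiff.comp_contDiffOn (hf.comp contDiff_fst.contDiffOn fun _ hy => hy.1)

theorem contDiffOn_triForm (k l : FrameIdx B F) {s : Set B} {f : B → ModelAlg F}
    (hf : ContDiffOn ℝ ∞ f s) :
    ContDiffOn ℝ ∞ (fun y : B × F => triForm k l (f y.1) y.2) (s ×ˢ Set.univ) :=
  ((ContinuousLinearMap.toSpanSingleton ℝ _).contDiff.comp_contDiffOn (contDiffOn_aff hf)).add
    ((ContinuousLinearMap.toSpanSingleton ℝ _).contDiff.comp_contDiffOn (contDiffOn_body hf))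

theorem contDiffOn_sum_triForm {s : Set B} {f : FrameIdx B F → FrameIdx B F → B → ModelAlg F}
    (hf : ∀ k l, ContDiffOn ℝ ∞ (f k l) s) :
    ContDiffOn ℝ ∞ (fun y : B × F => ∑ k, ∑ l, triForm k l (f k l y.1) y.2) (s ×ˢ Set.univ) :=
  ContDiffOn.sum fun k _ => ContDiffOn.sum fun l _ => contDiffOn_triForm k l (hf k l)

theorem contDiffOn_smul_model (c : ℝ) {s : Set B} {f : B → ModelAlg F}
    (hf : ContDiffOn ℝ ∞ f s) : ContDiffOn ℝ ∞ (fun z => c • f z) s :=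
  (modelCLM (Algebra.lsmul ℝ ℝ (ModelAlg F) c)).contDiff.comp_contDiffOn hf

theorem hasFDerivAt_aff {f : B → ModelAlg F} {z : B} (ξ : F) (hf : DifferentiableAt ℝ f z) :
    HasFDerivAt (fun y : B × F => aff y.2 (f y.1))
      ((bodyCLM ∘L fderiv ℝ f z + (linCLM ∘L fderiv ℝ f z).flip ξ) ∘L ContinuousLinearMap.fst ℝ B F
        + linCLM (f z) ∘L ContinuousLinearMap.snd ℝ B F) (z, ξ) := by
  have h0 : HasFDerivAt (fun y : B × F => f y.1) (fderiv ℝ f z ∘L ContinuousLinearMap.fst ℝ B F)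
      (z, ξ) := HasFDerivAt.comp (z, ξ) hf.hasFDerivAt hasFDerivAt_fst
  have h1 := (bodyCLM.hasFDerivAt.comp (z, ξ) h0).add
    ((linCLM.hasFDerivAt.comp (z, ξ) h0).clm_apply hasFDerivAt_snd)
  refine HasFDerivAt.congr_fderiv h1 ?_
  ext v
  · simp
  · simp

theorem fderiv_aff_prodBasis_inl {f : B → ModelAlg F} {z : B} (ξ : F)
    (hf : DifferentiableAt ℝ f z) (i : Fin (Module.finrank ℝ B)) :
    fderiv ℝ (fun y : B × F => aff y.2 (f y.1)) (z, ξ) (prodBasis B F (.inl i)) =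
      aff ξ (frameDeriv (.inl i) f z) := by
  rw [(hasFDerivAt_aff ξ hf).fderiv, prodBasis_inl]
  simp [aff, frameDeriv]

/-- The slope of an affine function along a fibre direction is its linear part on that direction,
which `body_contract` expresses through ∂/∂θ. -/
theorem fderiv_aff_prodBasis_inr {f : B → ModelAlg F} {z : B} (ξ : F)
    (hf : DifferentiableAt ℝ f z) (a : Fin (Module.finrank ℝ F)) :
    fderiv ℝ (fun y : B × F => aff y.2 (f y.1)) (z, ξ) (prodBasis B F (.inr a)) =
      body (frameDeriv (.inr a) f z : ModelAlg F) := by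
  rw [(hasFDerivAt_aff ξ hf).fderiv, prodBasis_inr]
  have := body_contract (Module.Dual.eval ℝ F (Module.finBasis ℝ F a)) (f z)
  simp only [frameDeriv, Sum.elim_inr, contractBasis]
  rw [this]
  simp [linCLM_apply]

/-- Even superderivations act on the components of degree at most one as a vector field. -/
theorem aff_sum_mul_frameDeriv {f : B → ModelAlg F} {z : B} (ξ : F)
    (hf : DifferentiableAt ℝ f z) {x : FrameIdx B F → ModelAlg F}
    (hx : ∀ k, x k ∈ CliffordAlgebra.evenOdd (0 : QuadraticForm ℝ (Module.Dual ℝ F))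
      (idxParity k)) :
    aff ξ (∑ k, x k * frameDeriv k f z) =
      fderiv ℝ (fun y : B × F => aff y.2 (f y.1)) (z, ξ) (∑ k, aff ξ (x k) • prodBasis B F k) := by
  rw [aff_sum, map_sum]
  refine Finset.sum_congr rfl fun k _ => ?_
  rw [map_smul, aff_mul, smul_eq_mul]
  rcases k with i | a
  -- For an even index the coefficient acts by its body. For an odd index it has no body, so only
  -- the body of the contraction survives, and that is the fibre derivative.
  · have h := lin_eq_zero_of_even (hx (.inl i))
    rw [fderiv_aff_prodBasis_inl ξ hf, aff_apply ξ (x _), h]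
    simp
  · rw [fderiv_aff_prodBasis_inr ξ hf, aff_apply ξ (x (.inr a)), body_eq_zero_of_odd (hx (.inr a))]
    simp

end AffineModel

/-! ### Vector field, bilinear form and Christoffel tensor in coordinates -/

section CoordinateFields

variable {B : Type*} [NormedAddCommGroup B] [NormedSpace ℝ B] [FiniteDimensional ℝ B]
  {F : Type*} [NormedAddCommGroup F] [NormedSpace ℝ F] [FiniteDimensional ℝ F]
  {M : Type*} [TopologicalSpace M] [ChartedSpace B M]
  {V : M → Type*} [TopologicalSpace (TotalSpace F V)]
  [∀ x, AddCommGroup (V x)] [∀ x, Module ℝ (V x)] [∀ x, TopologicalSpace (V x)]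
  [FiberBundle F V] [VectorBundle ℝ F V]
  [IsManifold 𝓘(ℝ, B) ∞ M] [ContMDiffVectorBundle ∞ F V 𝓘(ℝ, B)]

/-- The vector field on `B × F` which represents an even superderivation in the coordinates
at `x₀`. -/
def hat (x₀ : M) {U : Opens M} (hU : U ≤ coordDomain B F V x₀) (X : superDer B F V U)
    (y : B × F) : B × F :=
  ∑ k, aff y.2 (rep x₀ (X.app (coordSF x₀ hU k)) y.1) • prodBasis B F k

theorem prodCoord_hat {x₀ : M} {U : Opens M} (hU : U ≤ coordDomain B F V x₀)
    (X : superDer B F V U) (y : B × F) (k : FrameIdx B F) :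
    prodCoord k (hat x₀ hU X y) = aff y.2 (rep x₀ (X.app (coordSF x₀ hU k)) y.1) :=
  prodCoord_sum k _

theorem contDiffOn_hat {x₀ : M} {U : Opens M} (hU : U ≤ coordDomain B F V x₀)
    (X : superDer B F V U) : ContDiffOn ℝ ∞ (hat x₀ hU X) (chartImage x₀ U ×ˢ Set.univ) := by
  refine ContDiffOn.sum fun k _ => ?_
  exact (contDiffOn_aff (contDiffOn_rep hU _)).smul contDiffOn_const

theorem isOpen_chartImage_prod (x₀ : M) (U : Opens M) :
    IsOpen (chartImage (B := B) x₀ U ×ˢ (Set.univ : Set F)) :=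
  (isOpen_chartImage x₀ U).prod isOpen_univ

theorem app_resDer {U W : Opens M} (h : W ≤ U) (X : superDer B F V U) (f : superFun B F V U) :
    (resDer h X).app (res h f) = res h (X.app f) := by
  change X.1 ⟨W, _⟩ (res h f) = res h (X.1 ⟨U, le_rfl⟩ f)
  rw [superDer_res X le_rfl h]

theorem hat_resDer {x₀ : M} {U W : Opens M} (hU : U ≤ coordDomain B F V x₀) (h : W ≤ U)
    (X : superDer B F V U) {y : B × F} (hy : y.1 ∈ chartImage x₀ W) :
    hat x₀ (h.trans hU) (resDer h X) y = hat x₀ hU X y := by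
  refine Finset.sum_congr rfl fun k _ => ?_
  rw [← res_coordSF hU h, app_resDer, rep_res _ _ hy]

theorem hasParity_app {U : Opens M} {p q : ZMod 2} {X : superDer B F V U} (hX : DerHasParity p X)
    {f : superFun B F V U} (hf : HasParity q f) : HasParity (p + q) (X.app f) :=
  hX.2.1 U le_rfl q f hf

theorem hasParity_app_coordSF {x₀ : M} {U : Opens M} (hU : U ≤ coordDomain B F V x₀) {p : ZMod 2}
    {X : superDer B F V U} (hX : DerHasParity p X) (k : FrameIdx B F) :
    HasParity (p + idxParity k) (X.app (coordSF x₀ hU k)) :=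
  hasParity_app hX (coordSF_parity hU k)

theorem hasParity_even_app_coordSF {x₀ : M} {U : Opens M} (hU : U ≤ coordDomain B F V x₀)
    {X : superDer B F V U} (hX : DerHasParity 0 X) (k : FrameIdx B F) :
    HasParity (idxParity k) (X.app (coordSF x₀ hU k)) := by
  have := hasParity_app_coordSF hU hX k
  rwa [zero_add] at this

/-- Even superderivations act as the representing vector fields. -/
theorem aff_rep_der {x₀ : M} {U : Opens M} (hU : U ≤ coordDomain B F V x₀)
    {X : superDer B F V U} (hX : DerHasParity 0 X) {W : Opens M} (hW : W ≤ U)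
    (f : superFun B F V W) {y : B × F} (hy : y.1 ∈ chartImage x₀ W) :
    aff y.2 (rep x₀ (X.1 ⟨W, hW⟩ f) y.1) =
      fderiv ℝ (fun y : B × F => aff y.2 (rep x₀ f y.1)) y (hat x₀ hU X y) := by
  obtain ⟨z, ξ⟩ := y
  have hX' : DerHasParity 0 (resDer hW X) := restrict_mem hW hX
  rw [rep_superDer hU X hW f hy, ← hat_resDer hU hW X hy]
  exact aff_sum_mul_frameDeriv ξ (differentiableAt_rep (hW.trans hU) f hy)
    fun k => (hasParity_iff_rep (hW.trans hU)).1
      (hasParity_even_app_coordSF (hW.trans hU) hX' k) z hy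

/-- The components of an odd metric in the coordinates at `x₀`. -/
def metricCoef (x₀ : M) (g : OddRiemannianMetric B F V) (k l : FrameIdx B F) : B → ModelAlg F :=
  rep x₀ (g.toFun (coordDomain B F V x₀) (frame x₀ le_rfl k) (frame x₀ le_rfl l))

theorem rep_metric_frame {x₀ : M} (g : OddRiemannianMetric B F V) {U : Opens M}
    (hU : U ≤ coordDomain B F V x₀) (k l : FrameIdx B F) {z : B} (hz : z ∈ chartImage x₀ U) :
    rep x₀ (g.toFun U (frame x₀ hU k) (frame x₀ hU l)) z = metricCoef x₀ g k l z := by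
  rw [← resDer_frame le_rfl hU k, ← resDer_frame le_rfl hU l, ← g.res_apply, rep_res _ _ hz]
  rfl

theorem triForm_smul (k l : FrameIdx B F) (r : ℝ) (a : ModelAlg F) (ξ : F) :
    triForm k l (r • a) ξ = r • triForm k l a ξ := by
  ext v w <;> simp [triForm_apply, aff_smul] <;> ring

/-- The bilinear form on `B × F` induced by an odd metric in the coordinates at `x₀`. -/
def localForm (x₀ : M) (g : OddRiemannianMetric B F V) (y : B × F) : B × F →L[ℝ] B × F →L[ℝ] ℝ :=
  ∑ k, ∑ l, triForm k l
    ((sgn (idxParity k) * sgn (idxParity l)) • metricCoef x₀ g l k y.1) y.2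

theorem localForm_apply (x₀ : M) (g : OddRiemannianMetric B F V) (y v w : B × F) :
    localForm x₀ g y v w = ∑ k, ∑ l, sgn (idxParity k) * sgn (idxParity l) *
      triForm k l (metricCoef x₀ g l k y.1) y.2 v w := by
  simp only [localForm, sum_apply, triForm_smul, smul_apply, smul_eq_mul]

theorem contDiffOn_metricCoef (x₀ : M) (g : OddRiemannianMetric B F V) (k l : FrameIdx B F) :
    ContDiffOn ℝ ∞ (metricCoef x₀ g k l) (chartImage (B := B) x₀ (coordDomain B F V x₀)) :=
  contDiffOn_rep le_rfl _

theorem contDiffOn_localForm (x₀ : M) (g : OddRiemannianMetric B F V) :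
    ContDiffOn ℝ ∞ (localForm x₀ g)
      (chartImage (B := B) x₀ (coordDomain B F V x₀) ×ˢ Set.univ) := by
  exact contDiffOn_sum_triForm
    (f := fun k l z => (sgn (idxParity k) * sgn (idxParity l)) • metricCoef x₀ g l k z)
    fun k l => contDiffOn_smul_model _ (contDiffOn_metricCoef x₀ g l k)

theorem metric_smul_left_sum (g : OddRiemannianMetric B F V) {x₀ : M} {U : Opens M}
    (hU : U ≤ coordDomain B F V x₀) {p : ZMod 2} {X : superDer B F V U} (hX : DerHasParity p X)
    (Y : superDer B F V U) :
    g.toFun U X Y = ∑ k, sgn (p + idxParity k) •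
      (X.app (coordSF x₀ hU k) * g.toFun U (frame x₀ hU k) Y) := by
  conv_lhs => rw [superDer_eq_sum hU X]
  rw [map_sum, LinearMap.sum_apply]
  refine Finset.sum_congr rfl fun k _ => ?_
  rw [g.smul_left U _ _ _ _ (hasParity_app_coordSF hU hX k)]

/-- X is expanded in the first argument, the arguments are exchanged without sign because Y is even,
and then Y is expanded. This produces the exchanged indices of `metricCoef` in `localForm`; the two
signs come from the oddness of g. -/
theorem aff_rep_metric (g : OddRiemannianMetric B F V) {x₀ : M} {U : Opens M}
    (hU : U ≤ coordDomain B F V x₀) {X Y : superDer B F V U} (hX : DerHasParity 0 X)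
    (hY : DerHasParity 0 Y) {y : B × F} (hy : y.1 ∈ chartImage x₀ U) :
    aff y.2 (rep x₀ (g.toFun U X Y) y.1) =
      localForm x₀ g y (hat x₀ hU X y) (hat x₀ hU Y y) := by
  rw [metric_smul_left_sum g hU hX, rep_sum, aff_sum, localForm_apply]
  refine Finset.sum_congr rfl fun k _ => ?_
  rw [g.supersymm U _ _ _ _ (frame_parity hU k) hY, mul_zero, sgn_zero, one_smul,
    metric_smul_left_sum g hU hY, rep_smul, aff_smul, Finset.mul_sum, rep_sum, aff_sum,
    Finset.mul_sum]
  refine Finset.sum_congr rfl fun l _ => ?_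
  rw [mul_smul_comm, rep_smul, aff_smul, rep_mul, rep_mul, rep_metric_frame g hU l k hy, zero_add,
    zero_add, ← mul_assoc]
  congr 1
  exact aff_mul_mul_eq_triForm
    ((hasParity_iff_rep hU).1 (hasParity_even_app_coordSF hU hX k) _ hy)
    ((hasParity_iff_rep hU).1 (hasParity_even_app_coordSF hU hY l) _ hy) _ _
    (prodCoord_hat hU X y k) (prodCoord_hat hU Y y l)

theorem triForm_inr_inr (a b : Fin (Module.finrank ℝ F)) (c : ModelAlg F) (ξ : F) :
    triForm (B := B) (.inr a) (.inr b) c ξ = 0 := by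
  ext v w <;> simp [triForm_apply, evenCoord]

/-- The sign is -1 only when both indices are odd, where `triForm` vanishes. This is why
supersymmetry turns into ordinary symmetry, both for the metric and for the Christoffel tensor. -/
theorem triForm_sgn_smul (k l : FrameIdx B F) (a : ModelAlg F) (ξ : F) :
    triForm k l (sgn (idxParity k * idxParity l) • a) ξ = triForm k l a ξ := by
  rcases k with i | a
  · rw [show idxParity (.inl i : FrameIdx B F) = 0 from rfl, zero_mul, sgn_zero, one_smul]
  · rcases l with j | b
    · rw [show idxParity (.inl j : FrameIdx B F) = 0 from rfl, mul_zero, sgn_zero, one_smul]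
    · rw [triForm_inr_inr, triForm_inr_inr]

theorem metricCoef_symm (x₀ : M) (g : OddRiemannianMetric B F V) (k l : FrameIdx B F) (z : B) :
    metricCoef x₀ g k l z = sgn (idxParity k * idxParity l) • metricCoef x₀ g l k z := by
  rw [metricCoef, g.supersymm _ _ _ _ _ (frame_parity le_rfl k) (frame_parity le_rfl l), rep_smul]
  rfl

theorem localForm_symm (x₀ : M) (g : OddRiemannianMetric B F V) (y v w : B × F) :
    localForm x₀ g y v w = localForm x₀ g y w v := by
  rw [localForm_apply, localForm_apply, Finset.sum_comm]
  refine Finset.sum_congr rfl fun k _ => Finset.sum_congr rfl fun l _ => ?_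
  rw [triForm_swap, metricCoef_symm, triForm_sgn_smul, mul_comm (sgn _)]

/-- The Christoffel symbols of a connection in the coordinates at `x₀`. -/
def chris (x₀ : M) (D : SuperConnection B F V) (k l m : FrameIdx B F) : B → ModelAlg F :=
  rep x₀ ((D.toFun (coordDomain B F V x₀) (frame x₀ le_rfl k) (frame x₀ le_rfl l)).app
    (coordSF x₀ le_rfl m))

theorem rep_chris {x₀ : M} (D : SuperConnection B F V) {U : Opens M}
    (hU : U ≤ coordDomain B F V x₀) (k l m : FrameIdx B F) {z : B} (hz : z ∈ chartImage x₀ U) :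
    rep x₀ ((D.toFun U (frame x₀ hU k) (frame x₀ hU l)).app (coordSF x₀ hU m)) z =
      chris x₀ D k l m z := by
  rw [← resDer_frame le_rfl hU k, ← resDer_frame le_rfl hU l, ← D.res_apply,
    ← res_coordSF le_rfl hU, app_resDer, rep_res _ _ hz]
  rfl

/-- The Christoffel tensor on `B × F` induced by a connection in the coordinates at `x₀`. -/
def localChris (x₀ : M) (D : SuperConnection B F V) (y : B × F) :
    B × F →L[ℝ] B × F →L[ℝ] B × F :=
  ∑ m, ∑ k, ∑ l, ContinuousLinearMap.compL ℝ (B × F) ℝ (B × F)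
    (ContinuousLinearMap.toSpanSingleton ℝ (prodBasis B F m)) ∘L
      triForm k l (chris x₀ D k l m y.1) y.2

theorem localChris_apply (x₀ : M) (D : SuperConnection B F V) (y v w : B × F) :
    localChris x₀ D y v w =
      ∑ m, (∑ k, ∑ l, triForm k l (chris x₀ D k l m y.1) y.2 v w) • prodBasis B F m := by
  simp only [localChris, sum_apply, Finset.sum_smul]
  rfl

theorem contDiffOn_localChris (x₀ : M) (D : SuperConnection B F V) :
    ContDiffOn ℝ ∞ (localChris x₀ D)
      (chartImage (B := B) x₀ (coordDomain B F V x₀) ×ˢ Set.univ) := by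
  refine ContDiffOn.sum fun m _ => ContDiffOn.sum fun k _ => ContDiffOn.sum fun l _ => ?_
  exact contDiffOn_const.clm_comp (contDiffOn_triForm k l (contDiffOn_rep le_rfl _))

theorem app_add {U : Opens M} (X Y : superDer B F V U) (f : superFun B F V U) :
    (X + Y).app f = X.app f + Y.app f := rfl

theorem app_smul {U : Opens M} (c : superFun B F V U) (X : superDer B F V U)
    (f : superFun B F V U) : (c • X).app f = c * X.app f := rfl

theorem app_sum {U : Opens M} {ι : Type*} (s : Finset ι) (X : ι → superDer B F V U)
    (f : superFun B F V U) : (∑ i ∈ s, X i).app f = ∑ i ∈ s, (X i).app f :=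
  map_sum (evalDer le_rfl f) X s

theorem connection_smul_left_sum (D : SuperConnection B F V) {x₀ : M} {U : Opens M}
    (hU : U ≤ coordDomain B F V x₀) (X Y : superDer B F V U) :
    D.toFun U X Y = ∑ k, X.app (coordSF x₀ hU k) • D.toFun U (frame x₀ hU k) Y := by
  conv_lhs => rw [superDer_eq_sum hU X]
  rw [map_sum, LinearMap.sum_apply]
  refine Finset.sum_congr rfl fun k _ => ?_
  rw [D.smul_left]

/-- The Leibniz rule is applied to the expansion of Y in the frame. It produces no signs because X
is even. -/
theorem connection_app (D : SuperConnection B F V) {x₀ : M} {U : Opens M}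
    (hU : U ≤ coordDomain B F V x₀) {X : superDer B F V U} (hX : DerHasParity 0 X)
    {Y : superDer B F V U} (hY : DerHasParity 0 Y) (m : FrameIdx B F) :
    (D.toFun U X Y).app (coordSF x₀ hU m) = X.app (Y.app (coordSF x₀ hU m)) +
      ∑ l, ∑ k, Y.app (coordSF x₀ hU l) * (X.app (coordSF x₀ hU k) *
        (D.toFun U (frame x₀ hU k) (frame x₀ hU l)).app (coordSF x₀ hU m)) := by
  have h1 : X.app (Y.app (coordSF x₀ hU m)) = ∑ l, (X.app (Y.app (coordSF x₀ hU l)) •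
      frame x₀ hU l).app (coordSF x₀ hU m) := by
    simp only [app_smul]
    have : ∀ l, (frame (V := V) x₀ hU l).app (coordSF x₀ hU m) = if l = m then 1 else 0 :=
      fun l => frame_coordSF hU l m le_rfl
    simp [this]
  rw [h1]
  conv_lhs => rw [superDer_eq_sum hU Y]
  rw [map_sum, app_sum, ← Finset.sum_add_distrib]
  refine Finset.sum_congr rfl fun l _ => ?_
  rw [D.leibniz U 0 _ _ _ _ hX (hasParity_even_app_coordSF hU hY l), zero_mul, sgn_zero, one_smul,
    app_add, app_smul (Y.app _), connection_smul_left_sum D hU X, app_sum, Finset.mul_sum]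
  rfl

theorem fderiv_hat {x₀ : M} {U : Opens M} (hU : U ≤ coordDomain B F V x₀)
    (Y : superDer B F V U) {y : B × F} (hy : y.1 ∈ chartImage x₀ U) (v : B × F) :
    fderiv ℝ (hat x₀ hU Y) y v =
      ∑ m, fderiv ℝ (fun y : B × F => aff y.2 (rep x₀ (Y.app (coordSF x₀ hU m)) y.1)) y v •
        prodBasis B F m := by
  have hd : ∀ m, DifferentiableAt ℝ
      (fun y : B × F => aff y.2 (rep x₀ (Y.app (coordSF x₀ hU m)) y.1)) y := fun m =>
    ((contDiffOn_aff (contDiffOn_rep hU _)).contDiffAt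
      ((isOpen_chartImage_prod x₀ U).mem_nhds ⟨hy, Set.mem_univ _⟩)).differentiableAt (by simp)
  have h1 : HasFDerivAt (hat x₀ hU Y) (∑ m, (fderiv ℝ (fun y : B × F =>
      aff y.2 (rep x₀ (Y.app (coordSF x₀ hU m)) y.1)) y).smulRight (prodBasis B F m)) y :=
    HasFDerivAt.fun_sum fun m _ => (hd m).hasFDerivAt.smul_const (prodBasis B F m)
  rw [h1.fderiv, sum_apply]
  rfl

/-- Taking affine parts in `connection_app`: X(Y^m) becomes the derivative of a component of the
field of Y by `aff_rep_der`, and the products Y^l X^k Γ become values of `triForm`. -/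
theorem hat_connection (D : SuperConnection B F V) {x₀ : M} {U : Opens M}
    (hU : U ≤ coordDomain B F V x₀) {X Y : superDer B F V U} (hX : DerHasParity 0 X)
    (hY : DerHasParity 0 Y) {y : B × F} (hy : y.1 ∈ chartImage x₀ U) :
    hat x₀ hU (D.toFun U X Y) y = fderiv ℝ (hat x₀ hU Y) y (hat x₀ hU X y) +
      localChris x₀ D y (hat x₀ hU X y) (hat x₀ hU Y y) := by
  rw [fderiv_hat hU Y hy, localChris_apply, ← Finset.sum_add_distrib, hat]
  refine Finset.sum_congr rfl fun m _ => ?_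
  rw [connection_app D hU hX hY, rep_add, aff_add, ← aff_rep_der hU hX le_rfl _ hy, ← add_smul]
  congr 2
  rw [rep_sum, aff_sum, Finset.sum_comm]
  refine Finset.sum_congr rfl fun l _ => ?_
  rw [rep_sum, aff_sum]
  refine Finset.sum_congr rfl fun k _ => ?_
  rw [rep_mul, rep_mul, rep_chris D hU k l m hy, triForm_swap]
  exact aff_mul_mul_eq_triForm
    ((hasParity_iff_rep hU).1 (hasParity_even_app_coordSF hU hY l) _ hy)
    ((hasParity_iff_rep hU).1 (hasParity_even_app_coordSF hU hX k) _ hy) _ _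
    (prodCoord_hat hU Y y l) (prodCoord_hat hU X y k)

/-- The bracket of two coordinate derivations kills the coordinates, since each derivation maps a
coordinate to 0 or 1. -/
theorem chris_symm {D : SuperConnection B F V} (hD : D.IsTorsionFree) (x₀ : M)
    (k l m : FrameIdx B F) (z : B) :
    chris x₀ D k l m z = sgn (idxParity k * idxParity l) • chris x₀ D l k m z := by
  have h := hD (coordDomain B F V x₀) _ _ _ _ (frame_parity le_rfl k) (frame_parity le_rfl l)
  have h1 := congrFun h ⟨_, le_rfl⟩
  have h2 := DFunLike.congr_fun h1 (coordSF x₀ le_rfl m)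
  have h3 : ∀ i j : FrameIdx B F, (frame (V := V) x₀ le_rfl i).1 ⟨_, le_rfl⟩
      ((frame (V := V) x₀ le_rfl j).1 ⟨_, le_rfl⟩ (coordSF x₀ le_rfl m)) = 0 := fun i j => by
    rw [frame_coordSF le_rfl j m le_rfl]
    split_ifs
    · have := der_algebraMap (frame_parity (V := V) (x₀ := x₀) le_rfl i) le_rfl 1
      rwa [map_one] at this
    · exact map_zero _
  have h4 : superBracket (idxParity k) (idxParity l) (frame (V := V) x₀ le_rfl k)
      (frame x₀ le_rfl l) ⟨_, le_rfl⟩ (coordSF x₀ le_rfl m) = 0 := by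
    simp only [superBracket, LinearMap.sub_apply, LinearMap.smul_apply, LinearMap.comp_apply, h3,
      smul_zero, sub_zero]
  rw [h4] at h2
  have h5 := sub_eq_zero.1 h2
  rw [chris, chris, ← rep_smul]
  exact congrArg (fun f => rep x₀ f z) h5

theorem localChris_symm {D : SuperConnection B F V} (hD : D.IsTorsionFree) (x₀ : M)
    (y v w : B × F) : localChris x₀ D y v w = localChris x₀ D y w v := by
  rw [localChris_apply, localChris_apply]
  refine Finset.sum_congr rfl fun m _ => ?_
  rw [Finset.sum_comm]
  congr 1
  refine Finset.sum_congr rfl fun k _ => Finset.sum_congr rfl fun l _ => ?_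
  rw [triForm_swap, chris_symm hD, mul_comm, triForm_sgn_smul]

/-- The affine part of X(g(Y, Z)) is computed twice: by the product rule for the local form, and by
compatibility followed by `hat_connection`. -/
theorem fderiv_localForm_hat {g : OddRiemannianMetric B F V} {D : SuperConnection B F V}
    (hD : D.IsCompatible g) {x₀ : M} {U : Opens M} (hU : U ≤ coordDomain B F V x₀)
    {X Y Z : superDer B F V U} (hX : DerHasParity 0 X) (hY : DerHasParity 0 Y)
    (hZ : DerHasParity 0 Z) {y : B × F} (hy : y.1 ∈ chartImage x₀ U) :
    fderiv ℝ (localForm x₀ g) y (hat x₀ hU X y) (hat x₀ hU Y y) (hat x₀ hU Z y) =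
      localForm x₀ g y (localChris x₀ D y (hat x₀ hU X y) (hat x₀ hU Y y)) (hat x₀ hU Z y) +
      localForm x₀ g y (hat x₀ hU Y y) (localChris x₀ D y (hat x₀ hU X y) (hat x₀ hU Z y)) := by
  have hn : chartImage x₀ U ×ˢ Set.univ ∈ nhds y :=
    (isOpen_chartImage_prod x₀ U).mem_nhds ⟨hy, Set.mem_univ _⟩
  have hn' : chartImage x₀ (coordDomain B F V x₀) ×ˢ Set.univ ∈ nhds y :=
    (isOpen_chartImage_prod x₀ _).mem_nhds ⟨chartImage_mono hU hy, Set.mem_univ _⟩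
  have h := hD U 0 0 0 X Y Z hX hY hZ
  rw [mul_zero, sgn_zero, one_smul, one_smul] at h
  have h1 := aff_rep_der hU hX le_rfl (g.toFun U Y Z) hy
  have h2 : (fun y : B × F => aff y.2 (rep x₀ (g.toFun U Y Z) y.1)) =ᶠ[nhds y]
      fun y => localForm x₀ g y (hat x₀ hU Y y) (hat x₀ hU Z y) := by
    filter_upwards [hn] with y' hy'
    exact aff_rep_metric g hU hY hZ hy'.1
  have h3 : X.1 ⟨U, le_rfl⟩ (g.toFun U Y Z) = X.app (g.toFun U Y Z) := rfl
  have hDY := D.even U 0 0 X Y hX hY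
  have hDZ := D.even U 0 0 X Z hX hZ
  rw [zero_add] at hDY hDZ
  have hGd : DifferentiableAt ℝ (localForm x₀ g) y :=
    ((contDiffOn_localForm x₀ g).contDiffAt hn').differentiableAt (by simp)
  have hYd : DifferentiableAt ℝ (hat x₀ hU Y) y :=
    ((contDiffOn_hat hU Y).contDiffAt hn).differentiableAt (by simp)
  have hZd : DifferentiableAt ℝ (hat x₀ hU Z) y :=
    ((contDiffOn_hat hU Z).contDiffAt hn).differentiableAt (by simp)
  rw [h3, h, rep_add, aff_add, aff_rep_metric g hU hDY hZ hy, aff_rep_metric g hU hY hDZ hy,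
    hat_connection D hU hX hY hy, hat_connection D hU hX hZ hy, h2.fderiv_eq,
    fderiv_clm_apply (hGd.clm_apply hYd) hZd, fderiv_clm_apply hGd hYd] at h1
  simp only [add_apply, ContinuousLinearMap.comp_apply, ContinuousLinearMap.flip_apply,
    map_add] at h1
  -- The terms containing derivatives of the fields of Y and Z occur in both computations and
  -- cancel.
  linarith

end CoordinateFields

/-! ### Enough elements of L₀: constant horizontal and linear vertical fields -/

section LinearFields

variable {B : Type*} [NormedAddCommGroup B] [NormedSpace ℝ B] [FiniteDimensional ℝ B]
  {F : Type*} [NormedAddCommGroup F] [NormedSpace ℝ F] [FiniteDimensional ℝ F]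

/-- The projection of `Λ F^*` to the components of degree at most one. -/
def affProj : ModelAlg F →ₗ[ℝ] ModelAlg F :=
  Algebra.linearMap ℝ (ModelAlg F) ∘ₗ body.toLinearMap + ExteriorAlgebra.ι ℝ ∘ₗ lin

theorem affProj_apply (a : ModelAlg F) :
    affProj a = algebraMap ℝ _ (body a) + ExteriorAlgebra.ι ℝ (lin a) := rfl

/-- The fixed space of a constant linear projection is stable under differentiation. -/
theorem affProj_frameDeriv_inl (i : Fin (Module.finrank ℝ B)) {s : B → ModelAlg F} {z : B}
    (hs : DifferentiableAt ℝ s z) (h : ∀ᶠ y in nhds z, affProj (s y) = s y) :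
    affProj (frameDeriv (.inl i) s z) = frameDeriv (.inl i) s z := by
  have h2 : (fun y => affProj (s y)) =ᶠ[nhds z] s := h
  rw [← frameDeriv_linearMap_inl i hs affProj, h2.fderiv_eq]
  rfl

theorem frameDeriv_inr_of_affProj (a : Fin (Module.finrank ℝ F)) {s : B → ModelAlg F} {z : B}
    (h : affProj (s z) = s z) :
    (frameDeriv (.inr a) s z : ModelAlg F) =
      algebraMap ℝ _ (lin (s z) (Module.finBasis ℝ F a)) := by
  change contract (Module.Dual.eval ℝ F (Module.finBasis ℝ F a)) (s z) = _
  conv_lhs => rw [← h]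
  rw [affProj_apply, map_add, contract_algebraMap, contract_ι, zero_add]
  rfl

/-- The coefficients of the vector field on `B × F` with value `(w, A ξ)` at `(z, ξ)`. -/
def linCoef (w : B) (A : F →ₗ[ℝ] F) : FrameIdx B F → ModelAlg F :=
  Sum.elim (fun i => algebraMap ℝ _ ((Module.finBasis ℝ B).coord i w))
    (fun a => ExteriorAlgebra.ι ℝ ((Module.finBasis ℝ F).coord a ∘ₗ A))

theorem linCoef_mem_evenOdd (w : B) (A : F →ₗ[ℝ] F) (k : FrameIdx B F) :
    linCoef w A k ∈
      CliffordAlgebra.evenOdd (0 : QuadraticForm ℝ (Module.Dual ℝ F)) (idxParity k) := by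
  rcases k with i | a
  · rw [mem_evenOdd_iff]
    simp [linCoef, idxParity, sgn_zero]
  · exact CliffordAlgebra.ι_mem_evenOdd_one _ _

theorem aff_linCoef (w : B) (A : F →ₗ[ℝ] F) (k : FrameIdx B F) (ξ : F) :
    aff ξ (linCoef w A k) = prodCoord k (w, A ξ) := by
  rcases k with i | a
  · simp only [linCoef, Sum.elim_inl, aff_apply, lin_algebraMap]
    simp [prodCoord, prodBasis]
  · simp only [linCoef, Sum.elim_inr, aff_apply, lin_ι, body_ι]
    simp [prodCoord, prodBasis]

/-- Even coefficients are real numbers. Odd ones have degree one, but they multiply the contraction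
of an affine element, which is a scalar; the degree never exceeds one. -/
theorem affProj_linCoef_mul (w : B) (A : F →ₗ[ℝ] F) (k : FrameIdx B F) {s : B → ModelAlg F}
    {z : B} (hs : DifferentiableAt ℝ s z) (h : ∀ᶠ y in nhds z, affProj (s y) = s y) :
    affProj (linCoef w A k * frameDeriv k s z) = linCoef w A k * frameDeriv k s z := by
  rcases k with i | a
  · simp only [linCoef, Sum.elim_inl]
    rw [← Algebra.smul_def, map_smul, affProj_frameDeriv_inl i hs h]
  · simp only [linCoef, Sum.elim_inr]
    rw [frameDeriv_inr_of_affProj a h.self_of_nhds, ← Algebra.commutes, ← Algebra.smul_def,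
      map_smul, affProj_apply, body_ι, lin_ι, map_zero, zero_add]

/-- At ξ = 0 every linear vertical field vanishes, so for positive rank these fields miss the
vertical directions exactly on the zero section. -/
theorem exists_linearMap_apply_eq {ξ : F} (h : ξ ≠ 0 ∨ Subsingleton F) (β : F) :
    ∃ A : F →ₗ[ℝ] F, A ξ = β := by
  rcases h with h | h
  · obtain ⟨f, hf⟩ := SeparatingDual.exists_eq_one (R := ℝ) h
    exact ⟨(f.smulRight β : F →L[ℝ] F), by simp [hf]⟩
  · exact ⟨0, Subsingleton.elim _ _⟩

variable {M : Type*} [TopologicalSpace M] [ChartedSpace B M]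
  {V : M → Type*} [TopologicalSpace (TotalSpace F V)]
  [∀ x, AddCommGroup (V x)] [∀ x, Module ℝ (V x)] [∀ x, TopologicalSpace (V x)]
  [FiberBundle F V] [VectorBundle ℝ F V]
  [IsManifold 𝓘(ℝ, B) ∞ M] [ContMDiffVectorBundle ∞ F V 𝓘(ℝ, B)]

theorem derHasParity_sum {U : Opens M} {p : ZMod 2} {ι : Type*} (s : Finset ι)
    {X : ι → superDer B F V U} (h : ∀ i, DerHasParity p (X i)) :
    DerHasParity p (∑ i ∈ s, X i) :=
  Finset.sum_induction X (DerHasParity p) (fun _ _ ha hb => (derOfParity B F V U p).add_mem ha hb)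
    (derOfParity B F V U p).zero_mem fun i _ => h i

theorem derHasParity_smul {U : Opens M} {p q : ZMod 2} {f : superFun B F V U}
    (hf : HasParity q f) {X : superDer B F V U} (hX : DerHasParity p X) :
    DerHasParity (q + p) (f • X) := mulOp_mem_derOfParity hf hX

/-- The superderivation which is represented by the vector field `(z, ξ) ↦ (w, A ξ)`. -/
def linField (x₀ : M) {U : Opens M} (hU : U ≤ coordDomain B F V x₀) (w : B) (A : F →ₗ[ℝ] F) :
    superDer B F V U := ∑ k, constSF x₀ hU (linCoef w A k) • frame x₀ hU k

theorem rep_linField {x₀ : M} {U : Opens M} (hU : U ≤ coordDomain B F V x₀) (w : B)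
    (A : F →ₗ[ℝ] F) {W : Opens M} (hW : W ≤ U) (f : superFun B F V W) {z : B}
    (hz : z ∈ chartImage x₀ W) :
    rep x₀ ((linField x₀ hU w A).1 ⟨W, hW⟩ f) z = ∑ k, linCoef w A k * frameDeriv k (rep x₀ f) z := by
  have h1 : (linField x₀ hU w A).1 ⟨W, hW⟩ f =
      ∑ k, constSF x₀ (hW.trans hU) (linCoef w A k) * (frame x₀ hU k).1 ⟨W, hW⟩ f :=
    map_sum (evalDer hW f) _ _
  rw [h1, rep_sum]
  refine Finset.sum_congr rfl fun k _ => ?_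
  rw [rep_mul, rep_constSF _ _ hz, rep_frame hU k hW f hz]

theorem isEvenAffineDer_linField {x₀ : M} {U : Opens M} (hU : U ≤ coordDomain B F V x₀) (w : B)
    (A : F →ₗ[ℝ] F) : IsEvenAffineDer (linField (V := V) x₀ hU w A) := by
  refine ⟨derHasParity_sum _ fun k => ?_, fun W hW f hf => ?_⟩
  · have h1 : HasParity (idxParity k) (constSF (V := V) x₀ hU (linCoef w A k)) :=
      (hasParity_iff_rep hU).2 fun z hz => by
        rw [rep_constSF _ _ hz]; exact linCoef_mem_evenOdd w A k
    have h2 := derHasParity_smul h1 (frame_parity hU k)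
    have h3 : ∀ p : ZMod 2, p + p = 0 := by decide
    rwa [h3] at h2
  · rw [isAffine_iff_rep (hW.trans hU)] at hf ⊢
    intro z hz
    rw [rep_linField hU w A hW f hz, ← affProj_apply, map_sum]
    refine Finset.sum_congr rfl fun k _ => ?_
    refine affProj_linCoef_mul w A k (differentiableAt_rep (hW.trans hU) f hz) ?_
    filter_upwards [(isOpen_chartImage x₀ W).mem_nhds hz] with y hy
    exact hf y hy

theorem hat_linField {x₀ : M} {U : Opens M} (hU : U ≤ coordDomain B F V x₀) (w : B)
    (A : F →ₗ[ℝ] F) {y : B × F} (hy : y.1 ∈ chartImage x₀ U) :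
    hat x₀ hU (linField x₀ hU w A) y = (w, A y.2) := by
  rw [← sum_prodCoord (w, A y.2), hat]
  refine Finset.sum_congr rfl fun k _ => ?_
  have h1 : rep x₀ ((linField x₀ hU w A).app (coordSF x₀ hU k)) y.1 = linCoef w A k := by
    change rep x₀ ((linField x₀ hU w A).1 ⟨U, le_rfl⟩ (coordSF x₀ hU k)) y.1 = _
    rw [rep_linField hU w A le_rfl _ hy]
    have : ∀ l, frameDeriv l (rep x₀ (coordSF (V := V) x₀ hU k)) y.1 =
        if l = k then (1 : ModelAlg F) else 0 := fun l => by
      rw [frameDeriv_congr (rep_coordSF_eventuallyEq hU k hy), frameDeriv_coordFun]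
    simp [this]
  rw [h1, aff_linCoef]

theorem exists_hat_eq {x₀ : M} {U : Opens M} (hU : U ≤ coordDomain B F V x₀) {y : B × F}
    (hy : y.1 ∈ chartImage x₀ U) (h : y.2 ≠ 0 ∨ Subsingleton F) (v : B × F) :
    ∃ X : superDer B F V U, IsEvenAffineDer X ∧ hat x₀ hU X y = v := by
  obtain ⟨A, hA⟩ := exists_linearMap_apply_eq h v.2
  exact ⟨linField x₀ hU v.1 A, isEvenAffineDer_linField hU _ _, by rw [hat_linField hU _ _ hy, hA]⟩

/-- In positive dimension a point of F is not isolated; in dimension zero the second alternative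
makes the set everything. -/
theorem dense_ne_zero_or_subsingleton : Dense {y : B × F | y.2 ≠ 0 ∨ Subsingleton F} := by
  rcases subsingleton_or_nontrivial F with h | h
  · have : {y : B × F | y.2 ≠ 0 ∨ Subsingleton F} = Set.univ :=
      Set.eq_univ_of_forall fun y => Or.inr h
    rw [this]
    exact dense_univ
  · have h1 : Dense ({0}ᶜ : Set F) := by
      have := Module.punctured_nhds_neBot ℝ F 0
      exact dense_compl_singleton 0
    have h2 : Dense ((Set.univ : Set B) ×ˢ ({0}ᶜ : Set F)) := dense_univ.prod h1
    exact h2.mono fun y hy => Or.inl hy.2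

/-- The bilinear form and the Christoffel tensor induced by a Levi-Civita connection are
compatible. -/
theorem fderiv_localForm {g : OddRiemannianMetric B F V} {D : SuperConnection B F V}
    (hD : D.IsCompatible g) {x₀ : M} {y : B × F}
    (hy : y.1 ∈ chartImage x₀ (coordDomain B F V x₀)) (u v w : B × F) :
    fderiv ℝ (localForm x₀ g) y u v w = localForm x₀ g y (localChris x₀ D y u v) w +
      localForm x₀ g y v (localChris x₀ D y u w) := by
  have hn : chartImage x₀ (coordDomain B F V x₀) ×ˢ Set.univ ∈ nhds y :=
    (isOpen_chartImage_prod x₀ _).mem_nhds ⟨hy, Set.mem_univ _⟩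
  have h1 : ContinuousAt (fun y => fderiv ℝ (localForm x₀ g) y u v w) y := by
    have := ((contDiffOn_localForm x₀ g).contDiffAt hn).fderiv_right (m := 0) (by simp)
    exact ((this.continuousAt.clm_apply continuousAt_const).clm_apply
      continuousAt_const).clm_apply continuousAt_const
  have hG := ((contDiffOn_localForm x₀ g).contDiffAt hn).continuousAt
  have hC := ((contDiffOn_localChris x₀ D).contDiffAt hn).continuousAt
  have h2 : ContinuousAt (fun y => localForm x₀ g y (localChris x₀ D y u v) w +
      localForm x₀ g y v (localChris x₀ D y u w)) y :=
    ((hG.clm_apply ((hC.clm_apply continuousAt_const).clm_apply continuousAt_const)).clm_apply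
      continuousAt_const).add ((hG.clm_apply continuousAt_const).clm_apply
      ((hC.clm_apply continuousAt_const).clm_apply continuousAt_const))
  -- Off the zero section u, v, w are values of fields from L₀, so `fderiv_localForm_hat` applies;
  -- both sides are continuous, and density gives the rest.
  have h3 := mem_closure_iff_nhdsWithin_neBot.1 (dense_ne_zero_or_subsingleton (B := B) (F := F) y)
  refine tendsto_nhds_unique_of_eventuallyEq (h1.mono_left (nhdsWithin_le_nhds
    (s := {y : B × F | y.2 ≠ 0 ∨ Subsingleton F})))
    (h2.mono_left nhdsWithin_le_nhds) ?_
  filter_upwards [self_mem_nhdsWithin, nhdsWithin_le_nhds hn] with y' hy' hn'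
  obtain ⟨X, hX, rfl⟩ := exists_hat_eq (V := V) le_rfl hn'.1 hy' u
  obtain ⟨Y, hY, rfl⟩ := exists_hat_eq (V := V) le_rfl hn'.1 hy' v
  obtain ⟨Z, hZ, rfl⟩ := exists_hat_eq (V := V) le_rfl hn'.1 hy' w
  exact fderiv_localForm_hat hD le_rfl hX.1 hY.1 hZ.1 hn'.1

end LinearFields

/-! ### Non-degeneracy of the induced form -/

section Nondegeneracy

variable {B : Type*} [NormedAddCommGroup B] [NormedSpace ℝ B] [FiniteDimensional ℝ B]
  {F : Type*} [NormedAddCommGroup F] [NormedSpace ℝ F] [FiniteDimensional ℝ F]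
  {M : Type*} [TopologicalSpace M] [ChartedSpace B M]
  {V : M → Type*} [TopologicalSpace (TotalSpace F V)]
  [∀ x, AddCommGroup (V x)] [∀ x, Module ℝ (V x)] [∀ x, TopologicalSpace (V x)]
  [FiberBundle F V] [VectorBundle ℝ F V]

/-- The map `f ↦ (-1)^{p|f|} f`. -/
def twist {U : Opens M} (p : ZMod 2) : superFun B F V U →ₗ[ℝ] superFun B F V U where
  toFun f := parityPart 1 f + sgn p • parityPart (-1) f
  map_add' f g := by
    apply Subtype.ext
    funext x
    change (2⁻¹ : ℝ) • (f.1 x + g.1 x + (1 : ℝ) • CliffordAlgebra.involute (f.1 x + g.1 x)) +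
      sgn p • (2⁻¹ : ℝ) • (f.1 x + g.1 x + (-1 : ℝ) • CliffordAlgebra.involute (f.1 x + g.1 x)) =
      ((2⁻¹ : ℝ) • (f.1 x + (1 : ℝ) • CliffordAlgebra.involute (f.1 x)) +
      sgn p • (2⁻¹ : ℝ) • (f.1 x + (-1 : ℝ) • CliffordAlgebra.involute (f.1 x))) +
      ((2⁻¹ : ℝ) • (g.1 x + (1 : ℝ) • CliffordAlgebra.involute (g.1 x)) +
      sgn p • (2⁻¹ : ℝ) • (g.1 x + (-1 : ℝ) • CliffordAlgebra.involute (g.1 x)))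
    rw [map_add]
    module
  map_smul' c f := by
    apply Subtype.ext
    funext x
    change (2⁻¹ : ℝ) • (c • f.1 x + (1 : ℝ) • CliffordAlgebra.involute (c • f.1 x)) +
      sgn p • (2⁻¹ : ℝ) • (c • f.1 x + (-1 : ℝ) • CliffordAlgebra.involute (c • f.1 x)) =
      c • ((2⁻¹ : ℝ) • (f.1 x + (1 : ℝ) • CliffordAlgebra.involute (f.1 x)) +
      sgn p • (2⁻¹ : ℝ) • (f.1 x + (-1 : ℝ) • CliffordAlgebra.involute (f.1 x)))
    rw [map_smul]
    module

theorem twist_val {U : Opens M} (p : ZMod 2) (f : superFun B F V U) (x : U) :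
    (twist p f).1 x = if p = 0 then f.1 x else CliffordAlgebra.involute (f.1 x) := by
  change (2⁻¹ : ℝ) • (f.1 x + (1 : ℝ) • CliffordAlgebra.involute (f.1 x)) +
      sgn p • (2⁻¹ : ℝ) • (f.1 x + (-1 : ℝ) • CliffordAlgebra.involute (f.1 x)) = _
  have h2 : ∀ r : ZMod 2, r = 0 ∨ r = 1 := by decide
  rcases h2 p with rfl | rfl
  · rw [sgn_zero, if_pos rfl]; module
  · rw [sgn_one, if_neg (by decide)]; module

theorem twist_of_hasParity {U : Opens M} (p : ZMod 2) {q : ZMod 2} {f : superFun B F V U}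
    (hf : HasParity q f) : twist p f = sgn (p * q) • f := by
  apply Subtype.ext
  funext x
  rw [twist_val]
  change _ = sgn (p * q) • f.1 x
  have h2 : ∀ r : ZMod 2, r = 0 ∨ r = 1 := by decide
  rcases h2 p with rfl | rfl
  · rw [zero_mul, sgn_zero, if_pos rfl, one_smul]
  · rw [one_mul, if_neg (by decide), mem_evenOdd_iff.1 (hf x)]

theorem twist_mul {U : Opens M} (p : ZMod 2) (f h : superFun B F V U) :
    twist p (f * h) = twist p f * twist p h := by
  apply Subtype.ext
  funext x
  change (twist p (f * h)).1 x = (twist p f).1 x * (twist p h).1 x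
  rw [twist_val, twist_val, twist_val]
  change (if p = 0 then f.1 x * h.1 x else CliffordAlgebra.involute (f.1 x * h.1 x)) = _
  split_ifs
  · rfl
  · rw [map_mul]

theorem res_twist {U W : Opens M} (h : W ≤ U) (p : ZMod 2) (f : superFun B F V U) :
    res h (twist p f) = twist p (res h f) := rfl

theorem hasParity_twist {U : Opens M} (p : ZMod 2) {q : ZMod 2} {f : superFun B F V U}
    (hf : HasParity q f) : HasParity q (twist p f) := by
  rw [twist_of_hasParity p hf]
  exact fun x => Submodule.smul_mem _ _ (hf x)

variable [IsManifold 𝓘(ℝ, B) ∞ M] [ContMDiffVectorBundle ∞ F V 𝓘(ℝ, B)]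

/-- The differentials of the coordinates. -/
def coordForm (x₀ : M) (m : FrameIdx B F) :
    SuperOneForm B F V (coordDomain B F V x₀) (idxParity m) where
  -- The map X ↦ X(x^m) is left linear without signs; the twist introduces the sign that a one-form
  -- of parity |m| must have.
  toFun W := twist (idxParity m) ∘ₗ evalDer le_rfl (coordSF x₀ W.2 m)
  res_apply W W' h X := by
    change res h (twist _ (X.app (coordSF x₀ W.2 m))) =
      twist _ ((resDer h X).app (coordSF x₀ W'.2 m))
    rw [res_twist, ← res_coordSF W.2 h, app_resDer]
  parity W q X hX := by
    rw [add_comm]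
    exact hasParity_twist _ (hasParity_app_coordSF W.2 hX m)
  smul W q f X hf := by
    change twist _ (f * X.app _) = sgn (idxParity m * q) • (f * twist _ (X.app _))
    rw [twist_mul, twist_of_hasParity _ hf, smul_mul_assoc]

/-- Non-degeneracy of g, applied to the differential of the m-th coordinate, produces the dual
vector field. -/
theorem exists_metric_dual_frame (g : OddRiemannianMetric B F V) (x₀ : M) (m : FrameIdx B F) :
    ∃ X : superDer B F V (coordDomain B F V x₀), DerHasParity (idxParity m + 1) X ∧
      ∀ l, g.toFun _ X (frame x₀ le_rfl l) = if l = m then 1 else 0 := by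
  -- The field dual to a form of parity |m| has parity |m| + 1. The form therefore has to be
  -- regarded as one of parity |m| + 1 + 1, and `h3` removes this cast again.
  have h1 : ∀ p : ZMod 2, p = p + 1 + 1 := by decide
  obtain ⟨X, ⟨hX, h⟩, -⟩ := g.nondegenerate _ (idxParity m + 1)
    ((h1 (idxParity m)) ▸ coordForm x₀ m)
  refine ⟨X, hX, fun l => ?_⟩
  have h2 := h ⟨_, le_rfl⟩ (frame x₀ le_rfl l)
  have h3 : ∀ (q : ZMod 2) (hq : idxParity m = q),
      (hq ▸ coordForm x₀ m : SuperOneForm B F V (coordDomain B F V x₀) q).toFun ⟨_, le_rfl⟩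
        (frame x₀ le_rfl l) = twist (idxParity m) ((frame x₀ le_rfl l).app
          (coordSF x₀ le_rfl m)) := by
    rintro q rfl; rfl
  rw [h3] at h2
  refine (h2.trans ?_)
  have h4 : (frame (V := V) x₀ le_rfl l).app (coordSF x₀ le_rfl m) = if l = m then 1 else 0 :=
    frame_coordSF le_rfl l m le_rfl
  rw [h4]
  split_ifs
  · have : HasParity 0 (1 : superFun B F V (coordDomain B F V x₀)) :=
      fun x => SetLike.one_mem_graded _
    rw [twist_of_hasParity _ this, mul_zero, sgn_zero, one_smul]
  · exact map_zero _

/-- The body of the matrix of an odd metric has trivial kernel. -/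
theorem eq_zero_of_sum_body_metricCoef (g : OddRiemannianMetric B F V) {x₀ : M} {z : B}
    (hz : z ∈ chartImage x₀ (coordDomain B F V x₀)) {v : FrameIdx B F → ℝ}
    (h : ∀ k, ∑ l, v l * body (metricCoef x₀ g k l z) = 0) (m : FrameIdx B F) : v m = 0 := by
  obtain ⟨X, hX, hXl⟩ := exists_metric_dual_frame g x₀ m
  -- Taking bodies is multiplicative, so the coefficients of the dual fields give a real left
  -- inverse of the matrix of bodies of g.
  have h1 : ∀ l, ∑ k, sgn (idxParity m + 1 + idxParity k) *
      (body (rep x₀ (X.app (coordSF x₀ le_rfl k)) z) * body (metricCoef x₀ g k l z)) =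
        if l = m then 1 else 0 := fun l => by
    have h2 := congrArg (fun f => body (rep x₀ f z)) (hXl l)
    change body (rep x₀ (g.toFun _ X (frame x₀ le_rfl l)) z) = _ at h2
    rw [metric_smul_left_sum g le_rfl hX, rep_sum, map_sum] at h2
    have h3 : body (rep x₀ (if l = m then (1 : superFun B F V (coordDomain B F V x₀)) else 0) z) =
        if l = m then 1 else 0 := by
      split_ifs
      · rw [rep_one hz, map_one]
      · exact (congrArg body (map_zero (repLin x₀ _ z))).trans (map_zero _)
    rw [h3] at h2
    rw [← h2]
    refine Finset.sum_congr rfl fun k _ => ?_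
    rw [rep_smul, map_smul, rep_mul, map_mul, smul_eq_mul]
    rfl
  -- The left inverse is applied to a vector in the kernel.
  calc v m = ∑ l, v l * (if l = m then 1 else 0) := by simp
    _ = ∑ l, v l * ∑ k, sgn (idxParity m + 1 + idxParity k) *
      (body (rep x₀ (X.app (coordSF x₀ le_rfl k)) z) * body (metricCoef x₀ g k l z)) := by
        simp only [h1]
    _ = ∑ k, sgn (idxParity m + 1 + idxParity k) *
      body (rep x₀ (X.app (coordSF x₀ le_rfl k)) z) *
        ∑ l, v l * body (metricCoef x₀ g k l z) := by
        simp only [Finset.mul_sum]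
        rw [Finset.sum_comm]
        refine Finset.sum_congr rfl fun k _ => Finset.sum_congr rfl fun l _ => ?_
        ring
    _ = 0 := by simp only [h, mul_zero, Finset.sum_const_zero]

theorem hasParity_metric_frame (g : OddRiemannianMetric B F V) (x₀ : M) (k l : FrameIdx B F)
    {z : B} (hz : z ∈ chartImage x₀ (coordDomain B F V x₀)) :
    metricCoef x₀ g k l z ∈ CliffordAlgebra.evenOdd (0 : QuadraticForm ℝ (Module.Dual ℝ F))
      (idxParity k + idxParity l + 1) :=
  (hasParity_iff_rep le_rfl).1 (g.odd _ _ _ _ _ (frame_parity le_rfl k) (frame_parity le_rfl l))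
    z hz

/-- As g is odd, its entries between coordinates of equal parity are odd and have no body. -/
theorem body_metricCoef_of_eq (g : OddRiemannianMetric B F V) (x₀ : M) {k l : FrameIdx B F}
    {z : B} (hz : z ∈ chartImage x₀ (coordDomain B F V x₀))
    (h : (idxParity k : ZMod 2) = idxParity l) : body (metricCoef x₀ g k l z) = 0 := by
  refine body_eq_zero_of_odd ?_
  have h1 := hasParity_metric_frame g x₀ k l hz
  have h3 : ∀ p : ZMod 2, p + p = 0 := by decide
  rwa [h, h3, zero_add] at h1

/-- Vertical vectors are orthogonal to one another, so only the mixed block is seen; its entries are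
bodies and do not depend on ξ. -/
theorem localForm_prodBasis_inr (g : OddRiemannianMetric B F V) (x₀ : M) (y v : B × F)
    (a : Fin (Module.finrank ℝ F)) :
    localForm x₀ g y v (prodBasis B F (.inr a)) =
      -∑ i, prodCoord (.inl i) v * body (metricCoef x₀ g (.inr a) (.inl i) y.1) := by
  have h1 : ∀ l : FrameIdx B F, evenCoord l (prodBasis B F (.inr a)) = 0 := by
    rintro (i | b)
    · exact (prodCoord_prodBasis _ _).trans (if_neg (by simp))
    · rfl
  have h2 : ∀ l : FrameIdx B F, oddCoord l (prodBasis B F (.inr a)) =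
      if l = .inr a then 1 else 0 := by
    rintro (i | b)
    · simp [oddCoord]
    · exact prodCoord_prodBasis _ _
  rw [localForm_apply]
  simp only [triForm_apply, h1, h2, mul_zero, zero_add, mul_ite, mul_one, add_zero]
  simp only [Finset.sum_ite_eq', Finset.mem_univ, if_true, Fintype.sum_sum_type, evenCoord, Sum.elim_inl, Sum.elim_inr, zero_apply, mul_zero, Finset.sum_const_zero, add_zero,
    idxParity, sgn_zero, sgn_one]
  simp [mul_comm]

/-- The hypothesis `hv` removes the even-even block, the only one in which ξ occurs; what is left is
again a mixed block of bodies. -/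
theorem localForm_prodBasis_inl (g : OddRiemannianMetric B F V) (x₀ : M) (y : B × F)
    {v : B × F} (hv : ∀ i, prodCoord (.inl i) v = 0) (j : Fin (Module.finrank ℝ B)) :
    localForm x₀ g y v (prodBasis B F (.inl j)) =
      -∑ a, prodCoord (.inr a) v * body (metricCoef x₀ g (.inl j) (.inr a) y.1) := by
  have h1 : ∀ l : FrameIdx B F, oddCoord l (prodBasis B F (.inl j)) = 0 := by
    rintro (i | b)
    · rfl
    · exact (prodCoord_prodBasis _ _).trans (if_neg (by simp))
  have h2 : ∀ l : FrameIdx B F, evenCoord l (prodBasis B F (.inl j)) =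
      if l = .inl j then 1 else 0 := by
    rintro (i | b)
    · exact prodCoord_prodBasis _ _
    · simp [evenCoord]
  have h3 : ∀ l : FrameIdx B F, evenCoord l v = 0 := by
    rintro (i | b)
    · exact hv i
    · rfl
  rw [localForm_apply]
  simp only [triForm_apply, h1, h2, h3, mul_zero, zero_add, mul_ite, mul_one]
  simp only [Fintype.sum_sum_type, oddCoord, Sum.elim_inl, Sum.elim_inr, zero_apply, mul_zero,
    idxParity, sgn_zero, sgn_one]
  simp [mul_comm]

/-- The bilinear form induced by an odd metric is nondegenerate. -/
theorem localForm_nondegenerate (g : OddRiemannianMetric B F V) {x₀ : M} {y : B × F}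
    (hy : y.1 ∈ chartImage x₀ (coordDomain B F V x₀)) {v : B × F}
    (h : ∀ w, localForm x₀ g y v w = 0) : v = 0 := by
  -- Pairing with vertical vectors tests only the horizontal components of v. Padded by zero they
  -- lie in the kernel of the matrix of bodies.
  have h1 : ∀ i, prodCoord (.inl i) v = 0 := by
    have := eq_zero_of_sum_body_metricCoef g hy
      (v := Sum.elim (fun i => prodCoord (.inl i) v) fun _ => 0) ?_
    · exact fun i => this (.inl i)
    · rintro (j | a)
      · rw [Fintype.sum_sum_type]
        simp only [Sum.elim_inl, Sum.elim_inr, zero_mul, Finset.sum_const_zero, add_zero]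
        refine Finset.sum_eq_zero fun i _ => ?_
        rw [body_metricCoef_of_eq g x₀ (k := .inl j) (l := .inl i) hy rfl, mul_zero]
      · have h2 := h (prodBasis B F (.inr a))
        rw [localForm_prodBasis_inr, neg_eq_zero] at h2
        rw [Fintype.sum_sum_type]
        simpa using h2
  -- With v known to be vertical, pairing with horizontal vectors tests its remaining components.
  have h2 : ∀ a, prodCoord (.inr a) v = 0 := by
    have := eq_zero_of_sum_body_metricCoef g hy
      (v := Sum.elim (fun _ => 0) fun a => prodCoord (.inr a) v) ?_
    · exact fun a => this (.inr a)
    · rintro (j | a)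
      · have h2 := h (prodBasis B F (.inl j))
        rw [localForm_prodBasis_inl g x₀ y h1, neg_eq_zero] at h2
        rw [Fintype.sum_sum_type]
        simpa using h2
      · rw [Fintype.sum_sum_type]
        simp only [Sum.elim_inl, Sum.elim_inr, zero_mul, Finset.sum_const_zero, zero_add]
        refine Finset.sum_eq_zero fun i _ => ?_
        rw [body_metricCoef_of_eq g x₀ (k := .inr a) (l := .inr i) hy rfl, mul_zero]
  rw [← sum_prodCoord v]
  refine Finset.sum_eq_zero fun k _ => ?_
  rcases k with i | a
  · rw [h1, zero_smul]
  · rw [h2, zero_smul]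

end Nondegeneracy

/-! ### Charts of the total space -/

section TotalCoordinates

variable {B : Type*} [NormedAddCommGroup B] [NormedSpace ℝ B] [FiniteDimensional ℝ B]
  {F : Type*} [NormedAddCommGroup F] [NormedSpace ℝ F] [FiniteDimensional ℝ F]
  {M : Type*} [TopologicalSpace M] [ChartedSpace B M]
  {V : M → Type*} [TopologicalSpace (TotalSpace F V)]
  [∀ x, AddCommGroup (V x)] [∀ x, Module ℝ (V x)] [∀ x, TopologicalSpace (V x)]
  [FiberBundle F V] [VectorBundle ℝ F V]

/-- The coordinates on the total space induced by the chart and the trivialization at `x₀`. -/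
def totalCoord (x₀ : M) (e : TotalSpace F V) : B × F :=
  (chartAt B x₀ e.proj, (trivializationAt F V x₀ e).2)

/-- The chart of the total space at p is built from the trivialization and the chart at the base
point of p, the same data as in the local representation of superfunctions. -/
theorem extChartAt_total (p e : TotalSpace F V) (he : e.proj ∈ coordDomain B F V p.proj) :
    extChartAt (𝓘(ℝ, B).prod 𝓘(ℝ, F)) p e = totalCoord p.proj e := by
  rw [FiberBundle.extChartAt]
  simp only [PartialEquiv.coe_trans, Function.comp_apply, PartialEquiv.prod_coe,
    PartialEquiv.refl_coe, id_eq, extChartAt, OpenPartialHomeomorph.extend_coe,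
    modelWithCornersSelf_coe]
  refine Prod.ext ?_ rfl
  exact congrArg (chartAt B p.proj) (Trivialization.coe_fst' _ he.2)

theorem mem_extChartAt_total_source {p e : TotalSpace F V} :
    e ∈ (extChartAt (𝓘(ℝ, B).prod 𝓘(ℝ, F)) p).source ↔ e.proj ∈ coordDomain B F V p.proj := by
  rw [FiberBundle.extChartAt]
  simp only [PartialEquiv.trans_source, PartialEquiv.prod_source, PartialEquiv.refl_source,
    Set.mem_inter_iff, Set.mem_preimage, extChartAt_source, Set.mem_prod, Set.mem_univ, and_true]
  change e ∈ (trivializationAt F V p.proj).source ∧ _ ↔ _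
  rw [Trivialization.mem_source]
  constructor
  · rintro ⟨h1, h2⟩
    refine ⟨?_, h1⟩
    have := Trivialization.coe_fst' (trivializationAt F V p.proj) h1
    exact this ▸ h2
  · rintro ⟨h1, h2⟩
    refine ⟨h2, ?_⟩
    have := Trivialization.coe_fst' (trivializationAt F V p.proj) h2
    exact this.symm ▸ h1

theorem extChartAt_total_target (p : TotalSpace F V) :
    (extChartAt (𝓘(ℝ, B).prod 𝓘(ℝ, F)) p).target =
      chartImage p.proj (coordDomain B F V p.proj) ×ˢ Set.univ := by
  rw [FiberBundle.extChartAt_target]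
  congr 1
  ext z
  simp only [chartImage, coordDomain, extChartAt, OpenPartialHomeomorph.extend, mfld_simps,
    Set.mem_inter_iff, Set.mem_preimage]
  constructor
  · rintro ⟨h1, h2⟩
    exact ⟨h1, (chartAt B p.proj).map_target h1, h2⟩
  · rintro ⟨h1, h2⟩
    exact ⟨h1, h2.2⟩

theorem fiberAffine_res [IsManifold 𝓘(ℝ, B) ∞ M] [ContMDiffVectorBundle ∞ F V 𝓘(ℝ, B)]
    {U W : Opens M} (h : W ≤ U) (f : superFun B F V U)
    {e : TotalSpace F V} (he : e.proj ∈ W) : fiberAffine (res h f) e = fiberAffine f e := by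
  rw [fiberAffine, fiberAffine, dif_pos he, dif_pos (h he)]
  rfl

/-- The trivialization acts on vectors and its inverse transpose on linear forms, so the pairing of
the linear part with the fibre vector is unchanged. -/
theorem fiberAffine_eq_aff [IsManifold 𝓘(ℝ, B) ∞ M] [ContMDiffVectorBundle ∞ F V 𝓘(ℝ, B)]
    {x₀ : M} {U : Opens M} (hU : U ≤ coordDomain B F V x₀)
    (f : superFun B F V U) {e : TotalSpace F V} (he : e.proj ∈ U) :
    fiberAffine f e = aff (totalCoord (B := B) x₀ e).2 (rep x₀ f (totalCoord (B := B) x₀ e).1) := by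
  rw [fiberAffine, dif_pos he, totalCoord, rep_chart hU f he, aff_apply, toModel, body_map, lin_map]
  congr 1
  change _ = lin (f.1 ⟨e.proj, he⟩) ((trivializationAt F V x₀).symmₗ ℝ e.proj _)
  congr 1
  have := (trivializationAt F V x₀).symmₗ_linearMapAt (R := ℝ) (hU he).2 e.snd
  rw [Trivialization.linearMapAt_apply, if_pos (hU he).2] at this
  exact this.symm

theorem totalCoord_fst_mem {x₀ : M} {U : Opens M} (hU : U ≤ coordDomain B F V x₀)
    {e : TotalSpace F V} (he : e.proj ∈ U) :
    (totalCoord (B := B) x₀ e).1 ∈ chartImage x₀ U := chart_mem_chartImage hU he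

end TotalCoordinates

/-! ### The correspondence between even superderivations and vector fields -/

section Transport

variable {B : Type*} [NormedAddCommGroup B] [NormedSpace ℝ B] [FiniteDimensional ℝ B]
  {F : Type*} [NormedAddCommGroup F] [NormedSpace ℝ F] [FiniteDimensional ℝ F]
  {M : Type*} [TopologicalSpace M] [ChartedSpace B M]
  {V : M → Type*} [TopologicalSpace (TotalSpace F V)]
  [∀ x, AddCommGroup (V x)] [∀ x, Module ℝ (V x)] [∀ x, TopologicalSpace (V x)]
  [FiberBundle F V] [VectorBundle ℝ F V]
  [IsManifold 𝓘(ℝ, B) ∞ M] [ContMDiffVectorBundle ∞ F V 𝓘(ℝ, B)]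

theorem derHasParity_resDer {U W : Opens M} (h : W ≤ U) {p : ZMod 2} {X : superDer B F V U}
    (hX : DerHasParity p X) : DerHasParity p (resDer h X) := restrict_mem h hX

theorem eventually_proj_mem {U : Opens M} {e : TotalSpace F V} (he : e.proj ∈ U) :
    ∀ᶠ e' in nhds e, e'.proj ∈ U :=
  (FiberBundle.continuous_proj F V).continuousAt.eventually (U.2.mem_nhds he)

/-- The derivative of the function on the total space defined by a superfunction. -/
theorem mvfderiv_fiberAffine {p e : TotalSpace F V} {U : Opens M}
    (hU : U ≤ coordDomain B F V p.proj) (he : e.proj ∈ U) (f : superFun B F V U)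
    (v : TotalTangent B F V e) :
    mvfderiv (𝓘(ℝ, B).prod 𝓘(ℝ, F)) (fiberAffine f) e v =
      fderiv ℝ (fun y : B × F => aff y.2 (rep p.proj f y.1)) (totalCoord p.proj e)
        (dchart (𝓘(ℝ, B).prod 𝓘(ℝ, F)) p e v) := by
  have hs : e ∈ (extChartAt (𝓘(ℝ, B).prod 𝓘(ℝ, F)) p).source :=
    mem_extChartAt_total_source.2 (hU he)
  rw [← extChartAt_total p e (hU he)]
  refine mvfderiv_eq_fderiv hs ?_ ?_ v
  · rw [extChartAt_total p e (hU he)]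
    exact ((contDiffOn_aff (contDiffOn_rep hU f)).contDiffAt ((isOpen_chartImage_prod _ U).mem_nhds
      ⟨totalCoord_fst_mem hU he, Set.mem_univ _⟩)).differentiableAt (by simp)
  · filter_upwards [eventually_proj_mem he] with e' he'
    rw [extChartAt_total p e' (hU he'), fiberAffine_eq_aff hU f he']

/-- The vector field on `B × F` which represents an even superderivation in the coordinates
at `p`. -/
def hatAt (p : TotalSpace F V) {U : Opens M} (Z : superDer B F V U) : B × F → B × F :=
  hat p.proj (U := U ⊓ coordDomain B F V p.proj) inf_le_right (resDer inf_le_left Z)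

/-- This is the existence of Ψ(Z): both sides are local, and in coordinates they agree by
`aff_rep_der`. -/
theorem isTransportAt_of_dchart {p e : TotalSpace F V} (hp : e.proj ∈ coordDomain B F V p.proj)
    {U : Opens M} {Z : superDer B F V U} (hZ : DerHasParity 0 Z) {v : TotalTangent B F V e}
    (hv : dchart (𝓘(ℝ, B).prod 𝓘(ℝ, F)) p e v = hatAt p Z (totalCoord p.proj e)) :
    IsTransportAt Z e v := by
  rintro ⟨W, hW⟩ f heW -
  have hWW : W ⊓ coordDomain B F V p.proj ≤ W := inf_le_left
  have hWd : W ⊓ coordDomain B F V p.proj ≤ coordDomain B F V p.proj := inf_le_right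
  have heW' : e.proj ∈ W ⊓ coordDomain B F V p.proj := ⟨heW, hp⟩
  have h1 : mvfderiv (𝓘(ℝ, B).prod 𝓘(ℝ, F)) (fiberAffine f) e =
      mvfderiv (𝓘(ℝ, B).prod 𝓘(ℝ, F)) (fiberAffine (res hWW f)) e := by
    have : fiberAffine f =ᶠ[nhds e] fiberAffine (res hWW f) := by
      filter_upwards [eventually_proj_mem heW'] with e' he'
      rw [fiberAffine_res hWW f he']
    simp only [mvfderiv, this.mfderiv_eq]
    rw [fiberAffine_res hWW f heW']
  rw [h1, mvfderiv_fiberAffine hWd heW', hv, ← fiberAffine_res hWW _ heW', superDer_res Z hW hWW,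
    fiberAffine_eq_aff hWd _ heW']
  exact (aff_rep_der (U := U ⊓ coordDomain B F V p.proj) inf_le_right
    (X := resDer inf_le_left Z) (derHasParity_resDer inf_le_left hZ)
    (inf_le_inf_right _ hW) (res hWW f) (totalCoord_fst_mem hWd heW')).symm

theorem isAffine_coordSF {x₀ : M} {U : Opens M} (hU : U ≤ coordDomain B F V x₀)
    (k : FrameIdx B F) : IsAffine (coordSF (V := V) x₀ hU k) := by
  refine (isAffine_iff_rep hU).2 fun z hz => ?_
  rw [rep_coordSF hU k hz]
  rcases k with i | a
  · simp [coordFun, lin_algebraMap]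
  · simp only [coordFun, Sum.elim_inr, body_ι, lin_ι, map_zero, zero_add]

theorem aff_coordFun (k : FrameIdx B F) (y : B × F) : aff y.2 (coordFun k y.1) = prodCoord k y := by
  rcases k with i | a
  · simp only [coordFun, Sum.elim_inl, aff_apply, lin_algebraMap]
    simp [prodCoord, prodBasis]
  · simp only [coordFun, Sum.elim_inr, aff_apply, lin_ι, body_ι]
    simp [prodCoord, prodBasis]

/-- This is the uniqueness of Ψ(Z): the coordinates of the total space are themselves functions of
affine superfunctions, so the transport condition prescribes every component of v. -/
theorem prodCoord_dchart_of_isTransportAt {p e : TotalSpace F V}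
    (hp : e.proj ∈ coordDomain B F V p.proj) {U : Opens M} (he : e.proj ∈ U)
    {Z : superDer B F V U} {v : TotalTangent B F V e} (hv : IsTransportAt Z e v)
    (k : FrameIdx B F) :
    prodCoord k (dchart (𝓘(ℝ, B).prod 𝓘(ℝ, F)) p e v) =
      fiberAffine (Z.1 ⟨U ⊓ coordDomain B F V p.proj, inf_le_left⟩
        (coordSF p.proj inf_le_right k)) e := by
  have hd : U ⊓ coordDomain B F V p.proj ≤ coordDomain B F V p.proj := inf_le_right
  have he' : e.proj ∈ U ⊓ coordDomain B F V p.proj := ⟨he, hp⟩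
  rw [← hv ⟨_, inf_le_left⟩ _ he' (isAffine_coordSF hd k), mvfderiv_fiberAffine hd he']
  have : (fun y : B × F => aff y.2 (rep p.proj (coordSF (V := V) p.proj hd k) y.1))
      =ᶠ[nhds (totalCoord p.proj e)] prodCoord k := by
    filter_upwards [(isOpen_chartImage_prod p.proj _).mem_nhds
      (⟨totalCoord_fst_mem hd he', Set.mem_univ _⟩ :
        totalCoord p.proj e ∈ chartImage p.proj _ ×ˢ Set.univ)] with y hy
    rw [rep_coordSF hd k hy.1, aff_coordFun]
  rw [this.fderiv_eq, ContinuousLinearMap.fderiv]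

theorem prodCoord_ext {v w : B × F} (h : ∀ k, prodCoord k v = prodCoord k w) : v = w :=
  (prodBasis B F).ext_elem h

/-- The coordinates of the vector field which corresponds to an even superderivation. -/
theorem dchart_transport {p e : TotalSpace F V} (hp : e.proj ∈ coordDomain B F V p.proj)
    {U : Opens M} (he : e.proj ∈ U) {Z : superDer B F V U} (hZ : DerHasParity 0 Z) :
    dchart (𝓘(ℝ, B).prod 𝓘(ℝ, F)) p e (transport Z e) = hatAt p Z (totalCoord p.proj e) := by
  have hs : e ∈ (extChartAt (𝓘(ℝ, B).prod 𝓘(ℝ, F)) p).source := mem_extChartAt_total_source.2 hp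
  -- The tangent vector with the expected components satisfies the transport condition. Hence the
  -- default value 0 in `transport` does not occur, and by uniqueness the chosen vector is this one.
  have h0 := dchart_symm hs (hatAt p Z (totalCoord p.proj e))
  have h1 := isTransportAt_of_dchart hp hZ h0
  have h2 : e.proj ∈ U ∧ ∃ v, IsTransportAt Z e v := ⟨he, _, h1⟩
  have h3 : IsTransportAt Z e (transport Z e) := by
    rw [transport, dif_pos h2]
    exact h2.2.choose_spec
  refine prodCoord_ext fun k => ?_
  rw [prodCoord_dchart_of_isTransportAt hp he h3, ← prodCoord_dchart_of_isTransportAt hp he h1, h0]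

theorem contDiffAt_hatAt {p : TotalSpace F V} {U : Opens M} (Z : superDer B F V U) {y : B × F}
    (hy : y.1 ∈ chartImage p.proj (U ⊓ coordDomain B F V p.proj)) :
    ContDiffAt ℝ ∞ (hatAt p Z) y :=
  (contDiffOn_hat _ _).contDiffAt ((isOpen_chartImage_prod _ _).mem_nhds ⟨hy, Set.mem_univ _⟩)

theorem eventually_dchart_transport {p e : TotalSpace F V}
    (hp : e.proj ∈ coordDomain B F V p.proj)
    {U : Opens M} (he : e.proj ∈ U) {Z : superDer B F V U} (hZ : DerHasParity 0 Z) :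
    ∀ᶠ e' in nhds e, dchart (𝓘(ℝ, B).prod 𝓘(ℝ, F)) p e' (transport Z e') =
      hatAt p Z (extChartAt (𝓘(ℝ, B).prod 𝓘(ℝ, F)) p e') := by
  filter_upwards [eventually_proj_mem hp, eventually_proj_mem he] with e' h1 h2
  rw [dchart_transport h1 h2 hZ, extChartAt_total p e' h1]

theorem smoothFieldAt_transport {e : TotalSpace F V} {U : Opens M} (he : e.proj ∈ U)
    {Z : superDer B F V U} (hZ : DerHasParity 0 Z) :
    SmoothFieldAt (I := 𝓘(ℝ, B).prod 𝓘(ℝ, F)) (transport Z) e := by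
  have hp := mem_coordDomain (B := B) (F := F) (V := V) e.proj
  refine smoothFieldAt_of_eventuallyEq (mem_extChartAt_source e) ?_
    (eventually_dchart_transport hp he hZ)
  rw [extChartAt_total e e hp]
  exact contDiffAt_hatAt Z (totalCoord_fst_mem inf_le_right ⟨he, hp⟩)

/-- The connection with the Christoffel tensor induced by `D` is induced by `D`. -/
theorem chartConn_transport {D : SuperConnection B F V} {p e : TotalSpace F V}
    (hp : e.proj ∈ coordDomain B F V p.proj) {U : Opens M} (he : e.proj ∈ U)
    {X Y : superDer B F V U} (hX : DerHasParity 0 X) (hY : DerHasParity 0 Y) :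
    chartConn (I := 𝓘(ℝ, B).prod 𝓘(ℝ, F)) p (localChris p.proj D) (transport Y) e
      (transport X e) = transport (D.toFun U X Y) e := by
  have hs : e ∈ (extChartAt (𝓘(ℝ, B).prod 𝓘(ℝ, F)) p).source := mem_extChartAt_total_source.2 hp
  have hD := D.even U 0 0 X Y hX hY
  rw [zero_add] at hD
  have hd : U ⊓ coordDomain B F V p.proj ≤ coordDomain B F V p.proj := inf_le_right
  apply dchart_injective hs
  rw [dchart_chartConn hs, (vrep_eventuallyEq hs (eventually_dchart_transport hp he hY)).fderiv_eq,
    dchart_transport hp he hX, dchart_transport hp he hY, dchart_transport hp he hD,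
    extChartAt_total p e hp]
  unfold hatAt
  rw [D.res_apply]
  exact (hat_connection D hd (derHasParity_resDer inf_le_left hX) (derHasParity_resDer inf_le_left hY)
    (totalCoord_fst_mem hd ⟨he, hp⟩)).symm

/-- The bilinear form with the components induced by `g` is induced by `g`. -/
theorem chartForm_transport {g : OddRiemannianMetric B F V} {p e : TotalSpace F V}
    (hp : e.proj ∈ coordDomain B F V p.proj) {U : Opens M} (he : e.proj ∈ U)
    {X Y : superDer B F V U} (hX : DerHasParity 0 X) (hY : DerHasParity 0 Y) :
    chartForm (I := 𝓘(ℝ, B).prod 𝓘(ℝ, F)) p (localForm p.proj g) e (transport X e)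
      (transport Y e) = fiberAffine (g.toFun U X Y) e := by
  have hd : U ⊓ coordDomain B F V p.proj ≤ coordDomain B F V p.proj := inf_le_right
  have he' : e.proj ∈ U ⊓ coordDomain B F V p.proj := ⟨he, hp⟩
  rw [chartForm_apply, dchart_transport hp he hX, dchart_transport hp he hY,
    extChartAt_total p e hp, ← fiberAffine_res inf_le_left _ he', g.res_apply,
    fiberAffine_eq_aff hd _ he']
  exact (aff_rep_metric g hd (derHasParity_resDer inf_le_left hX) (derHasParity_resDer inf_le_left hY)
    (totalCoord_fst_mem hd he')).symm

variable (B F V) in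
/-- The points at which the vector fields corresponding to elements of `L₀` span the tangent
space. -/
def spanningPoints : Set (TotalSpace F V) :=
  {e | ∃ U : Opens M, e.proj ∈ U ∧ ∀ v : TotalTangent B F V e,
    ∃ X : superDer B F V U, IsEvenAffineDer X ∧ transport X e = v}

theorem mem_spanningPoints {p e : TotalSpace F V} (hp : e.proj ∈ coordDomain B F V p.proj)
    (h : (totalCoord (B := B) p.proj e).2 ≠ 0 ∨ Subsingleton F) : e ∈ spanningPoints B F V := by
  have hs : e ∈ (extChartAt (𝓘(ℝ, B).prod 𝓘(ℝ, F)) p).source := mem_extChartAt_total_source.2 hp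
  refine ⟨coordDomain B F V p.proj, hp, fun v => ?_⟩
  obtain ⟨X, hX, hXv⟩ := exists_hat_eq (V := V) le_rfl (totalCoord_fst_mem le_rfl hp) h
    (dchart (𝓘(ℝ, B).prod 𝓘(ℝ, F)) p e v)
  refine ⟨X, hX, dchart_injective hs ?_⟩
  rw [dchart_transport hp hp hX.1, ← hXv, hatAt]
  exact hat_resDer le_rfl inf_le_left X (totalCoord_fst_mem inf_le_right ⟨hp, hp⟩)

/-- Density off the zero section holds in the chart at e, whose target is open, and is carried back
by the continuous inverse chart. -/
theorem mem_closure_spanningPoints (e : TotalSpace F V) : e ∈ closure (spanningPoints B F V) := by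
  have he := mem_extChartAt_source (I := 𝓘(ℝ, B).prod 𝓘(ℝ, F)) e
  have hz := (extChartAt (𝓘(ℝ, B).prod 𝓘(ℝ, F)) e).map_source he
  have h1 := (isOpen_extChartAt_target (I := 𝓘(ℝ, B).prod 𝓘(ℝ, F)) e).inter_closure
    ⟨hz, dense_ne_zero_or_subsingleton (B := B) (F := F) _⟩
  have h2 := (continuousAt_extChartAt_symm' (I := 𝓘(ℝ, B).prod 𝓘(ℝ, F)) he).continuousWithinAt
    |>.mem_closure_image h1
  rw [(extChartAt (𝓘(ℝ, B).prod 𝓘(ℝ, F)) e).left_inv he] at h2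
  refine closure_mono ?_ h2
  rintro _ ⟨y, ⟨hy1, hy2⟩, rfl⟩
  have h3 := mem_extChartAt_total_source.1
    ((extChartAt (𝓘(ℝ, B).prod 𝓘(ℝ, F)) e).map_target hy1)
  refine mem_spanningPoints h3 ?_
  rw [← extChartAt_total e _ h3, (extChartAt (𝓘(ℝ, B).prod 𝓘(ℝ, F)) e).right_inv hy1]
  exact hy2

end Transport

/-! ### Global form and connection: gluing, uniqueness, Levi-Civita property -/

section GlobalGeometry

variable {B : Type*} [NormedAddCommGroup B] [NormedSpace ℝ B] [FiniteDimensional ℝ B]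
  {F : Type*} [NormedAddCommGroup F] [NormedSpace ℝ F] [FiniteDimensional ℝ F]
  {M : Type*} [TopologicalSpace M] [ChartedSpace B M]
  {V : M → Type*} [TopologicalSpace (TotalSpace F V)]
  [∀ x, AddCommGroup (V x)] [∀ x, Module ℝ (V x)] [∀ x, TopologicalSpace (V x)]
  [FiberBundle F V] [VectorBundle ℝ F V]
  [IsManifold 𝓘(ℝ, B) ∞ M] [ContMDiffVectorBundle ∞ F V 𝓘(ℝ, B)]

theorem contDiffOn_localForm_target (g : OddRiemannianMetric B F V) (p : TotalSpace F V) :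
    ContDiffOn ℝ ∞ (localForm p.proj g) (extChartAt (𝓘(ℝ, B).prod 𝓘(ℝ, F)) p).target := by
  rw [extChartAt_total_target]
  exact contDiffOn_localForm p.proj g

theorem contDiffOn_localChris_target (D : SuperConnection B F V) (p : TotalSpace F V) :
    ContDiffOn ℝ ∞ (localChris p.proj D) (extChartAt (𝓘(ℝ, B).prod 𝓘(ℝ, F)) p).target := by
  rw [extChartAt_total_target]
  exact contDiffOn_localChris p.proj D

theorem eq_of_mem_spanningPoints {g : OddRiemannianMetric B F V} {e : TotalSpace F V}
    (he : e ∈ spanningPoints B F V)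
    {φ φ' : TotalTangent B F V e →L[ℝ] TotalTangent B F V e →L[ℝ] ℝ}
    (h : ∀ (U : Opens M) (X Y : superDer B F V U), IsEvenAffineDer X → IsEvenAffineDer Y →
      e.proj ∈ U → φ (transport X e) (transport Y e) = fiberAffine (g.toFun U X Y) e)
    (h' : ∀ (U : Opens M) (X Y : superDer B F V U), IsEvenAffineDer X → IsEvenAffineDer Y →
      e.proj ∈ U → φ' (transport X e) (transport Y e) = fiberAffine (g.toFun U X Y) e) :
    φ = φ' := by
  obtain ⟨U, heU, hU⟩ := he
  ext v w
  obtain ⟨X, hX, rfl⟩ := hU v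
  obtain ⟨Y, hY, rfl⟩ := hU w
  rw [h U X Y hX hY heU, h' U X Y hX hY heU]

theorem covariantDerivative_eq_of_mem_spanningPoints {D : SuperConnection B F V}
    {e : TotalSpace F V} (he : e ∈ spanningPoints B F V)
    {c c' : (∀ e : TotalSpace F V, TotalTangent B F V e) →
      ∀ e : TotalSpace F V, TotalTangent B F V e →L[ℝ] TotalTangent B F V e}
    (hc : IsCovariantDerivativeOn (B × F) c {e}) (hc' : IsCovariantDerivativeOn (B × F) c' {e})
    (h : ∀ (U : Opens M) (X Y : superDer B F V U), IsEvenAffineDer X → IsEvenAffineDer Y →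
      e.proj ∈ U → c (transport Y) e (transport X e) = transport (D.toFun U X Y) e)
    (h' : ∀ (U : Opens M) (X Y : superDer B F V U), IsEvenAffineDer X → IsEvenAffineDer Y →
      e.proj ∈ U → c' (transport Y) e (transport X e) = transport (D.toFun U X Y) e)
    (Y : ∀ e : TotalSpace F V, TotalTangent B F V e)
    (hY : DiffFieldAt (I := 𝓘(ℝ, B).prod 𝓘(ℝ, F)) Y e) : c Y e = c' Y e := by
  obtain ⟨U, heU, hU⟩ := he
  refine covariantDerivative_eq_of_span hc hc' (fun v w => ?_) Y hY
  obtain ⟨X, hX, rfl⟩ := hU v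
  obtain ⟨Z, hZ, rfl⟩ := hU w
  refine ⟨transport X, (smoothFieldAt_transport heU hX.1).mdifferentiableAt (by simp), rfl, ?_⟩
  rw [h U Z X hZ hX heU, h' U Z X hZ hX heU]

/-- Both local forms are induced by the same g, which determines them at spanning points; these
accumulate at e. No transformation law for the coefficients is needed. -/
theorem chartForm_localForm_eq (g : OddRiemannianMetric B F V) (p e : TotalSpace F V)
    (he : e ∈ (extChartAt (𝓘(ℝ, B).prod 𝓘(ℝ, F)) p).source) :
    chartForm (I := 𝓘(ℝ, B).prod 𝓘(ℝ, F)) p (localForm p.proj g) e =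
      chartForm (I := 𝓘(ℝ, B).prod 𝓘(ℝ, F)) e (localForm e.proj g) e := by
  have hs := mem_extChartAt_source (I := 𝓘(ℝ, B).prod 𝓘(ℝ, F)) e
  have hsm : ∀ q : TotalSpace F V, e ∈ (extChartAt (𝓘(ℝ, B).prod 𝓘(ℝ, F)) q).source →
      ContDiffAt ℝ ∞ (localForm q.proj g) (extChartAt (𝓘(ℝ, B).prod 𝓘(ℝ, F)) q e) :=
    fun q hq => (contDiffOn_localForm_target g q).contDiffAt
      ((isOpen_extChartAt_target q).mem_nhds ((extChartAt _ q).map_source hq))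
  refine form_eq_of_mem_closure (contMDiffAt_chartForm he (hsm p he))
    (contMDiffAt_chartForm hs (hsm e hs)) (mem_closure_spanningPoints (B := B) e) ?_
  filter_upwards [eventually_mem_source he, eventually_mem_source hs] with e' h1 h2 h3
  exact eq_of_mem_spanningPoints h3
    (fun U X Y hX hY hU => chartForm_transport (mem_extChartAt_total_source.1 h1) hU hX.1 hY.1)
    (fun U X Y hX hY hU => chartForm_transport (mem_extChartAt_total_source.1 h2) hU hX.1 hY.1)

variable [T2Space M]

/-- The same density argument for connections: at spanning points both are prescribed by D on fields
from L₀, which take all values there. -/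
theorem chartConn_localChris_eq (D : SuperConnection B F V) (p e : TotalSpace F V)
    (he : e ∈ (extChartAt (𝓘(ℝ, B).prod 𝓘(ℝ, F)) p).source)
    (Y : ∀ e : TotalSpace F V, TotalTangent B F V e)
    (hY : DiffFieldAt (I := 𝓘(ℝ, B).prod 𝓘(ℝ, F)) Y e) :
    chartConn (I := 𝓘(ℝ, B).prod 𝓘(ℝ, F)) p (localChris p.proj D) Y e =
      chartConn (I := 𝓘(ℝ, B).prod 𝓘(ℝ, F)) e (localChris e.proj D) Y e := by
  have : T2Space (TotalSpace F V) := t2Space_totalSpace F V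
  have hs := mem_extChartAt_source (I := 𝓘(ℝ, B).prod 𝓘(ℝ, F)) e
  have hcov : ∀ q e' : TotalSpace F V, e' ∈ (extChartAt (𝓘(ℝ, B).prod 𝓘(ℝ, F)) q).source →
      IsCovariantDerivativeOn (B × F)
        (chartConn (I := 𝓘(ℝ, B).prod 𝓘(ℝ, F)) q (localChris q.proj D)) {e'} :=
    fun q e' hq => (isCovariantDerivativeOn_chartConn q _).mono (Set.singleton_subset_iff.2 hq)
  refine covariantDerivative_eq_of_mem_closure (hcov p e he) (hcov e e hs)
    (fun σ hσ => contMDiffAt_chartConn he (contDiffOn_localChris_target D p) (hσ e))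
    (fun σ hσ => contMDiffAt_chartConn hs (contDiffOn_localChris_target D e) (hσ e))
    (mem_closure_spanningPoints (B := B) e) ?_ Y hY
  filter_upwards [eventually_mem_source he, eventually_mem_source hs] with e' h1 h2 h3 σ hσ
  exact covariantDerivative_eq_of_mem_spanningPoints h3 (hcov p e' h1) (hcov e e' h2)
    (fun U X Y hX hY hU => chartConn_transport (mem_extChartAt_total_source.1 h1) hU hX.1 hY.1)
    (fun U X Y hX hY hU => chartConn_transport (mem_extChartAt_total_source.1 h2) hU hX.1 hY.1)
    σ hσ

/-- The form on the total space with prescribed components in the charts. -/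
def SmoothSymmetricForm.glue
    (G : TotalSpace F V → B × F → (B × F) →L[ℝ] (B × F) →L[ℝ] ℝ)
    (hG : ∀ p y v w, G p y v w = G p y w v)
    (hsm : ∀ p, ContDiffOn ℝ ∞ (G p) (extChartAt (𝓘(ℝ, B).prod 𝓘(ℝ, F)) p).target)
    (hcompat : ∀ p, ∀ e ∈ (extChartAt (𝓘(ℝ, B).prod 𝓘(ℝ, F)) p).source,
      chartForm (I := 𝓘(ℝ, B).prod 𝓘(ℝ, F)) p (G p) e = chartForm e (G e) e) :
    SmoothSymmetricForm B F V where
  toFun := gluedForm (I := 𝓘(ℝ, B).prod 𝓘(ℝ, F)) G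
  symm := gluedForm_symm (I := 𝓘(ℝ, B).prod 𝓘(ℝ, F)) hG
  contMDiff := contMDiff_gluedForm (I := 𝓘(ℝ, B).prod 𝓘(ℝ, F)) hsm hcompat

/-- The symmetric bilinear form on the total space induced by an odd metric. -/
def totalForm (g : OddRiemannianMetric B F V) : SmoothSymmetricForm B F V :=
  .glue (fun p => localForm p.proj g) (fun p => localForm_symm p.proj g)
    (contDiffOn_localForm_target g) (chartForm_localForm_eq g)

/-- The connection on the total space induced by a connection on the supermanifold. -/
def totalConnection (D : SuperConnection B F V) : TotalConnection B F V :=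
  gluedConn (I := 𝓘(ℝ, B).prod 𝓘(ℝ, F)) fun p => localChris p.proj D

theorem inducesForm_totalForm (g : OddRiemannianMetric B F V) : InducesForm g (totalForm g) :=
  fun _ _ _ hX hY e he => chartForm_transport (mem_coordDomain e.proj) he hX.1 hY.1

/-- Uniqueness is the gluing argument again: an inducing form is determined at spanning points, and
smoothness leaves no freedom elsewhere. -/
theorem eq_totalForm {g : OddRiemannianMetric B F V} {g' : SmoothSymmetricForm B F V}
    (h : InducesForm g g') : g' = totalForm g := by
  have key : g'.toFun = (totalForm g).toFun := by
    funext e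
    refine form_eq_of_mem_closure (g'.contMDiff e) ((totalForm g).contMDiff e)
      (mem_closure_spanningPoints (B := B) e) (Filter.Eventually.of_forall fun e' he' => ?_)
    exact eq_of_mem_spanningPoints he' (fun U X Y hX hY hU => h U X Y hX hY e' hU)
      fun U X Y hX hY hU => inducesForm_totalForm g U X Y hX hY e' hU
  cases g'
  cases hg : totalForm g
  rw [hg] at key
  simp only at key
  subst key
  rfl

theorem isPseudoRiemannian_totalForm (g : OddRiemannianMetric B F V) :
    (totalForm g).IsPseudoRiemannian := by
  intro e v hv
  have hs := mem_extChartAt_source (I := 𝓘(ℝ, B).prod 𝓘(ℝ, F)) e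
  have hc := mem_coordDomain (B := B) (F := F) (V := V) e.proj
  apply dchart_injective hs
  rw [map_zero]
  refine localForm_nondegenerate g (x₀ := e.proj)
    (y := extChartAt (𝓘(ℝ, B).prod 𝓘(ℝ, F)) e e) ?_ fun w => ?_
  · rw [extChartAt_total e e hc]
    exact totalCoord_fst_mem le_rfl hc
  · rw [← dchart_symm hs w]
    exact hv _

theorem contMDiff_totalConnection (D : SuperConnection B F V) :
    (totalConnection D).ContMDiffCovariantDerivative ∞ :=
  contMDiff_gluedConn (contDiffOn_localChris_target D) (chartConn_localChris_eq D)

theorem induces_totalConnection (D : SuperConnection B F V) : Induces D (totalConnection D) :=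
  fun _ _ _ hX hY e he => chartConn_transport (mem_coordDomain e.proj) he hX.1 hY.1

theorem contMDiffAt_of_covariantDerivative {D : TotalConnection B F V}
    (hD : D.ContMDiffCovariantDerivative ∞) (σ : ∀ e : TotalSpace F V, TotalTangent B F V e)
    (hσ : ∀ e, SmoothFieldAt (I := 𝓘(ℝ, B).prod 𝓘(ℝ, F)) σ e) (e : TotalSpace F V) :
    ContMDiffAt (𝓘(ℝ, B).prod 𝓘(ℝ, F))
      ((𝓘(ℝ, B).prod 𝓘(ℝ, F)).prod 𝓘(ℝ, (B × F) →L[ℝ] (B × F))) ∞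
      (fun e => (⟨e, D σ e⟩ : TotalSpace ((B × F) →L[ℝ] (B × F))
        (fun e : TotalSpace F V => TotalTangent B F V e →L[ℝ] TotalTangent B F V e))) e :=
  (hD.contMDiff.contMDiff (σ := σ) fun e _ => (hσ e).contMDiffWithinAt).contMDiffAt
    Filter.univ_mem

/-- Equality is asserted only on fields differentiable at the point, because the axioms of a
covariant derivative do not constrain its values on other fields. -/
theorem eq_totalConnection {D : SuperConnection B F V} {D' : TotalConnection B F V}
    (hD' : D'.ContMDiffCovariantDerivative ∞) (h : Induces D D')
    (Y : ∀ e : TotalSpace F V, TotalTangent B F V e) (e : TotalSpace F V)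
    (hY : IsDiffFieldAt B F V Y e) : D' Y e = totalConnection D Y e := by
  have : T2Space (TotalSpace F V) := t2Space_totalSpace F V
  refine covariantDerivative_eq_of_mem_closure D'.isCovariantDerivativeOn
    (totalConnection D).isCovariantDerivativeOn
    (fun σ hσ => contMDiffAt_of_covariantDerivative hD' σ hσ e)
    (fun σ hσ => contMDiffAt_of_covariantDerivative (contMDiff_totalConnection D) σ hσ e)
    (mem_closure_spanningPoints (B := B) e) (Filter.Eventually.of_forall fun e' he' σ hσ => ?_) Y hY
  exact covariantDerivative_eq_of_mem_spanningPoints he' D'.isCovariantDerivativeOn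
    (totalConnection D).isCovariantDerivativeOn (fun U X Y hX hY hU => h U X Y hX hY e' hU)
    (fun U X Y hX hY hU => induces_totalConnection D U X Y hX hY e' hU) σ hσ

theorem totalTorsionFree_totalConnection {D : SuperConnection B F V} (hD : D.IsTorsionFree) :
    TotalTorsionFree (totalConnection D) := fun X Y e _ _ =>
  gluedConn_torsionFree (I := 𝓘(ℝ, B).prod 𝓘(ℝ, F))
    (Γ := fun p : TotalSpace F V => localChris p.proj D) (e := e) (fun v w => localChris_symm hD e.proj _ v w) X Y

theorem totalCompatible_totalConnection {g : OddRiemannianMetric B F V}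
    {D : SuperConnection B F V} (hD : D.IsCompatible g) :
    TotalCompatible (totalConnection D) (totalForm g) := fun X Y Z e _ hY hZ => by
  refine gluedConn_compatible (I := 𝓘(ℝ, B).prod 𝓘(ℝ, F))
    (Γ := fun p : TotalSpace F V => localChris p.proj D)
    (G := fun p : TotalSpace F V => localForm p.proj g) (e := e) (contDiffOn_localForm_target g) (chartForm_localForm_eq g)
    (fun u v w => ?_) X Y Z hY hZ
  have hc := mem_coordDomain (B := B) (F := F) (V := V) e.proj
  refine fderiv_localForm hD ?_ u v w
  rw [extChartAt_total e e hc]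
  exact totalCoord_fst_mem le_rfl hc

end GlobalGeometry

end

end Batchelor

theorem corollary3p11
    {B : Type*} [NormedAddCommGroup B] [NormedSpace ℝ B] [FiniteDimensional ℝ B]
    {F : Type*} [NormedAddCommGroup F] [NormedSpace ℝ F] [FiniteDimensional ℝ F]
    {M : Type*} [TopologicalSpace M] [T2Space M] [SecondCountableTopology M]
    [ChartedSpace B M] [IsManifold 𝓘(ℝ, B) ∞ M]
    {V : M → Type*} [TopologicalSpace (TotalSpace F V)]
    [∀ x, AddCommGroup (V x)] [∀ x, Module ℝ (V x)] [∀ x, TopologicalSpace (V x)]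
    [FiberBundle F V] [VectorBundle ℝ F V] [ContMDiffVectorBundle ∞ F V 𝓘(ℝ, B)]
    (g : Batchelor.OddRiemannianMetric B F V) (D : Batchelor.SuperConnection B F V)
    (hD : D.IsLeviCivita g) :
    ∃ (gTE : Batchelor.SmoothSymmetricForm B F V) (DTE : Batchelor.TotalConnection B F V),
      (Batchelor.InducesForm g gTE ∧
        ∀ g' : Batchelor.SmoothSymmetricForm B F V, Batchelor.InducesForm g g' → g' = gTE) ∧
      (DTE.ContMDiffCovariantDerivative ∞ ∧ Batchelor.Induces D DTE ∧
        ∀ D' : Batchelor.TotalConnection B F V,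
          D'.ContMDiffCovariantDerivative ∞ → Batchelor.Induces D D' →
            ∀ (Y : ∀ e : TotalSpace F V, Batchelor.TotalTangent B F V e) (e : TotalSpace F V),
              Batchelor.IsDiffFieldAt B F V Y e → D' Y e = DTE Y e) ∧
      gTE.IsPseudoRiemannian ∧
      Batchelor.IsTotalLeviCivita DTE gTE :=
  ⟨Batchelor.totalForm g, Batchelor.totalConnection D,
    ⟨Batchelor.inducesForm_totalForm g, fun _ h => Batchelor.eq_totalForm h⟩,
    ⟨Batchelor.contMDiff_totalConnection D, Batchelor.induces_totalConnection D,
      fun _ hD' h Y e hY => Batchelor.eq_totalConnection hD' h Y e hY⟩,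
    Batchelor.isPseudoRiemannian_totalForm g, Batchelor.contMDiff_totalConnection D,
    Batchelor.totalTorsionFree_totalConnection hD.1,
    Batchelor.totalCompatible_totalConnection hD.2⟩
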